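/- **Setting.** Let $\mathcal V=\mathbb R^3\ni V=(g,z,\mu)$ with the supremum norm. For real coefficients $\eta_j,\gamma_j,\lambda_j,\beta_j,\theta_j,\zeta_j,\upsilon^{gg}_j,\upsilon^{gz}_j,\upsilon^{g\mu}_j,\upsilon^{zz}_j,\upsilon^{z\mu}_j$ $(j\in\mathbb N_0)$ let $\bar\varphi_j(V)=(g',z',\mu')$ with $$g'=g-\beta_jg^2,\qquad z'=z-\theta_jg^2-\zeta_jgz,$$ $$\mu'=\eta_jg+\gamma_jz+\lambda_j\mu-\upsilon^{gg}_jg^2-\upsilon^{gz}_jgz-\upsilon^{g\mu}_jg\mu-\upsilon^{zz}_jz^2-\upsilon^{z\mu}_jz\mu .$$ Fix $\Omega>1$ and put $\|\beta\|_\infty=\sup_j|\beta_j|$, $j_\Omega=\inf\{k\in\mathbb N_0:|\beta_j|\le\Omega^{-(j-k)_+}\|\beta\|_\infty\ \forall j\ge0\}\in\mathbb N_0\cup\{\infty\}$ (with $\inf\emptyset=\infty$) and $\chi_j=\Omega^{-(j-j_\Omega)_+}$. For small $g_0>0$ let $\bar V=(\bar g_j,\bar z_j,\bar\mu_j)_{j\ge0}$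 be the unique solution of $\bar V_{j+1}=\bar\varphi_j(\bar V_j)$ with $\bar g_0=g_0$, $\bar z_j\to0$, $\bar\mu_j\to0$. Let $\mathcal W_j$ be real Banach spaces and $X_j=\mathcal W_j\oplus\mathcal V$, with elements $x_j=(K_j,g_j,z_j,\mu_j)$. For $a,h>0$ let $D_j=D_j(g_0,a,h)\subset X_j$ be the set of $x_j$ with $\|K_j\|\le a\chi_j\bar g_j^3$, $|g_j-\bar g_j|\le h\bar g_j^2|\log\bar g_j|$, $|z_j-\bar z_j|\le h\chi_j\bar g_j^2|\log\bar g_j|$ and $|\mu_j-\bar\mu_j|\le h\chi_j\bar g_j^2|\log\bar g_j|$. For $\psi_j:D_j\to\mathcal W_{j+1}$ and $\rho_j:D_j\to\mathcal V$ let $\Phi_j(K,V)=(\psi_j(K,V),\bar\varphi_j(V)+\rho_j(K,V))$. **Assumptions**, with constants $\Omega,B,c,\lambda,C,a,h,\kappa,R,M,g_0$: * (A1) $|\beta_j|\le B$ for all $j$, and $\beta_j\ge c$ for all but at most $c^{-1}$ values of $j\le j_\Omega$. * (A2) $\lambda_j\ge\lambda$ for all $j$; $\zeta_j\le0$ for all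 but at most $c^{-1}$ values of $j\le j_\Omega$; and $|\eta_j|,|\gamma_j|,|\theta_j|,|\zeta_j|,|\upsilon^{\alpha\alpha'}_j|\le C\chi_j$ for all $j$. * (A3) $\psi_j,\rho_j$ are three times continuously Fréchet differentiable on $D_j=D_j(g_0,a,h)$, and for all $j$ and all $x=(K,V)\in D_j$: $\|\psi_j(0,V)\|\le R\chi_{j+1}\bar g_{j+1}^3$, $\|\rho_j(x)\|\le M\chi_{j+1}\bar g_{j+1}^3$, $\|D_K\psi_j(x)\|\le\kappa$, $\|D_K\rho_j(x)\|\le M$, and, for $\phi=\psi,\rho$, $\|D_V\phi_j(x)\|\le M\chi_{j+1}\bar g_{j+1}^2$ and, for $2\le n+m\le3$, $\|D_V^mD_K^n\phi_j(x)\|\le M(\chi_{j+1}\bar g_{j+1}^3)^{1-n}(\bar g_{j+1}^2|\log\bar g_{j+1}|)^{-m}$. **Statement.** Let $\Omega>1$, $c>0$, $\lambda>1$, $B,C\in\mathbb R$, $a>0$, $\kappa\in(0,\Omega^{-1})$, $R\in(0,a(1-\kappa\Omega))$, $M>0$, $a_*\in(R/(1-\kappa\Omega),a)$, $b\in(0,1)$.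 There is $h_*>0$ such that for every $h\ge h_*$ there is $g_*>0$, where $h_*$ depends only on these constants and $g_*$ only on these constants and $h$, such that the following holds. Let $g_0'\in(0,g_*]$ and $\|K_0'\|_{\mathcal W_0}\le a_*g_0'^3$. Let $M_{\rm ext}$ be a metric space. Suppose that the coefficients of $\bar\varphi_j$ are continuous functions of $m\in M_{\rm ext}$, that $\psi_j,\rho_j$ depend on $m$, that for every $j$ the map $(x,m)\mapsto\Phi_j(x,m)$ is continuous on $\big(\bigcup_{m'\in M_{\rm ext}}D_j(m')\big)\times M_{\rm ext}$, where $D_j(m')$ is the domain $D_j(g_0',a,h)$ for the parameter $m'$, and that for every $m\in M_{\rm ext}$ the assumptions (A1)–(A3) hold with the above constants and $g_0=g_0'$ (all independent of $m$). Then there is a neighbourhood $\mathsf N\subset\mathcal W_0\oplus\mathbb R$ of $(K_0',g_0')$, independent of $m$, such that: 1. For all $m\in M_{\rm ext}$ and $u_0=(K_0,g_0)\in\mathsf N$, the flow $\bar V=\bar V(m,g_0)$ exists and is unique; the sequence $\bar x=(\bar K,\bar V)$ with $\bar K_0=K_0$, $\bar K_{j+1}=\psi_j(\bar K_j,\bar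 V_j)$ is well defined with $\bar x_j\in D_j(m)$; and there is a unique sequence $x=x(m,u_0)=(K_j,g_j,z_j,\mu_j)_{j\ge0}$ with $x_{j+1}=\Phi_j(x_j,m)$ for all $j$, with the prescribed initial values $(K_0,g_0)=u_0$, with $z_j\to0$ and $\mu_j\to0$, and with $$\|K_j-\bar K_j\|\le b(a-a_*)\chi_j\bar g_j^3,\qquad |g_j-\bar g_j|\le bh\bar g_j^2|\log\bar g_j|,$$ $$|z_j-\bar z_j|\le bh\chi_j\bar g_j^2|\log\bar g_j|,\qquad |\mu_j-\bar\mu_j|\le bh\chi_j\bar g_j^2|\log\bar g_j|$$ for all $j$ (where $\chi_j$ and $\bar x_j$ belong to the parameter $m$ and the initial condition $u_0$); moreover $x_j\in D_j(m)$ for all $j$. 2. For every $j\in\mathbb N_0$ the map $(m,u_0)\mapsto x_j(m,u_0)\in X_j$ is continuous on $M_{\rm ext}\times\mathsf N$. -/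

import Mathlib

open Filter Topology

noncomputable section

namespace QuadFlow

/-- The coupling space `ℝ³` with elements `V = (g, z, μ)`; the product norm is the supremum norm. -/
abbrev Coupling : Type := ℝ × ℝ × ℝ

/-- The real coefficients of the quadratic maps, one sequence in the scale `j` for each. -/
structure Coeffs where
  eta : ℕ → ℝ
  gamma : ℕ → ℝ
  lam : ℕ → ℝ
  beta : ℕ → ℝ
  theta : ℕ → ℝ
  zeta : ℕ → ℝ
  ups_gg : ℕ → ℝ
  ups_gz : ℕ → ℝ
  ups_gmu : ℕ → ℝ
  ups_zz : ℕ → ℝ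
  ups_zmu : ℕ → ℝ

/-- The quadratic map `φ̄_j`, written out in the coordinates `V = (g, z, μ)`. -/
def quadMap (P : Coeffs) (j : ℕ) (V : Coupling) : Coupling :=
  (V.1 - P.beta j * V.1 ^ 2,
    V.2.1 - (P.theta j * V.1 ^ 2 + P.zeta j * V.1 * V.2.1),
    P.eta j * V.1 + P.gamma j * V.2.1 + P.lam j * V.2.2
      - (P.ups_gg j * V.1 ^ 2 + P.ups_gz j * V.1 * V.2.1 + P.ups_gmu j * V.1 * V.2.2
        + P.ups_zz j * V.2.1 ^ 2 + P.ups_zmu j * V.2.1 * V.2.2))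

/-- The cut-off time `j_Ω` of a sequence `β`; it is `⊤` if no `k` qualifies. The natural number
`j - k` is the positive part of the difference. -/
def cutoffTime (Ω : ℝ) (β : ℕ → ℝ) : ℕ∞ :=
  sInf ((fun k : ℕ => (k : ℕ∞)) '' {k : ℕ | ∀ j, |β j| ≤ (Ω ^ (j - k))⁻¹ * ⨆ i, |β i|})

/-- `χ_j = Ω ^ (-(j - j_Ω)₊)`; the subtraction in `ℕ∞` is truncated and `j - ⊤ = 0`. -/
def chi (Ω : ℝ) (β : ℕ → ℝ) (j : ℕ) : ℝ :=
  (Ω ^ ((j : ℕ∞) - cutoffTime Ω β).toNat)⁻¹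

/-- Assumption (A1) with constants `Ω`, `B`, `c`. -/
structure AssumptionA1 (Ω B c : ℝ) (P : Coeffs) : Prop where
  beta_bdd : ∀ j, |P.beta j| ≤ B
  exceptional_finite : {j : ℕ | (j : ℕ∞) ≤ cutoffTime Ω P.beta ∧ P.beta j < c}.Finite
  exceptional_card :
    ({j : ℕ | (j : ℕ∞) ≤ cutoffTime Ω P.beta ∧ P.beta j < c}.ncard : ℝ) ≤ c⁻¹

/-- Assumption (A2) with constants `Ω`, `c`, `lam₀` (the lower bound on the `λ_j`) and `C` (the
constant in the bounds `O(χ_j)`). -/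
structure AssumptionA2 (Ω c lam₀ C : ℝ) (P : Coeffs) : Prop where
  le_lam : ∀ j, lam₀ ≤ P.lam j
  exceptional_finite : {j : ℕ | (j : ℕ∞) ≤ cutoffTime Ω P.beta ∧ 0 < P.zeta j}.Finite
  exceptional_card :
    ({j : ℕ | (j : ℕ∞) ≤ cutoffTime Ω P.beta ∧ 0 < P.zeta j}.ncard : ℝ) ≤ c⁻¹
  eta_le : ∀ j, |P.eta j| ≤ C * chi Ω P.beta j
  gamma_le : ∀ j, |P.gamma j| ≤ C * chi Ω P.beta j
  theta_le : ∀ j, |P.theta j| ≤ C * chi Ω P.beta j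
  zeta_le : ∀ j, |P.zeta j| ≤ C * chi Ω P.beta j
  ups_gg_le : ∀ j, |P.ups_gg j| ≤ C * chi Ω P.beta j
  ups_gz_le : ∀ j, |P.ups_gz j| ≤ C * chi Ω P.beta j
  ups_gmu_le : ∀ j, |P.ups_gmu j| ≤ C * chi Ω P.beta j
  ups_zz_le : ∀ j, |P.ups_zz j| ≤ C * chi Ω P.beta j
  ups_zmu_le : ∀ j, |P.ups_zmu j| ≤ C * chi Ω P.beta j

/-- Every coefficient is a continuous function of the external parameter. -/
structure ContinuousCoeffs {E : Type*} [TopologicalSpace E] (P : E → Coeffs) : Prop where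
  eta : ∀ j, Continuous fun m => (P m).eta j
  gamma : ∀ j, Continuous fun m => (P m).gamma j
  lam : ∀ j, Continuous fun m => (P m).lam j
  beta : ∀ j, Continuous fun m => (P m).beta j
  theta : ∀ j, Continuous fun m => (P m).theta j
  zeta : ∀ j, Continuous fun m => (P m).zeta j
  ups_gg : ∀ j, Continuous fun m => (P m).ups_gg j
  ups_gz : ∀ j, Continuous fun m => (P m).ups_gz j
  ups_gmu : ∀ j, Continuous fun m => (P m).ups_gmu j
  ups_zz : ∀ j, Continuous fun m => (P m).ups_zz j
  ups_zmu : ∀ j, Continuous fun m => (P m).ups_zmu j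

/-- `V` is a global flow of `φ̄` with initial condition `g₀` and final condition
`(z_∞, μ_∞) = (0, 0)`. -/
structure IsQuadFlow (P : Coeffs) (g₀ : ℝ) (V : ℕ → Coupling) : Prop where
  init : (V 0).1 = g₀
  step : ∀ j, V (j + 1) = quadMap P j (V j)
  z_lim : Tendsto (fun j => (V j).2.1) atTop (𝓝 0)
  mu_lim : Tendsto (fun j => (V j).2.2) atTop (𝓝 0)

/-- The flow `V̄ = (ḡ, z̄, μ̄)` with initial condition `g₀`: the flow described by `IsQuadFlow`
(used only where it exists and is unique). -/
def quadFlow (P : Coeffs) (g₀ : ℝ) : ℕ → Coupling :=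
  Classical.epsilon (IsQuadFlow P g₀)

/-- The sequence `ḡ` with initial condition `g₀`. -/
def gbar (P : Coeffs) (g₀ : ℝ) (j : ℕ) : ℝ := (quadFlow P g₀ j).1

section Perturbation

variable {W : ℕ → Type*} [∀ j, NormedAddCommGroup (W j)] [∀ j, NormedSpace ℝ (W j)]

/-- The domain `D_j(g₀, a, h) ⊆ X_j = W_j ⊕ ℝ³`. -/
def domain (W : ℕ → Type*) [∀ j, NormedAddCommGroup (W j)]
    (Ω a h g₀ : ℝ) (P : Coeffs) (j : ℕ) : Set (W j × Coupling) :=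
  {x | ‖x.1‖ ≤ a * (chi Ω P.beta j * gbar P g₀ j ^ 3) ∧
    |x.2.1 - gbar P g₀ j| ≤ h * (gbar P g₀ j ^ 2 * |Real.log (gbar P g₀ j)|) ∧
    |x.2.2.1 - (quadFlow P g₀ j).2.1|
      ≤ h * (chi Ω P.beta j * gbar P g₀ j ^ 2 * |Real.log (gbar P g₀ j)|) ∧
    |x.2.2.2 - (quadFlow P g₀ j).2.2|
      ≤ h * (chi Ω P.beta j * gbar P g₀ j ^ 2 * |Real.log (gbar P g₀ j)|)}

/-- The partial Fréchet derivative `D_K f(x)` of a map defined on `s ⊆ A ⊕ ℝ³`. -/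
def derivK {A F : Type*} [NormedAddCommGroup A] [NormedSpace ℝ A] [NormedAddCommGroup F]
    [NormedSpace ℝ F] (f : A × Coupling → F) (s : Set (A × Coupling)) (x : A × Coupling) :
    A →L[ℝ] F :=
  (fderivWithin ℝ f s x).comp (ContinuousLinearMap.inl ℝ A Coupling)

/-- The partial Fréchet derivative `D_V f(x)` of a map defined on `s ⊆ A ⊕ ℝ³`. -/
def derivV {A F : Type*} [NormedAddCommGroup A] [NormedSpace ℝ A] [NormedAddCommGroup F]
    [NormedSpace ℝ F] (f : A × Coupling → F) (s : Set (A × Coupling)) (x : A × Coupling) :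
    Coupling →L[ℝ] F :=
  (fderivWithin ℝ f s x).comp (ContinuousLinearMap.inr ℝ A Coupling)

/-- The operator norm of the multilinear map `D_V^m D_K^n f(x)` is at most `C`: the total derivative
of order `n + m` is evaluated on `n` vectors of `A` and `m` vectors of `ℝ³`. -/
def MixedDerivBound {A F : Type*} [NormedAddCommGroup A] [NormedSpace ℝ A] [NormedAddCommGroup F]
    [NormedSpace ℝ F] (f : A × Coupling → F) (s : Set (A × Coupling)) (x : A × Coupling)
    (n m : ℕ) (C : ℝ) : Prop :=
  ∀ (k : Fin n → A) (v : Fin m → Coupling),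
    ‖iteratedFDerivWithin ℝ (n + m) f s x
        (Fin.append (fun i => ((k i, 0) : A × Coupling)) (fun i => ((0, v i) : A × Coupling)))‖
      ≤ C * ((∏ i, ‖k i‖) * ∏ i, ‖v i‖)

/-- Assumption (A3) on the perturbation `(ψ_j, ρ_j)`, with parameters `(g₀, a, h, κ, Ω, R, M)`.
The maps are total functions of which only the restrictions to the domains `D_j` matter. -/
structure AssumptionA3 (Ω a h κ R M g₀ : ℝ) (P : Coeffs)
    (ψ : ∀ j, W j × Coupling → W (j + 1)) (ρ : ∀ j, W j × Coupling → Coupling) : Prop where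
  psi_contDiff : ∀ j, ContDiffOn ℝ 3 (ψ j) (domain W Ω a h g₀ P j)
  rho_contDiff : ∀ j, ContDiffOn ℝ 3 (ρ j) (domain W Ω a h g₀ P j)
  psi_le : ∀ j, ∀ x ∈ domain W Ω a h g₀ P j,
    ‖ψ j (0, x.2)‖ ≤ R * (chi Ω P.beta (j + 1) * gbar P g₀ (j + 1) ^ 3)
  rho_le : ∀ j, ∀ x ∈ domain W Ω a h g₀ P j,
    ‖ρ j x‖ ≤ M * (chi Ω P.beta (j + 1) * gbar P g₀ (j + 1) ^ 3)
  derivK_psi_le : ∀ j, ∀ x ∈ domain W Ω a h g₀ P j,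
    ‖derivK (ψ j) (domain W Ω a h g₀ P j) x‖ ≤ κ
  derivK_rho_le : ∀ j, ∀ x ∈ domain W Ω a h g₀ P j,
    ‖derivK (ρ j) (domain W Ω a h g₀ P j) x‖ ≤ M
  derivV_psi_le : ∀ j, ∀ x ∈ domain W Ω a h g₀ P j,
    ‖derivV (ψ j) (domain W Ω a h g₀ P j) x‖
      ≤ M * (chi Ω P.beta (j + 1) * gbar P g₀ (j + 1) ^ 2)
  derivV_rho_le : ∀ j, ∀ x ∈ domain W Ω a h g₀ P j,
    ‖derivV (ρ j) (domain W Ω a h g₀ P j) x‖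
      ≤ M * (chi Ω P.beta (j + 1) * gbar P g₀ (j + 1) ^ 2)
  higher_psi_le : ∀ j, ∀ x ∈ domain W Ω a h g₀ P j, ∀ n m : ℕ, 2 ≤ n + m → n + m ≤ 3 →
    MixedDerivBound (ψ j) (domain W Ω a h g₀ P j) x n m
      (M * (chi Ω P.beta (j + 1) * gbar P g₀ (j + 1) ^ 3) ^ (1 - (n : ℤ))
        * (gbar P g₀ (j + 1) ^ 2 * |Real.log (gbar P g₀ (j + 1))|) ^ (-(m : ℤ)))
  higher_rho_le : ∀ j, ∀ x ∈ domain W Ω a h g₀ P j, ∀ n m : ℕ, 2 ≤ n + m → n + m ≤ 3 →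
    MixedDerivBound (ρ j) (domain W Ω a h g₀ P j) x n m
      (M * (chi Ω P.beta (j + 1) * gbar P g₀ (j + 1) ^ 3) ^ (1 - (n : ℤ))
        * (gbar P g₀ (j + 1) ^ 2 * |Real.log (gbar P g₀ (j + 1))|) ^ (-(m : ℤ)))

/-- The evolution map `Φ_j(K, V) = (ψ_j(K, V), φ̄_j(V) + ρ_j(K, V))`. -/
def evolution (P : Coeffs) (ψ : ∀ j, W j × Coupling → W (j + 1))
    (ρ : ∀ j, W j × Coupling → Coupling) (j : ℕ) (x : W j × Coupling) : W (j + 1) × Coupling :=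
  (ψ j x, quadMap P j x.2 + ρ j x)

/-- The sequence `K̄_0 = K₀`, `K̄_{j+1} = ψ_j(K̄_j, V̄_j)`. -/
def approxK (ψ : ∀ j, W j × Coupling → W (j + 1)) (V : ℕ → Coupling) (K₀ : W 0) : ∀ j, W j
  | 0 => K₀
  | j + 1 => ψ j (approxK ψ V K₀ j, V j)

/-- The approximate flow `x̄ = (K̄, V̄)`, the flow of `Φ̄ = (ψ, φ̄)` with initial condition
`u₀ = (K₀, g₀)` and final condition `(z̄_∞, μ̄_∞) = (0, 0)`. -/
def approxFlow (P : Coeffs) (ψ : ∀ j, W j × Coupling → W (j + 1)) (u₀ : W 0 × ℝ) (j : ℕ) :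
    W j × Coupling :=
  (approxK ψ (quadFlow P u₀.2) u₀.1 j, quadFlow P u₀.2 j)

/-- `x` is a global flow of `Φ` with initial condition `(K_0, g_0) = u₀` and final condition
`(z_∞, μ_∞) = (0, 0)`. -/
structure IsGlobalFlow (P : Coeffs) (ψ : ∀ j, W j × Coupling → W (j + 1))
    (ρ : ∀ j, W j × Coupling → Coupling) (u₀ : W 0 × ℝ) (x : ∀ j, W j × Coupling) : Prop where
  init_K : (x 0).1 = u₀.1
  init_g : (x 0).2.1 = u₀.2
  step : ∀ j, x (j + 1) = evolution P ψ ρ j (x j)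
  z_lim : Tendsto (fun j => (x j).2.2.1) atTop (𝓝 0)
  mu_lim : Tendsto (fun j => (x j).2.2.2) atTop (𝓝 0)

/-- The bounds on the distance of `x` from the approximate flow with initial condition `u₀`. -/
structure FlowBounds (Ω a aStar h b : ℝ) (P : Coeffs) (ψ : ∀ j, W j × Coupling → W (j + 1))
    (u₀ : W 0 × ℝ) (x : ∀ j, W j × Coupling) : Prop where
  K_le : ∀ j, ‖(x j).1 - (approxFlow P ψ u₀ j).1‖
    ≤ b * (a - aStar) * (chi Ω P.beta j * gbar P u₀.2 j ^ 3)
  g_le : ∀ j, |(x j).2.1 - (approxFlow P ψ u₀ j).2.1|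
    ≤ b * h * (gbar P u₀.2 j ^ 2 * |Real.log (gbar P u₀.2 j)|)
  z_le : ∀ j, |(x j).2.2.1 - (approxFlow P ψ u₀ j).2.2.1|
    ≤ b * h * (chi Ω P.beta j * gbar P u₀.2 j ^ 2 * |Real.log (gbar P u₀.2 j)|)
  mu_le : ∀ j, |(x j).2.2.2 - (approxFlow P ψ u₀ j).2.2.2|
    ≤ b * h * (chi Ω P.beta j * gbar P u₀.2 j ^ 2 * |Real.log (gbar P u₀.2 j)|)

end Perturbation

end QuadFlow

end

open QuadFlow

namespace QuadFlow

/-! ### The cut-off weights -/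

/-! The flow is the fixed point of a Picard map on sequences, in a tube around the quadratic flow
`(0, ḡ, z̄, μ̄)` started at `g₀'`. The estimates rest on `ḡ`. Since `1/ḡ_{j+1} ≥ 1/ḡ_j + β_j`, and
`β_j ≥ c χ_j` up to an error of bounded total mass (`exists_error_weight`), `ḡ` is almost
decreasing, `Σ_{k<j} χ_k ḡ_k = O(|log ḡ_j|)`, `Σ_{k≥j} χ_k ḡ_k² = O(χ_j ḡ_j)` and `χ_j ḡ_j² =
O((j+1)⁻²)`. The components `z̄`, `μ̄` have a final condition and are given by convergent series
from infinity (`backSum`).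

The Picard map treats each direction according to its stability. `K` contracts, because `κΩ < 1`
beats the loss in the weight `χ ḡ³`. The `g`-equation is solved forward with a linear part for which
`ḡ_j²` is an exact homogeneous solution; a source `O(χ ḡ³)` divided by `ḡ²` sums to a logarithm,
hence the weight `ḡ²|log ḡ|`. The `z`-equation is neutral up to summable effects and is solved from
infinity. The `μ`-equation expands, and inverting one step gains `λ⁻¹`. New `g`- and `z`-components
are inserted as soon as they are computed, so their bounds do not grow with `h`: first `h` is taken
large, then the coupling small depending on `h`, and the map becomes a contraction preserving a
smaller tube (`FlowEnv.picard_mem_tube`, `FlowEnv.picard_contraction`, `exists_fixedPoint`).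

One tube, around the flow from `g₀'`, serves all nearby `u₀`. The approximate flow is the flow for
`ρ = 0`, so it lies in the same smaller tube; comparing the two gives the stated bounds, and
conversely these bounds force a sequence into the large tube, where fixed points are unique.
Continuity holds because each Picard iterate is continuous (series dominated by `(l+1)⁻²`) and the
iterates converge geometrically, uniformly in `(m, u₀)` (`continuous_flow`). -/

theorem chi_cases (Ω : ℝ) (β : ℕ → ℝ) :
    (cutoffTime Ω β = ⊤ ∧ ∀ j, chi Ω β j = 1) ∨
      ∃ N : ℕ, cutoffTime Ω β = N ∧ (∀ j, chi Ω β j = (Ω ^ (j - N))⁻¹) ∧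
        ∀ j, |β j| ≤ (Ω ^ (j - N))⁻¹ * ⨆ i, |β i| := by
  set S : Set ℕ := {k : ℕ | ∀ j, |β j| ≤ (Ω ^ (j - k))⁻¹ * ⨆ i, |β i|} with hS
  rcases S.eq_empty_or_nonempty with h | h
  · have ht : cutoffTime Ω β = ⊤ := by
      unfold cutoffTime; rw [← hS, h]; simp
    refine Or.inl ⟨ht, fun j => ?_⟩
    simp [chi, ht]
  -- The infimum of a nonempty set is attained, so the cut-off time itself satisfies the defining
  -- inequality.
  · have hmem := csInf_mem (h.image (fun k : ℕ => (k : ℕ∞)))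
    obtain ⟨N, hN, hNe⟩ := hmem
    have ht : cutoffTime Ω β = N := hNe.symm
    refine Or.inr ⟨N, ht, fun j => ?_, hN⟩
    have : ((j : ℕ∞) - (N : ℕ∞)).toNat = j - N := by
      rw [← ENat.natCast_sub, ENat.toNat_natCast]
    simp [chi, ht, this]

/-- The properties of the weights `χ_j` that the analysis uses. -/
structure CutoffWeight (Ω : ℝ) (χ : ℕ → ℝ) : Prop where
  zero : χ 0 = 1
  pos : ∀ j, 0 < χ j
  le_one : ∀ j, χ j ≤ 1
  succ_le : ∀ j, χ (j + 1) ≤ χ j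
  le_mul_succ : ∀ j, χ j ≤ Ω * χ (j + 1)
  -- Either the cut-off has not been passed, or the weights are exactly geometric from `j` on.
  eq_one_or : ∀ j, χ j = 1 ∨ ∀ l, χ (j + l) = χ j * (Ω ^ l)⁻¹

theorem cutoffWeight_chi {Ω : ℝ} (hΩ : 1 < Ω) (β : ℕ → ℝ) : CutoffWeight Ω (chi Ω β) := by
  have h0 : 0 < Ω := by linarith
  rcases chi_cases Ω β with ⟨-, h⟩ | ⟨N, -, h, -⟩
  · constructor <;> intros <;> simp [h]
    linarith
  · constructor
    · simp [h]
    · intro j; rw [h]; positivity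
    · intro j; rw [h]; exact inv_le_one_of_one_le₀ (one_le_pow₀ hΩ.le)
    · intro j; rw [h, h]
      exact inv_anti₀ (by positivity) (pow_le_pow_right₀ hΩ.le (by omega))
    · intro j
      rw [h, h, ← div_eq_mul_inv, inv_eq_one_div, div_le_div_iff₀ (by positivity) (by positivity),
        one_mul, ← pow_succ']
      exact pow_le_pow_right₀ hΩ.le (by omega)
    · intro j
      rcases le_total N j with hj | hj
      · right; intro l
        rw [h, h, ← mul_inv, ← pow_add]; congr 2; omega
      · left; rw [h, Nat.sub_eq_zero_of_le hj]; simp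

/-- Up to the cut-off the weight is 1; beyond it the decay of `β` is what defines the cut-off time.
-/
theorem abs_beta_le_chi {Ω B : ℝ} (hΩ : 1 < Ω) {β : ℕ → ℝ} (hβ : ∀ j, |β j| ≤ B) (j : ℕ) :
    |β j| ≤ B * chi Ω β j := by
  rcases chi_cases Ω β with ⟨-, h⟩ | ⟨N, -, h, h'⟩
  · simpa [h] using hβ j
  · rw [h, mul_comm]
    refine (h' j).trans ?_
    have : 0 < Ω := by linarith
    gcongr
    exact ciSup_le hβ

/-- Strictly beyond the cut-off the exponents start at 1, and the sum of `Ω⁻ⁿ` over `n ≥ 1` is `(Ω -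
1)⁻¹`. -/
theorem sum_inv_pow_sub_le {Ω : ℝ} (hΩ : 1 < Ω) (N : ℕ) (F : Finset ℕ) (hF : ∀ j ∈ F, N < j) :
    ∑ j ∈ F, (Ω ^ (j - N))⁻¹ ≤ (Ω - 1)⁻¹ := by
  have h0 : 0 < Ω := by linarith
  have hq : Ω⁻¹ < 1 := inv_lt_one_of_one_lt₀ hΩ
  have hinj : Set.InjOn (fun j => j - N - 1) (F : Set ℕ) := by
    intro x hx y hy hxy
    have := hF x hx; have := hF y hy
    simp only at hxy; omega
  have hsum := (hasSum_geometric_of_lt_one (inv_nonneg.2 h0.le) hq).mul_left Ω⁻¹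
  calc ∑ j ∈ F, (Ω ^ (j - N))⁻¹ = ∑ n ∈ F.image (fun j => j - N - 1), Ω⁻¹ * Ω⁻¹ ^ n := by
        rw [Finset.sum_image hinj]
        refine Finset.sum_congr rfl fun j hj => ?_
        have := hF j hj
        rw [← pow_succ', show j - N - 1 + 1 = j - N by omega, inv_pow]
    _ ≤ Ω⁻¹ * (1 - Ω⁻¹)⁻¹ := sum_le_hasSum _ (fun n _ => by positivity) hsum
    _ = (Ω - 1)⁻¹ := by
        have : Ω - 1 ≠ 0 := by linarith
        field_simp

/-- A property that fails only for at most `c⁻¹` scales up to the cut-off time holds up to an error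
weight of bounded total mass. -/
theorem exists_error_weight {Ω c : ℝ} (hΩ : 1 < Ω) (β : ℕ → ℝ) (bad : ℕ → Prop)
    (hfin : {j : ℕ | (j : ℕ∞) ≤ cutoffTime Ω β ∧ bad j}.Finite)
    (hcard : ({j : ℕ | (j : ℕ∞) ≤ cutoffTime Ω β ∧ bad j}.ncard : ℝ) ≤ c⁻¹) :
    ∃ e : ℕ → ℝ, (∀ j, 0 ≤ e j) ∧ (∀ F : Finset ℕ, ∑ j ∈ F, e j ≤ c⁻¹ + (Ω - 1)⁻¹) ∧
      ∀ j, e j = chi Ω β j ∨ (chi Ω β j = 1 ∧ e j = 0 ∧ ¬ bad j) := by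
  classical
  set t := cutoffTime Ω β with ht
  have hw := cutoffWeight_chi hΩ β
  -- The error vanishes at good scales up to the cut-off and equals `χ` elsewhere: exceptional
  -- scales contribute at most `c⁻¹`, the tail at most `(Ω - 1)⁻¹`.
  refine ⟨fun j => if (j : ℕ∞) ≤ t ∧ ¬ bad j then 0 else chi Ω β j, fun j => ?_, fun F => ?_,
    fun j => ?_⟩
  · dsimp only; split_ifs
    · exact le_rfl
    · exact (hw.pos j).le
  · have h1 : ∑ j ∈ F.filter (fun j : ℕ => (j : ℕ∞) ≤ t), (if (j : ℕ∞) ≤ t ∧ ¬ bad j then 0 else chi Ω β j)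
        ≤ c⁻¹ := by
      refine le_trans ?_ hcard
      rw [Set.ncard_eq_toFinset_card _ hfin]
      calc _ ≤ ∑ j ∈ F.filter (fun j : ℕ => (j : ℕ∞) ≤ t), (if bad j then (1 : ℝ) else 0) := by
            refine Finset.sum_le_sum fun j hj => ?_
            have := (Finset.mem_filter.1 hj).2
            by_cases hb : bad j <;> simp [this, hb, hw.le_one j]
        _ = (((F.filter (fun j : ℕ => (j : ℕ∞) ≤ t)).filter bad).card : ℝ) := by
            rw [← Finset.sum_filter]; simp
        _ ≤ _ := by
            norm_cast
            refine Finset.card_le_card fun j hj => ?_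
            simp only [Finset.mem_filter] at hj
            simp [hj.1.2, hj.2]
    have h2 : ∑ j ∈ F.filter (fun j : ℕ => ¬ (j : ℕ∞) ≤ t), (if (j : ℕ∞) ≤ t ∧ ¬ bad j then 0 else chi Ω β j)
        ≤ (Ω - 1)⁻¹ := by
      rcases chi_cases Ω β with ⟨htop, -⟩ | ⟨N, hN, h, -⟩
      · have : ∀ j ∈ F, ¬ ¬ (j : ℕ∞) ≤ t := by intro j _; rw [ht, htop]; simp
        rw [Finset.filter_false_of_mem this]
        simp; linarith
      · calc _ = ∑ j ∈ F.filter (fun j : ℕ => ¬ (j : ℕ∞) ≤ t), (Ω ^ (j - N))⁻¹ := by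
              refine Finset.sum_congr rfl fun j hj => ?_
              have := (Finset.mem_filter.1 hj).2
              simp [this, h]
          _ ≤ _ := by
              refine sum_inv_pow_sub_le hΩ N _ fun j hj => ?_
              have := (Finset.mem_filter.1 hj).2
              rw [ht, hN] at this
              simpa using this
    rw [← Finset.sum_filter_add_sum_filter_not F (fun j : ℕ => (j : ℕ∞) ≤ t)]
    exact add_le_add h1 h2
  · dsimp only
    split_ifs with hj
    · right
      refine ⟨?_, rfl, hj.2⟩
      rcases chi_cases Ω β with ⟨htop, h⟩ | ⟨N, hN, h, -⟩
      · exact h j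
      · have h3 := hj.1
        rw [ht, hN] at h3
        have : j ≤ N := by exact_mod_cast h3
        rw [h, Nat.sub_eq_zero_of_le this]; simp
    · exact Or.inl rfl

theorem CutoffWeight.antitone {Ω : ℝ} {χ : ℕ → ℝ} (hχ : CutoffWeight Ω χ) : Antitone χ :=
  antitone_nat_of_succ_le hχ.succ_le

/-- The sums of the weights grow linearly, up to the loss that the weights themselves account
for. -/
theorem exists_chi_mul_sq_le {Ω : ℝ} (hΩ : 1 < Ω) :
    ∃ A : ℝ, 0 < A ∧ ∀ β : ℕ → ℝ, ∀ l : ℕ,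
      chi Ω β l * ((l : ℝ) + 1) ^ 2 ≤ A * (1 + ∑ k ∈ Finset.range l, chi Ω β k) ^ 2 := by
  have h0 : 0 < Ω := by linarith
  -- With `n` counted from the cut-off, geometric decay beats the quadratic growth.
  obtain ⟨A, hA⟩ : ∃ A : ℝ, ∀ n : ℕ, ((n : ℝ) + 1) ^ 2 * (Ω ^ n)⁻¹ ≤ A := by
    have h1 := tendsto_pow_const_div_const_pow_of_one_lt 2 hΩ
    obtain ⟨A, hA⟩ := h1.bddAbove_range
    refine ⟨A * Ω, fun n => ?_⟩
    have := hA ⟨n + 1, rfl⟩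
    simp only [Nat.cast_add, Nat.cast_one] at this
    rw [div_le_iff₀ (by positivity)] at this
    rw [← div_eq_mul_inv, div_le_iff₀ (by positivity)]
    rw [pow_succ Ω] at this
    linarith
  have hA1 : 1 ≤ A := by simpa using hA 0
  refine ⟨A, by linarith, fun β l => ?_⟩
  have hlow : ∀ n : ℕ, (∀ k < n, chi Ω β k = 1) → n ≤ l →
      (n : ℝ) ≤ ∑ k ∈ Finset.range l, chi Ω β k := by
    intro n hn hnl
    calc (n : ℝ) = ∑ k ∈ Finset.range n, chi Ω β k := by
          rw [Finset.sum_congr rfl fun k hk => hn k (Finset.mem_range.1 hk)]; simp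
      _ ≤ _ := Finset.sum_le_sum_of_subset_of_nonneg (by simpa using hnl)
          fun k _ _ => ((cutoffWeight_chi hΩ β).pos k).le
  have hw := cutoffWeight_chi hΩ β
  by_cases hl : ∀ k < l, chi Ω β k = 1
  · have h1 := hlow l hl le_rfl
    have h2 : chi Ω β l * ((l : ℝ) + 1) ^ 2 ≤ 1 * ((l : ℝ) + 1) ^ 2 := by
      gcongr; exact hw.le_one l
    have h3 : ((l : ℝ) + 1) ^ 2 ≤ (1 + ∑ k ∈ Finset.range l, chi Ω β k) ^ 2 := by
      rw [add_comm]; gcongr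
    nlinarith [sq_nonneg (1 + ∑ k ∈ Finset.range l, chi Ω β k)]
  · rcases chi_cases Ω β with ⟨-, h⟩ | ⟨N, -, h, -⟩
    · exact absurd (fun k _ => h k) hl
    · have hNl : N ≤ l := by
        by_contra hcon
        refine hl fun k hk => ?_
        rw [h, Nat.sub_eq_zero_of_le (by omega)]; simp
      have h1 := hlow N (fun k hk => by rw [h, Nat.sub_eq_zero_of_le hk.le]; simp) hNl
      obtain ⟨n, rfl⟩ := Nat.exists_eq_add_of_le hNl
      have h2 := hA n
      rw [h, Nat.add_sub_cancel_left]
      have hpos : (0 : ℝ) < (Ω ^ n)⁻¹ := by positivity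
      -- This separates the `N` scales before the cut-off, which the sum of weights counts, from the
      -- `n` scales after it, which `A` absorbs.
      have h3 : ((N + n : ℕ) : ℝ) + 1 ≤ (N + 1) * (n + 1) := by
        push_cast; nlinarith [mul_nonneg (Nat.cast_nonneg (α := ℝ) N) (Nat.cast_nonneg (α := ℝ) n)]
      calc (Ω ^ n)⁻¹ * (((N + n : ℕ) : ℝ) + 1) ^ 2
          ≤ (Ω ^ n)⁻¹ * (((N : ℝ) + 1) * (n + 1)) ^ 2 := by gcongr
        _ = ((n : ℝ) + 1) ^ 2 * (Ω ^ n)⁻¹ * (1 + (N : ℝ)) ^ 2 := by ring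
        _ ≤ A * (1 + (N : ℝ)) ^ 2 := by gcongr
        _ ≤ _ := by gcongr


/-! ### The running coupling `ḡ` -/

/-- The solution of `g_{j+1} = g_j - β_j g_j²` with initial value `g₀`. -/
def gSeq (β : ℕ → ℝ) (g₀ : ℝ) : ℕ → ℝ
  | 0 => g₀
  | j + 1 => gSeq β g₀ j - β j * gSeq β g₀ j ^ 2

/-- The sequence `β` is bounded by the weights, and bounded below by them up to an error of total
mass at most `S`. -/
structure BetaBounds (Ω B c S : ℝ) (χ β : ℕ → ℝ) : Prop where
  weight : CutoffWeight Ω χ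
  abs_beta_le : ∀ j, |β j| ≤ B * χ j
  lower : ∃ e : ℕ → ℝ, (∀ j, 0 ≤ e j) ∧ (∀ j n, ∑ k ∈ Finset.range n, e (j + k) ≤ S) ∧
    ∀ j, c * χ j ≤ β j + e j

namespace BetaBounds

variable {Ω B c S : ℝ} {χ β : ℕ → ℝ}

theorem nonneg (hb : BetaBounds Ω B c S χ β) : 0 ≤ S := by
  obtain ⟨e, -, he, -⟩ := hb.lower
  simpa using he 0 0

/-- The form in which the lower bound on `β` is used: summed against a bounded nonnegative sequence,
all bad scales together cost at most `S` times its bound. -/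
theorem sum_lower (hb : BetaBounds Ω B c S χ β) (w : ℕ → ℝ) (W : ℝ) (j n : ℕ)
    (hw0 : ∀ k, 0 ≤ w (j + k)) (hw : ∀ k, w (j + k) ≤ W) :
    c * ∑ k ∈ Finset.range n, χ (j + k) * w (j + k)
      ≤ (∑ k ∈ Finset.range n, β (j + k) * w (j + k)) + S * W := by
  obtain ⟨e, he0, he, hlow⟩ := hb.lower
  have hW : 0 ≤ W := (hw0 0).trans (hw 0)
  calc c * ∑ k ∈ Finset.range n, χ (j + k) * w (j + k)
      = ∑ k ∈ Finset.range n, (c * χ (j + k)) * w (j + k) := by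
        rw [Finset.mul_sum]; exact Finset.sum_congr rfl fun k _ => by ring
    _ ≤ ∑ k ∈ Finset.range n, (β (j + k) * w (j + k) + e (j + k) * W) := by
        refine Finset.sum_le_sum fun k _ => ?_
        have h1 := mul_le_mul_of_nonneg_right (hlow (j + k)) (hw0 k)
        have h2 := mul_le_mul_of_nonneg_left (hw k) (he0 (j + k))
        linarith
    _ = (∑ k ∈ Finset.range n, β (j + k) * w (j + k)) + (∑ k ∈ Finset.range n, e (j + k)) * W := by
        rw [Finset.sum_add_distrib, Finset.sum_mul]
    _ ≤ _ := by gcongr; exact he j n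

theorem step_aux (hb : BetaBounds Ω B c S χ β) (hB : 0 ≤ B) {g₀ t : ℝ} {j : ℕ}
    (hBg : 4 * B * g₀ ≤ 1) (ht : 0 < t) (ht2 : t ≤ 2 * g₀) :
    |β j * t| ≤ 1 / 2 := by
  rw [abs_mul, abs_of_pos ht]
  have h1 : |β j| ≤ B := (hb.abs_beta_le j).trans (by
    nlinarith [hb.weight.le_one j])
  nlinarith [abs_nonneg (β j)]

/-- Since `1/(1 - y) ≥ 1 + y` for `y < 1`, the reciprocal of the coupling grows by at least `b`. -/
theorem inv_step {b t : ℝ} (ht : 0 < t) (h : |b * t| ≤ 1 / 2) :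
    0 < t - b * t ^ 2 ∧ 1 / t + b ≤ 1 / (t - b * t ^ 2) := by
  have h1 := abs_le.1 h
  have h2 : 0 < 1 - b * t := by linarith
  have h3 : t - b * t ^ 2 = t * (1 - b * t) := by ring
  rw [h3]
  refine ⟨by positivity, ?_⟩
  rw [le_div_iff₀ (by positivity)]
  have : (1 / t + b) * (t * (1 - b * t)) = 1 - (b * t) ^ 2 := by field_simp; ring
  rw [this]; nlinarith [sq_nonneg (b * t)]

/-- Partial sums of `β` are at least `-S`, so `1/g_j ≥ 1/g₀ - S ≥ 1/(2g₀)`. The induction carries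
the upper bound along because the reciprocal step needs `|β_j g_j| ≤ 1/2`. -/
theorem gSeq_bounds (hb : BetaBounds Ω B c S χ β) (hB : 0 ≤ B) (hc : 0 < c) {g₀ : ℝ} (hg : 0 < g₀)
    (hBg : 4 * B * g₀ ≤ 1) (hSg : 4 * S * g₀ ≤ 1) (j : ℕ) :
    0 < gSeq β g₀ j ∧ gSeq β g₀ j ≤ 2 * g₀ := by
  have key : ∀ j, 0 < gSeq β g₀ j ∧ gSeq β g₀ j ≤ 2 * g₀ ∧
      1 / g₀ + ∑ k ∈ Finset.range j, β k ≤ 1 / gSeq β g₀ j := by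
    intro j
    induction j with
    | zero => simp [gSeq, hg]
    | succ j ih =>
      obtain ⟨h1, h2, h3⟩ := ih
      obtain ⟨h4, h5⟩ := inv_step h1 (hb.step_aux hB hBg h1 h2 (j := j))
      have h6 : 1 / g₀ + ∑ k ∈ Finset.range (j + 1), β k ≤ 1 / gSeq β g₀ (j + 1) := by
        rw [Finset.sum_range_succ]; simp only [gSeq] at h5 ⊢; linarith
      refine ⟨h4, ?_, h6⟩
      have h7 := hb.sum_lower (fun _ => 1) 1 0 (j + 1) (by simp) (by simp)
      simp only [zero_add, mul_one] at h7
      have h8 : 0 ≤ ∑ k ∈ Finset.range (j + 1), χ k :=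
        Finset.sum_nonneg fun k _ => (hb.weight.pos k).le
      have h9 : 1 / (2 * g₀) ≤ 1 / g₀ - S := by
        rw [le_sub_iff_add_le, div_add' _ _ _ (by positivity), div_le_div_iff₀ (by positivity) hg]
        nlinarith
      have h10 : 1 / (2 * g₀) ≤ 1 / gSeq β g₀ (j + 1) := by
        have := mul_nonneg hc.le h8
        linarith
      exact (one_div_le_one_div (by positivity) h4).1 h10
  exact ⟨(key j).1, (key j).2.1⟩

theorem gSeq_inv (hb : BetaBounds Ω B c S χ β) (hB : 0 ≤ B) (hc : 0 < c) {g₀ : ℝ} (hg : 0 < g₀)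
    (hBg : 4 * B * g₀ ≤ 1) (hSg : 4 * S * g₀ ≤ 1) (j n : ℕ) :
    1 / gSeq β g₀ j + c * (∑ k ∈ Finset.range n, χ (j + k)) - S ≤ 1 / gSeq β g₀ (j + n) := by
  have hgb := hb.gSeq_bounds hB hc hg hBg hSg
  have h1 : 1 / gSeq β g₀ j + ∑ k ∈ Finset.range n, β (j + k) ≤ 1 / gSeq β g₀ (j + n) := by
    induction n with
    | zero => simp
    | succ n ih =>
      have := (inv_step (hgb (j + n)).1
        (hb.step_aux hB hBg (hgb (j + n)).1 (hgb (j + n)).2 (j := j + n))).2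
      rw [Finset.sum_range_succ, ← add_assoc j n 1]
      simp only [gSeq] at this ⊢
      linarith
  have h7 := hb.sum_lower (fun _ => 1) 1 j n (by simp) (by simp)
  simp only [mul_one] at h7
  linarith

theorem gSeq_quasi_antitone (hb : BetaBounds Ω B c S χ β) (hB : 0 ≤ B) (hc : 0 < c) {g₀ : ℝ}
    (hg : 0 < g₀) (hBg : 4 * B * g₀ ≤ 1) (hSg : 4 * S * g₀ ≤ 1) (j n : ℕ) :
    gSeq β g₀ (j + n) ≤ 2 * gSeq β g₀ j := by
  have hgb := hb.gSeq_bounds hB hc hg hBg hSg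
  have h1 := hb.gSeq_inv hB hc hg hBg hSg j n
  have h8 : 0 ≤ ∑ k ∈ Finset.range n, χ (j + k) :=
    Finset.sum_nonneg fun k _ => (hb.weight.pos _).le
  obtain ⟨hp, hle⟩ := hgb j
  have h9 : 1 / (2 * gSeq β g₀ j) ≤ 1 / gSeq β g₀ j - S := by
    rw [le_sub_iff_add_le, div_add' _ _ _ (by positivity), div_le_div_iff₀ (by positivity) hp]
    nlinarith [mul_le_mul_of_nonneg_left hle hb.nonneg]
  have := mul_nonneg hc.le h8
  exact (one_div_le_one_div (by positivity) (hgb (j + n)).1).1 (by linarith)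

/-- Telescoping `log(1 - y) ≤ -y` bounds the sum of `β g` by a difference of logarithms. The error
`2 S g₀ ≤ 1/2` is absorbed by `log g₀ ≤ -1`. -/
theorem sum_chi_gSeq_le (hb : BetaBounds Ω B c S χ β) (hB : 0 ≤ B) (hc : 0 < c) {g₀ : ℝ}
    (hg : 0 < g₀) (hBg : 4 * B * g₀ ≤ 1) (hSg : 4 * S * g₀ ≤ 1) (hlog : Real.log g₀ ≤ -1)
    (j : ℕ) :
    ∑ k ∈ Finset.range j, χ k * gSeq β g₀ k ≤ c⁻¹ * -Real.log (gSeq β g₀ j) := by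
  have hgb := hb.gSeq_bounds hB hc hg hBg hSg
  have h1 : ∑ k ∈ Finset.range j, β k * gSeq β g₀ k ≤ Real.log g₀ - Real.log (gSeq β g₀ j) := by
    induction j with
    | zero => simp [gSeq]
    | succ j ih =>
      obtain ⟨hp, hle⟩ := hgb j
      have h2 := abs_le.1 (hb.step_aux hB hBg hp hle (j := j))
      have h3 : gSeq β g₀ (j + 1) = gSeq β g₀ j * (1 - β j * gSeq β g₀ j) := by
        simp only [gSeq]; ring
      have h5 : 0 < 1 - β j * gSeq β g₀ j := by linarith
      have h4 := Real.log_le_sub_one_of_pos h5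
      rw [Finset.sum_range_succ, h3, Real.log_mul hp.ne' h5.ne']
      linarith
  have h2 := hb.sum_lower (gSeq β g₀) (2 * g₀) 0 j (fun k => (hgb _).1.le) (fun k => (hgb _).2)
  simp only [zero_add] at h2
  rw [inv_mul_eq_div, le_div_iff₀ hc]
  linarith

/-- If `χ_j = 1`, the sum of `β g²` telescopes to `g_j - g_{j+n}`. Otherwise the weights are
geometric from `j` on and `g_{j+k} ≤ 2 g_j` suffices. -/
theorem sum_chi_gSeq_sq_le (hb : BetaBounds Ω B c S χ β) (hΩ : 1 < Ω) (hB : 0 ≤ B) (hc : 0 < c)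
    {g₀ : ℝ} (hg : 0 < g₀) (hBg : 4 * B * g₀ ≤ 1) (hSg : 4 * S * g₀ ≤ 1) (hg8 : 8 * g₀ ≤ 1)
    (j n : ℕ) :
    ∑ k ∈ Finset.range n, χ (j + k) * gSeq β g₀ (j + k) ^ 2
      ≤ (3 * c⁻¹ + (1 - Ω⁻¹)⁻¹) * (χ j * gSeq β g₀ j) := by
  have hgb := hb.gSeq_bounds hB hc hg hBg hSg
  have hq := hb.gSeq_quasi_antitone hB hc hg hBg hSg j
  obtain ⟨hp, hle⟩ := hgb j
  have hΩ1 : 0 < 1 - Ω⁻¹ := by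
    have := inv_lt_one_of_one_lt₀ hΩ; linarith
  have hχ := hb.weight.pos j
  have hsq : ∀ k, gSeq β g₀ (j + k) ^ 2 ≤ 4 * gSeq β g₀ j ^ 2 := by
    intro k
    have := pow_le_pow_left₀ (hgb (j + k)).1.le (hq k) 2
    linarith
  have hpos : 0 ≤ χ j * gSeq β g₀ j := by positivity
  rcases hb.weight.eq_one_or j with h1 | h1
  · have h2 : ∑ k ∈ Finset.range n, β (j + k) * gSeq β g₀ (j + k) ^ 2
        = gSeq β g₀ j - gSeq β g₀ (j + n) := by
      induction n with
      | zero => simp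
      | succ n ih => rw [Finset.sum_range_succ, ih, ← add_assoc j n 1]; simp only [gSeq]; ring
    have h3 := hb.sum_lower (fun k => gSeq β g₀ k ^ 2) (4 * gSeq β g₀ j ^ 2) j n
      (fun k => sq_nonneg _) hsq
    rw [h2] at h3
    have h4 := (hgb (j + n)).1
    have h5 : S * (4 * gSeq β g₀ j ^ 2) ≤ 2 * gSeq β g₀ j := by
      have := mul_le_mul_of_nonneg_left hle hb.nonneg
      nlinarith
    have h6 : ∑ k ∈ Finset.range n, χ (j + k) * gSeq β g₀ (j + k) ^ 2
        ≤ 3 * c⁻¹ * (χ j * gSeq β g₀ j) := by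
      rw [h1, one_mul, mul_comm 3, mul_assoc, inv_mul_eq_div, le_div_iff₀ hc]
      linarith
    have h7 : 0 ≤ (1 - Ω⁻¹)⁻¹ * (χ j * gSeq β g₀ j) := by positivity
    linarith
  · have h2 : ∑ k ∈ Finset.range n, χ (j + k) * gSeq β g₀ (j + k) ^ 2
        ≤ (1 - Ω⁻¹)⁻¹ * (χ j * (4 * gSeq β g₀ j ^ 2)) := by
      have hΩ0 : 0 ≤ Ω⁻¹ := by positivity
      calc _ ≤ ∑ k ∈ Finset.range n, Ω⁻¹ ^ k * (χ j * (4 * gSeq β g₀ j ^ 2)) := by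
            refine Finset.sum_le_sum fun k _ => ?_
            rw [h1 k, inv_pow]
            have : 0 ≤ χ j * (Ω ^ k)⁻¹ := by positivity
            nlinarith [mul_le_mul_of_nonneg_left (hsq k) this]
        _ = (∑ k ∈ Finset.range n, Ω⁻¹ ^ k) * (χ j * (4 * gSeq β g₀ j ^ 2)) := by
            rw [Finset.sum_mul]
        _ ≤ _ := by
            gcongr
            exact sum_le_hasSum _ (fun k _ => by positivity)
              (hasSum_geometric_of_lt_one hΩ0 (inv_lt_one_of_one_lt₀ hΩ))
    have h3 : χ j * (4 * gSeq β g₀ j ^ 2) ≤ χ j * gSeq β g₀ j := by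
      gcongr; nlinarith
    have h4 := mul_le_mul_of_nonneg_left h3 (inv_pos.2 hΩ1).le
    have h5 : 0 ≤ 3 * c⁻¹ * (χ j * gSeq β g₀ j) := by positivity
    linarith

/-- `1/g_l` is at least a multiple of one plus the sum of the weights, whose square dominates `χ_l
(l+1)²`. The resulting bound depends on neither `β` nor `g₀`, which is what dominated summation in
the external parameter requires. -/
theorem chi_gSeq_sq_decay (hb : BetaBounds Ω B c S χ β) (hB : 0 ≤ B) (hc : 0 < c)
    {g₀ : ℝ} (hg : 0 < g₀) (hBg : 4 * B * g₀ ≤ 1) (hSg : 4 * S * g₀ ≤ 1) (hg8 : 8 * g₀ ≤ 1)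
    {A : ℝ} {l : ℕ}
    (hA : χ l * ((l : ℝ) + 1) ^ 2 ≤ A * (1 + ∑ k ∈ Finset.range l, χ k) ^ 2) :
    χ l * gSeq β g₀ l ^ 2 ≤ A / (min 1 c) ^ 2 * (1 / ((l : ℝ) + 1) ^ 2) := by
  have hgb := hb.gSeq_bounds hB hc hg hBg hSg
  have h1 := hb.gSeq_inv hB hc hg hBg hSg 0 l
  simp only [zero_add, gSeq] at h1
  have hs : 0 ≤ ∑ k ∈ Finset.range l, χ k :=
    Finset.sum_nonneg fun k _ => (hb.weight.pos _).le
  set s := ∑ k ∈ Finset.range l, χ k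
  have hp := (hgb l).1
  set g := gSeq β g₀ l
  have hm : 0 < min 1 c := lt_min one_pos hc
  have h2 : 1 ≤ 1 / g₀ - S := by
    rw [le_sub_iff_add_le, le_div_iff₀ hg]
    nlinarith
  have h3 : min 1 c * (1 + s) ≤ 1 / g := by
    have := min_le_left 1 c
    have := mul_le_mul_of_nonneg_right (min_le_right 1 c) hs
    linarith
  rw [le_div_iff₀ hp] at h3
  have h4 : (min 1 c * (1 + s) * g) ^ 2 ≤ 1 := by
    have h5 : 0 ≤ min 1 c * (1 + s) * g := by positivity
    exact pow_le_one₀ h5 h3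
  rw [div_mul_div_comm, le_div_iff₀ (by positivity)]
  have hA0 : 0 ≤ A := by
    by_contra hneg
    have h6 : A * (1 + s) ^ 2 < 0 := mul_neg_of_neg_of_pos (by linarith) (by positivity)
    have h7 : 0 ≤ χ l * ((l : ℝ) + 1) ^ 2 := mul_nonneg (hb.weight.pos l).le (sq_nonneg _)
    linarith
  calc χ l * g ^ 2 * (min 1 c ^ 2 * ((l : ℝ) + 1) ^ 2)
      = (χ l * ((l : ℝ) + 1) ^ 2) * (g ^ 2 * min 1 c ^ 2) := by ring
    _ ≤ (A * (1 + s) ^ 2) * (g ^ 2 * min 1 c ^ 2) := by gcongr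
    _ = A * (min 1 c * (1 + s) * g) ^ 2 := by ring
    _ ≤ A * 1 := by gcongr

end BetaBounds

theorem continuous_gSeq {E : Type*} [TopologicalSpace E] {β : E → ℕ → ℝ}
    (hβ : ∀ j, Continuous fun m => β m j) (g₀ : ℝ) (j : ℕ) :
    Continuous fun m => gSeq (β m) g₀ j := by
  induction j with
  | zero => exact continuous_const
  | succ j ih => exact ih.sub ((hβ j).mul (ih.pow 2))


/-! ### Scalar linear recursions solved from infinity -/

/-- The term of index `l` in the solution from infinity of `x_{j+1} = a_j x_j + f_j`. -/
noncomputable def backTerm (a f : ℕ → ℝ) (j l : ℕ) : ℝ :=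
  (∏ k ∈ Finset.range (l + 1), a (j + k))⁻¹ * f (j + l)

/-- The solution from infinity of the recursion `x_{j+1} = a_j x_j + f_j`. -/
noncomputable def backSum (a f : ℕ → ℝ) (j : ℕ) : ℝ := -∑' l, backTerm a f j l

theorem backTerm_succ (a f : ℕ → ℝ) (j l : ℕ) :
    backTerm a f j (l + 1) = (a j)⁻¹ * backTerm a f (j + 1) l := by
  unfold backTerm
  rw [Finset.prod_range_succ' _ (l + 1), mul_inv_rev, ← mul_assoc]
  have h : ∀ k, j + (k + 1) = j + 1 + k := fun k => by omega
  rw [h l, Finset.prod_congr rfl fun k _ => by rw [h k], add_zero]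

theorem backSum_succ {a f : ℕ → ℝ} {j : ℕ} (ha : a j ≠ 0) (hs : Summable (backTerm a f j)) :
    backSum a f (j + 1) = a j * backSum a f j + f j := by
  unfold backSum
  rw [hs.tsum_eq_zero_add]
  simp only [backTerm_succ, tsum_mul_left]
  simp only [backTerm, zero_add, Finset.range_one, Finset.prod_singleton, add_zero]
  field_simp
  ring

theorem backTerm_summable {a f : ℕ → ℝ} {j : ℕ} {Q : ℝ}
    (h : ∀ n, ∑ l ∈ Finset.range n, |backTerm a f j l| ≤ Q) : Summable (backTerm a f j) :=
  (summable_of_sum_range_le (fun _ => abs_nonneg _) h).of_abs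

theorem abs_backSum_le {a f : ℕ → ℝ} {j : ℕ} {Q : ℝ}
    (h : ∀ n, ∑ l ∈ Finset.range n, |backTerm a f j l| ≤ Q) : |backSum a f j| ≤ Q := by
  have hs : Summable fun l => |backTerm a f j l| :=
    summable_of_sum_range_le (fun _ => abs_nonneg _) h
  rw [backSum, abs_neg]
  have h1 : |∑' l, backTerm a f j l| ≤ ∑' l, |backTerm a f j l| := by
    simpa only [Real.norm_eq_abs] using norm_tsum_le_tsum_norm (f := backTerm a f j) hs
  exact h1.trans (hs.tsum_le_of_sum_range_le h)

theorem backSum_sub {a f f' : ℕ → ℝ} {j : ℕ} (h : Summable (backTerm a f j))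
    (h' : Summable (backTerm a f' j)) :
    backSum a f j - backSum a f' j = backSum a (fun i => f i - f' i) j := by
  unfold backSum
  have : backTerm a (fun i => f i - f' i) j = fun l => backTerm a f j l - backTerm a f' j l := by
    funext l; simp [backTerm, mul_sub]
  rw [this, h.tsum_sub h']; ring

/-- A homogeneous solution is its value at `j` times a product of multipliers. If these products
stay away from zero, only the zero solution tends to zero; this is the uniqueness behind every final
condition. -/
theorem eq_zero_of_recursion {a d : ℕ → ℝ} {m : ℝ} (hm : 0 < m)
    (ha : ∀ j l, m ≤ |∏ k ∈ Finset.range l, a (j + k)|) (hd : ∀ j, d (j + 1) = a j * d j)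
    (hlim : Tendsto d atTop (𝓝 0)) (j : ℕ) : d j = 0 := by
  have h1 : ∀ l, d (j + l) = (∏ k ∈ Finset.range l, a (j + k)) * d j := by
    intro l
    induction l with
    | zero => simp
    | succ l ih => rw [← add_assoc, hd, ih, Finset.prod_range_succ]; ring
  have h2 : Tendsto (fun l => |d (j + l)|) atTop (𝓝 0) := by
    have := (hlim.comp (tendsto_add_atTop_nat j)).abs
    simpa [Function.comp_def, add_comm] using this
  have h3 : m * |d j| ≤ 0 := by
    refine ge_of_tendsto' h2 fun l => ?_
    rw [h1, abs_mul]
    exact mul_le_mul_of_nonneg_right (ha j l) (abs_nonneg _)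
  have : |d j| ≤ 0 := by nlinarith [abs_nonneg (d j)]
  exact abs_nonpos_iff.1 this

theorem abs_backTerm_le_of_prod {a f : ℕ → ℝ} {m : ℝ} (hm : 0 < m)
    (ha : ∀ j l, m ≤ |∏ k ∈ Finset.range l, a (j + k)|) (j l : ℕ) :
    |backTerm a f j l| ≤ m⁻¹ * |f (j + l)| := by
  rw [backTerm, abs_mul, abs_inv]
  gcongr
  exact ha j (l + 1)

theorem abs_backTerm_le_of_pow {a f : ℕ → ℝ} {q : ℝ} (hq : 0 < q) (ha : ∀ j, q ≤ |a j|)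
    (j l : ℕ) : |backTerm a f j l| ≤ q⁻¹ ^ (l + 1) * |f (j + l)| := by
  rw [backTerm, abs_mul, abs_inv, inv_pow]
  gcongr
  rw [Finset.abs_prod]
  calc q ^ (l + 1) = ∏ _k ∈ Finset.range (l + 1), q := by simp
    _ ≤ _ := Finset.prod_le_prod (fun _ _ => hq.le) fun k _ => ha _

theorem continuousOn_backSum {X : Type*} [TopologicalSpace X] {s : Set X} {a f : X → ℕ → ℝ}
    (ha : ∀ j, ContinuousOn (fun x => a x j) s) (hf : ∀ j, ContinuousOn (fun x => f x j) s)
    (ha0 : ∀ x ∈ s, ∀ j, a x j ≠ 0) {j : ℕ} {u : ℕ → ℝ} (hu : Summable u)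
    (hb : ∀ x ∈ s, ∀ l, |backTerm (a x) (f x) j l| ≤ u l) :
    ContinuousOn (fun x => backSum (a x) (f x) j) s := by
  refine (continuousOn_tsum (fun l => ?_) hu fun l x hx => hb x hx l).neg
  refine ContinuousOn.mul (ContinuousOn.inv₀ ?_ fun x hx => ?_) (hf _)
  · exact continuousOn_finsetProd _ fun k _ => ha _
  · exact Finset.prod_ne_zero_iff.2 fun k _ => ha0 x hx _

/-- The Weierstrass product inequality, one-sided: factors larger than 1 only help. -/
theorem one_sub_sum_le_prod {a e : ℕ → ℝ} (h : ∀ k, 1 - e k ≤ a k) (he : ∀ k, 0 ≤ e k)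
    (hs : ∀ n, ∑ k ∈ Finset.range n, e k ≤ 1) (n : ℕ) :
    1 - ∑ k ∈ Finset.range n, e k ≤ ∏ k ∈ Finset.range n, a k := by
  induction n with
  | zero => simp
  | succ n ih =>
    rw [Finset.sum_range_succ, Finset.prod_range_succ]
    have h1 := hs n
    have h2 := hs (n + 1)
    rw [Finset.sum_range_succ] at h2
    have h3 : 0 ≤ ∑ k ∈ Finset.range n, e k := Finset.sum_nonneg fun k _ => he k
    have h4 := mul_le_mul_of_nonneg_left (h n) (le_trans (by linarith) ih)
    nlinarith [he n]

/-! ### The quadratic flow -/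

/-- Bounds on the coefficients of the quadratic map, apart from `β`. -/
structure CoeffBounds (C S lam₀ : ℝ) (χ : ℕ → ℝ) (P : Coeffs) : Prop where
  le_lam : ∀ j, lam₀ ≤ P.lam j
  zeta_upper : ∃ e : ℕ → ℝ, (∀ j, 0 ≤ e j) ∧ (∀ j n, ∑ k ∈ Finset.range n, e (j + k) ≤ S) ∧
    ∀ j, P.zeta j ≤ e j
  eta_le : ∀ j, |P.eta j| ≤ C * χ j
  gamma_le : ∀ j, |P.gamma j| ≤ C * χ j
  theta_le : ∀ j, |P.theta j| ≤ C * χ j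
  zeta_le : ∀ j, |P.zeta j| ≤ C * χ j
  ups_gg_le : ∀ j, |P.ups_gg j| ≤ C * χ j
  ups_gz_le : ∀ j, |P.ups_gz j| ≤ C * χ j
  ups_gmu_le : ∀ j, |P.ups_gmu j| ≤ C * χ j
  ups_zz_le : ∀ j, |P.ups_zz j| ≤ C * χ j
  ups_zmu_le : ∀ j, |P.ups_zmu j| ≤ C * χ j

/-- Only the positive part of `ζ` can shrink the product, and it has total mass at most `S`. -/
theorem CoeffBounds.half_le_prod {C S lam₀ : ℝ} {χ : ℕ → ℝ} {P : Coeffs}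
    (hP : CoeffBounds C S lam₀ χ P) {g : ℕ → ℝ} {g₁ : ℝ} (hg : ∀ j, 0 < g j)
    (hg1 : ∀ j, g j ≤ g₁) (hS : 2 * S * g₁ ≤ 1) (j l : ℕ) :
    1 / 2 ≤ ∏ k ∈ Finset.range l, (1 - P.zeta (j + k) * g (j + k)) := by
  obtain ⟨e, he0, hes, he⟩ := hP.zeta_upper
  have hsum : ∀ n, ∑ k ∈ Finset.range n, e (j + k) * g (j + k) ≤ 1 / 2 := by
    intro n
    calc _ ≤ ∑ k ∈ Finset.range n, e (j + k) * g₁ :=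
          Finset.sum_le_sum fun k _ => mul_le_mul_of_nonneg_left (hg1 _) (he0 _)
      _ = (∑ k ∈ Finset.range n, e (j + k)) * g₁ := by rw [Finset.sum_mul]
      _ ≤ S * g₁ := mul_le_mul_of_nonneg_right (hes j n) ((hg 0).le.trans (hg1 0))
      _ ≤ 1 / 2 := by linarith
  have := one_sub_sum_le_prod (a := fun k => 1 - P.zeta (j + k) * g (j + k))
    (e := fun k => e (j + k) * g (j + k))
    (fun k => by
      have := mul_le_mul_of_nonneg_right (he (j + k)) (hg (j + k)).le
      linarith)
    (fun k => mul_nonneg (he0 _) (hg _).le) (fun n => (hsum n).trans (by norm_num)) l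
  linarith [hsum l]

/-- The `z`-component of the quadratic flow with given `g`-component. -/
noncomputable def zBar (P : Coeffs) (g : ℕ → ℝ) : ℕ → ℝ :=
  backSum (fun j => 1 - P.zeta j * g j) (fun j => -(P.theta j * g j ^ 2))

/-- The multiplier of `μ` in the quadratic flow. -/
def muCoeff (P : Coeffs) (g z : ℕ → ℝ) (j : ℕ) : ℝ :=
  P.lam j - P.ups_gmu j * g j - P.ups_zmu j * z j

/-- The inhomogeneity of the equation for `μ` in the quadratic flow. -/
def muSource (P : Coeffs) (g z : ℕ → ℝ) (j : ℕ) : ℝ :=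
  P.eta j * g j + P.gamma j * z j
    - (P.ups_gg j * g j ^ 2 + P.ups_gz j * g j * z j + P.ups_zz j * z j ^ 2)

/-- The `μ`-component of the quadratic flow with given `g`- and `z`-components. -/
noncomputable def muBar (P : Coeffs) (g z : ℕ → ℝ) : ℕ → ℝ :=
  backSum (muCoeff P g z) (muSource P g z)

/-- The bounds on the coupling sequence `g` from which the rest of the analysis proceeds. -/
structure CouplingBounds (L : ℝ) (χ g : ℕ → ℝ) : Prop where
  chi_pos : ∀ j, 0 < χ j
  chi_le_one : ∀ j, χ j ≤ 1
  chi_antitone : Antitone χ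
  pos : ∀ j, 0 < g j
  le_one : ∀ j, g j ≤ 1
  quasi_antitone : ∀ j n, g (j + n) ≤ 2 * g j
  sum_sq_le : ∀ j n, ∑ k ∈ Finset.range n, χ (j + k) * g (j + k) ^ 2 ≤ L * (χ j * g j)
  decay : ∃ A : ℝ, ∀ l : ℕ, χ l * g l ^ 2 ≤ A * (1 / ((l : ℝ) + 1) ^ 2)

theorem summable_one_div_succ_sq : Summable fun l : ℕ => 1 / ((l : ℝ) + 1) ^ 2 := by
  have := (summable_nat_add_iff 1).2 (Real.summable_one_div_nat_pow.2 (one_lt_two))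
  simpa using this

/-- Since `χ ≤ 1`, the square of `χ g` is at most `χ g²`, which decays. -/
theorem CouplingBounds.tendsto_mul {L : ℝ} {χ g : ℕ → ℝ} (h : CouplingBounds L χ g) :
    Tendsto (fun j => χ j * g j) atTop (𝓝 0) := by
  obtain ⟨A, hA⟩ := h.decay
  have h1 : Tendsto (fun l : ℕ => A * (1 / ((l : ℝ) + 1) ^ 2)) atTop (𝓝 0) := by
    simpa using summable_one_div_succ_sq.tendsto_atTop_zero.const_mul A
  have h2 : Tendsto (fun l : ℕ => Real.sqrt (A * (1 / ((l : ℝ) + 1) ^ 2))) atTop (𝓝 0) := by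
    simpa [Function.comp_def] using (Real.continuous_sqrt.tendsto 0).comp h1
  refine squeeze_zero (fun j => mul_nonneg (h.chi_pos j).le (h.pos j).le) (fun j => ?_) h2
  refine Real.le_sqrt_of_sq_le (le_trans ?_ (hA j))
  have := h.chi_pos j; have := h.chi_le_one j
  rw [mul_pow]
  gcongr
  nlinarith

theorem abs_le_of_weight {x C t : ℝ} (h : |x| ≤ C * t) (hC : 0 ≤ C) (ht : t ≤ 1) : |x| ≤ C :=
  h.trans (by nlinarith)

section Flow

variable {C S lam₀ L : ℝ} {χ g : ℕ → ℝ} {P : Coeffs}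

theorem sum_abs_zBar_le (hP : CoeffBounds C S lam₀ χ P) (hg : CouplingBounds L χ g) (hC : 0 ≤ C)
    (hprod : ∀ j l, 1 / 2 ≤ ∏ k ∈ Finset.range l, (1 - P.zeta (j + k) * g (j + k))) (j n : ℕ) :
    ∑ l ∈ Finset.range n, |backTerm (fun j => 1 - P.zeta j * g j)
      (fun j => -(P.theta j * g j ^ 2)) j l| ≤ 2 * C * L * (χ j * g j) := by
  calc _ ≤ ∑ l ∈ Finset.range n, 2 * C * (χ (j + l) * g (j + l) ^ 2) := by
        refine Finset.sum_le_sum fun l _ => ?_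
        refine (abs_backTerm_le_of_prod (m := 1 / 2) (by norm_num)
          (fun j l => (hprod j l).trans (le_abs_self _)) j l).trans ?_
        rw [abs_neg, abs_mul, abs_of_nonneg (sq_nonneg (g (j + l)))]
        have := mul_le_mul_of_nonneg_right (hP.theta_le (j + l)) (sq_nonneg (g (j + l)))
        norm_num
        linarith
    _ = 2 * C * ∑ l ∈ Finset.range n, χ (j + l) * g (j + l) ^ 2 := by rw [Finset.mul_sum]
    _ ≤ 2 * C * (L * (χ j * g j)) := by gcongr; exact hg.sum_sq_le j n
    _ = _ := by ring

theorem abs_muSource_le (hP : CoeffBounds C S lam₀ χ P) (hg : CouplingBounds L χ g) (hC : 0 ≤ C)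
    {z : ℕ → ℝ} {Z : ℝ} (hZ : 0 ≤ Z) (hz : ∀ j, |z j| ≤ Z * (χ j * g j)) (j : ℕ) :
    |muSource P g z j| ≤ 2 * C * (1 + Z) ^ 2 * (χ j * g j) := by
  have hgp := hg.pos j
  have hg1 := hg.le_one j
  have hχ := hg.chi_pos j
  have hχ1 := hg.chi_le_one j
  have hz' : |z j| ≤ Z * g j := (hz j).trans (by gcongr; nlinarith)
  have hK : 0 ≤ C * χ j := by positivity
  have hgg : g j ^ 2 ≤ g j := by nlinarith
  have hZg : 0 ≤ Z * g j := by positivity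
  have e1 : |P.eta j * g j| ≤ C * χ j * g j := by
    rw [abs_mul, abs_of_pos hgp]; gcongr; exact hP.eta_le j
  have e2 : |P.gamma j * z j| ≤ C * χ j * (Z * g j) := by
    rw [abs_mul]; gcongr; exact hP.gamma_le j
  have e3 : |P.ups_gg j * g j ^ 2| ≤ C * χ j * g j := by
    rw [abs_mul, abs_of_nonneg (sq_nonneg (g j))]; gcongr; exact hP.ups_gg_le j
  have e4 : |P.ups_gz j * g j * z j| ≤ C * χ j * (Z * g j) := by
    rw [mul_assoc, abs_mul, abs_mul, abs_of_pos hgp]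
    have : g j * |z j| ≤ 1 * (Z * g j) := mul_le_mul hg1 hz' (abs_nonneg _) zero_le_one
    rw [one_mul] at this
    exact mul_le_mul (hP.ups_gz_le j) this (by positivity) hK
  have e5 : |P.ups_zz j * z j ^ 2| ≤ C * χ j * (Z ^ 2 * g j) := by
    rw [abs_mul, abs_pow]
    have : |z j| ^ 2 ≤ Z ^ 2 * g j := by
      calc |z j| ^ 2 ≤ (Z * g j) ^ 2 := by gcongr
        _ = Z ^ 2 * g j ^ 2 := by ring
        _ ≤ _ := by gcongr
    exact mul_le_mul (hP.ups_zz_le j) this (by positivity) hK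
  have h0 : |muSource P g z j| ≤ |P.eta j * g j| + |P.gamma j * z j| + (|P.ups_gg j * g j ^ 2|
      + |P.ups_gz j * g j * z j| + |P.ups_zz j * z j ^ 2|) := by
    unfold muSource
    refine (abs_sub _ _).trans (add_le_add (abs_add_le _ _) ?_)
    exact (abs_add_le _ _).trans (add_le_add (abs_add_le _ _) le_rfl)
  have h1 : 0 ≤ C * χ j * g j * (2 * Z + Z ^ 2) := by positivity
  nlinarith

theorem le_muCoeff (hP : CoeffBounds C S lam₀ χ P) (hg : CouplingBounds L χ g) (hC : 0 ≤ C)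
    {z : ℕ → ℝ} {Z : ℝ} (hZ : 0 ≤ Z) (hz : ∀ j, |z j| ≤ Z * (χ j * g j))
    (hsmall : ∀ j, 2 * C * (1 + Z) * g j ≤ lam₀ - 1) (j : ℕ) :
    (1 + lam₀) / 2 ≤ muCoeff P g z j := by
  have hgp := hg.pos j
  have hχ := hg.chi_pos j
  have hχ1 := hg.chi_le_one j
  have hz' : |z j| ≤ Z * g j := (hz j).trans (by gcongr; nlinarith)
  have e1 : |P.ups_gmu j * g j| ≤ C * g j := by
    rw [abs_mul, abs_of_pos hgp]; gcongr; exact abs_le_of_weight (hP.ups_gmu_le j) hC hχ1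
  have e2 : |P.ups_zmu j * z j| ≤ C * (Z * g j) := by
    rw [abs_mul]; gcongr; exact abs_le_of_weight (hP.ups_zmu_le j) hC hχ1
  have := (abs_le.1 e1).2
  have := (abs_le.1 e2).2
  have := hP.le_lam j
  have := hsmall j
  unfold muCoeff
  nlinarith

/-- The multipliers exceed `q = (1 + λ)/2 > 1`, so the series is geometric, while later sources are
at most twice the bound at `j` by quasi-monotonicity. -/
theorem sum_abs_muBar_le (hP : CoeffBounds C S lam₀ χ P) (hg : CouplingBounds L χ g) (hC : 0 ≤ C)
    (hlam : 1 < lam₀) {z : ℕ → ℝ} {Z : ℝ} (hZ : 0 ≤ Z) (hz : ∀ j, |z j| ≤ Z * (χ j * g j))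
    (hsmall : ∀ j, 2 * C * (1 + Z) * g j ≤ lam₀ - 1) (j n : ℕ) :
    ∑ l ∈ Finset.range n, |backTerm (muCoeff P g z) (muSource P g z) j l|
      ≤ 8 * C * (1 + Z) ^ 2 / (lam₀ - 1) * (χ j * g j) := by
  set q := (1 + lam₀) / 2 with hq
  have hq1 : 1 < q := by rw [hq]; linarith
  have hq0 : 0 < q := by linarith
  have hlow := le_muCoeff hP hg hC hZ hz hsmall
  set F := 2 * C * (1 + Z) ^ 2 with hF
  have hF0 : 0 ≤ F := by positivity
  have hpos : 0 ≤ χ j * g j := mul_nonneg (hg.chi_pos j).le (hg.pos j).le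
  calc _ ≤ ∑ l ∈ Finset.range n, q⁻¹ ^ l * (q⁻¹ * (2 * F * (χ j * g j))) := by
        refine Finset.sum_le_sum fun l _ => ?_
        refine (abs_backTerm_le_of_pow hq0 (fun j => (hlow j).trans (le_abs_self _)) j l).trans ?_
        rw [pow_succ, mul_assoc]
        gcongr
        refine (abs_muSource_le hP hg hC hZ hz (j + l)).trans ?_
        have h1 : χ (j + l) * g (j + l) ≤ χ j * (2 * g j) :=
          mul_le_mul (hg.chi_antitone (Nat.le_add_right j l)) (hg.quasi_antitone j l)
            (hg.pos _).le (hg.chi_pos j).le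
        calc F * (χ (j + l) * g (j + l)) ≤ F * (χ j * (2 * g j)) := by gcongr
          _ = _ := by ring
    _ = (∑ l ∈ Finset.range n, q⁻¹ ^ l) * (q⁻¹ * (2 * F * (χ j * g j))) := by rw [Finset.sum_mul]
    _ ≤ (1 - q⁻¹)⁻¹ * (q⁻¹ * (2 * F * (χ j * g j))) := by
        gcongr
        exact sum_le_hasSum _ (fun k _ => by positivity)
          (hasSum_geometric_of_lt_one (by positivity) (inv_lt_one_of_one_lt₀ hq1))
    _ = _ := by
        have h1 : q - 1 ≠ 0 := by linarith
        have h2 : lam₀ - 1 ≠ 0 := by linarith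
        have h3 : (1 - q⁻¹)⁻¹ * q⁻¹ = 2 / (lam₀ - 1) := by
          rw [← mul_inv, sub_mul, one_mul, inv_mul_cancel₀ hq0.ne', hq]
          rw [show (1 + lam₀) / 2 - 1 = (lam₀ - 1) / 2 by ring, inv_div]
        rw [← mul_assoc, h3, hF]; ring

/-- The system is triangular: `g` is determined by its initial value; given `g`, two `z`-components
differ by a homogeneous solution tending to zero; given both, so do two `μ`-components. -/
theorem isQuadFlow_unique {g₀ : ℝ} {V V' : ℕ → Coupling} (hlam : 1 < lam₀)
    (hP : CoeffBounds C S lam₀ χ P)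
    (hg : CouplingBounds L χ (gSeq P.beta g₀)) (hC : 0 ≤ C)
    (hprod : ∀ j l, 1 / 2 ≤ ∏ k ∈ Finset.range l,
      (1 - P.zeta (j + k) * gSeq P.beta g₀ (j + k))) {Z : ℝ} (hZ : 0 ≤ Z)
    (hz : ∀ j, |(V j).2.1| ≤ Z * (χ j * gSeq P.beta g₀ j))
    (hsmall : ∀ j, 2 * C * (1 + Z) * gSeq P.beta g₀ j ≤ lam₀ - 1)
    (hV : IsQuadFlow P g₀ V) (hV' : IsQuadFlow P g₀ V') : V' = V := by
  have hgV : ∀ U, IsQuadFlow P g₀ U → ∀ j, (U j).1 = gSeq P.beta g₀ j := by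
    intro U hU j
    induction j with
    | zero => exact hU.init
    | succ j ih => rw [hU.step j]; simp [quadMap, gSeq, ih]
  have h1 := hgV V hV
  have h1' := hgV V' hV'
  have h2 : ∀ j, (V' j).2.1 - (V j).2.1 = 0 := by
    refine eq_zero_of_recursion (a := fun j => 1 - P.zeta j * gSeq P.beta g₀ j)
      (d := fun j => (V' j).2.1 - (V j).2.1) (m := 1 / 2) (by norm_num)
      (fun j l => (hprod j l).trans (le_abs_self _)) (fun j => ?_)
      (by simpa using hV'.z_lim.sub hV.z_lim)
    simp only [hV.step j, hV'.step j, quadMap, h1, h1']; ring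
  have h2' : ∀ j, (V' j).2.1 = (V j).2.1 := fun j => sub_eq_zero.1 (h2 j)
  have hlow := le_muCoeff (z := fun j => (V j).2.1) hP hg hC hZ hz hsmall
  have h3 : ∀ j, (V' j).2.2 - (V j).2.2 = 0 := by
    refine eq_zero_of_recursion (a := muCoeff P (gSeq P.beta g₀) (fun j => (V j).2.1))
      (d := fun j => (V' j).2.2 - (V j).2.2) (m := 1) (by norm_num)
      (fun j l => ?_) (fun j => ?_) (by simpa using hV'.mu_lim.sub hV.mu_lim)
    · rw [Finset.abs_prod]
      exact Finset.one_le_prod fun k _ =>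
        le_trans (by linarith) ((hlow (j + k)).trans (le_abs_self _))
    · simp only [hV.step j, hV'.step j, quadMap, h1, h1', h2', muCoeff]; ring
  funext j
  exact Prod.ext ((h1' j).trans (h1 j).symm) (Prod.ext (h2' j) (sub_eq_zero.1 (h3 j)))

theorem isQuadFlow_bar {g₀ : ℝ} (hlam : 1 < lam₀) (hP : CoeffBounds C S lam₀ χ P)
    (hgd : g = gSeq P.beta g₀) (hg : CouplingBounds L χ g) (hC : 0 ≤ C) (hL : 0 ≤ L)
    (hprod : ∀ j l, 1 / 2 ≤ ∏ k ∈ Finset.range l, (1 - P.zeta (j + k) * g (j + k)))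
    (hsmall : ∀ j, 2 * C * (1 + 2 * C * L) * g j ≤ lam₀ - 1) :
    IsQuadFlow P g₀ (fun j => (g j, zBar P g j, muBar P g (zBar P g) j)) ∧
      (∀ j, |zBar P g j| ≤ 2 * C * L * (χ j * g j)) ∧
      ∀ j, |muBar P g (zBar P g) j| ≤ 8 * C * (1 + 2 * C * L) ^ 2 / (lam₀ - 1) * (χ j * g j) := by
  have hzs := sum_abs_zBar_le hP hg hC hprod
  have hz : ∀ j, |zBar P g j| ≤ 2 * C * L * (χ j * g j) := fun j => abs_backSum_le (hzs j)
  have hZ : 0 ≤ 2 * C * L := by positivity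
  have hms := sum_abs_muBar_le hP hg hC hlam hZ hz hsmall
  have hm : ∀ j, |muBar P g (zBar P g) j|
    ≤ 8 * C * (1 + 2 * C * L) ^ 2 / (lam₀ - 1) * (χ j * g j) := fun j => abs_backSum_le (hms j)
  have ha : ∀ j, 1 - P.zeta j * g j ≠ 0 := fun j => by
    have := hprod j 1; simp at this; linarith
  have hlow := le_muCoeff hP hg hC hZ hz hsmall
  refine ⟨⟨by simp [hgd, gSeq], fun j => ?_, ?_, ?_⟩, hz, hm⟩
  · have h1 : g (j + 1) = g j - P.beta j * g j ^ 2 := by rw [hgd]; rfl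
    have h2 : zBar P g (j + 1) = (1 - P.zeta j * g j) * zBar P g j + -(P.theta j * g j ^ 2) :=
      backSum_succ (a := fun j => 1 - P.zeta j * g j) (ha j) (backTerm_summable (hzs j))
    have h3 : muBar P g (zBar P g) (j + 1) = muCoeff P g (zBar P g) j * muBar P g (zBar P g) j
        + muSource P g (zBar P g) j :=
      backSum_succ (by have := hlow j; linarith) (backTerm_summable (hms j))
    refine Prod.ext h1 (Prod.ext ?_ ?_)
    · simp only [h2, quadMap]; ring
    · simp only [h3, quadMap, muCoeff, muSource]; ring
  · refine squeeze_zero_norm hz ?_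
    simpa using hg.tendsto_mul.const_mul (2 * C * L)
  · refine squeeze_zero_norm hm ?_
    simpa using hg.tendsto_mul.const_mul (8 * C * (1 + 2 * C * L) ^ 2 / (lam₀ - 1))

end Flow


/-! ### The Picard map for the couplings -/

/-- The weight `t² |log t|` of the deviations of the couplings. -/
noncomputable def logWeight (t : ℝ) : ℝ := t ^ 2 * |Real.log t|

/-- The `g`-component of the Picard map with source `r`, initial value `u` and argument `x`. -/
def gNext (P : Coeffs) (g : ℕ → ℝ) (u : ℝ) (r x : ℕ → ℝ) : ℕ → ℝ
  | 0 => u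
  -- The linearisation about `g` has multiplier `1 - 2βg`. Completing it to `(1 - βg)²`, with the
  -- excess `(βg)²` moved to the old argument, makes `g_j²` an exact homogeneous solution.
  | j + 1 => g (j + 1) + (1 - P.beta j * g j) ^ 2 * (gNext P g u r x j - g j)
      + (r j - (P.beta j * g j) ^ 2 * (x j - g j) - P.beta j * (x j - g j) ^ 2)

/-- The source of the `z`-component of the Picard map. -/
def zSource (P : Coeffs) (g r x z : ℕ → ℝ) (j : ℕ) : ℝ :=
  -- The old `z` enters only multiplied by the deviation `x - g`; the main part `ζ g z` belongs to
  -- the multiplier.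
  -(P.theta j * x j ^ 2) - P.zeta j * (x j - g j) * z j + r j

/-- The `z`-component of the Picard map, where `x` is the new `g`-component. -/
noncomputable def zNext (P : Coeffs) (g r x z : ℕ → ℝ) : ℕ → ℝ :=
  backSum (fun j => 1 - P.zeta j * g j) (zSource P g r x z)

/-- The `μ`-component of the Picard map, where `x` and `z` are the new `g`- and `z`-components. -/
noncomputable def muNext (P : Coeffs) (r x z μ : ℕ → ℝ) (j : ℕ) : ℝ :=
  -- The equation for `μ_{j+1}` is solved for `μ_j`: inverting the expanding direction already
  -- contracts, so no series is needed.
  (P.lam j)⁻¹ * (μ (j + 1) - (P.eta j * x j + P.gamma j * z j)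
    + (P.ups_gg j * x j ^ 2 + P.ups_gz j * x j * z j + P.ups_gmu j * x j * μ j
      + P.ups_zz j * z j ^ 2 + P.ups_zmu j * z j * μ j) - r j)

/-- The quadratic flow `(g, z, μ)` around which the Picard map is set up, with its bounds. -/
structure FlowEnv (Ω B C S lam₀ L Z δ : ℝ) (P : Coeffs) (χ g z μ : ℕ → ℝ) : Prop where
  weight : CutoffWeight Ω χ
  beta_le : ∀ j, |P.beta j| ≤ B * χ j
  coeff : CoeffBounds C S lam₀ χ P
  coupling : CouplingBounds L χ g
  g_step : ∀ j, g (j + 1) = g j - P.beta j * g j ^ 2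
  z_step : ∀ j, z (j + 1) = z j - (P.theta j * g j ^ 2 + P.zeta j * g j * z j)
  mu_step : ∀ j, μ (j + 1) = P.eta j * g j + P.gamma j * z j + P.lam j * μ j
      - (P.ups_gg j * g j ^ 2 + P.ups_gz j * g j * z j + P.ups_gmu j * g j * μ j
        + P.ups_zz j * z j ^ 2 + P.ups_zmu j * z j * μ j)
  z_eq : z = zBar P g
  z_le : ∀ j, |z j| ≤ Z * (χ j * g j)
  mu_le : ∀ j, |μ j| ≤ Z * (χ j * g j)
  half_le_prod : ∀ j l, 1 / 2 ≤ ∏ k ∈ Finset.range l, (1 - P.zeta (j + k) * g (j + k))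
  sum_le_log : ∀ j, ∑ k ∈ Finset.range j, χ k * g k ≤ L * |Real.log (g j)|
  one_le_log : ∀ j, 1 ≤ |Real.log (g j)|
  -- `δ` measures the smallness of the coupling; it is chosen after `h`, so that also `h δ` is
  -- small.
  log_sq_le : ∀ j, g j * |Real.log (g j)| ^ 2 ≤ δ
  succ_le : ∀ j, g (j + 1) ≤ (1 + δ) * g j
  le_succ : ∀ j, g j ≤ (1 + δ) * g (j + 1)
  log_succ_le : ∀ j, |Real.log (g (j + 1))| ≤ (1 + δ) * |Real.log (g j)|

namespace FlowEnv

variable {Ω B C S lam₀ L Z δ : ℝ} {P : Coeffs} {χ g z μ : ℕ → ℝ}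

theorem log_le (hE : FlowEnv Ω B C S lam₀ L Z δ P χ g z μ) (j : ℕ) :
    g j * |Real.log (g j)| ≤ δ := by
  refine le_trans ?_ (hE.log_sq_le j)
  have := hE.one_le_log j
  have := (hE.coupling.pos j).le
  gcongr
  nlinarith

theorem g_le (hE : FlowEnv Ω B C S lam₀ L Z δ P χ g z μ) (j : ℕ) : g j ≤ δ := by
  have := hE.one_le_log j
  have := hE.coupling.pos j
  nlinarith [hE.log_le j]

theorem logWeight_pos (hE : FlowEnv Ω B C S lam₀ L Z δ P χ g z μ) (j : ℕ) :
    0 < logWeight (g j) := by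
  have := hE.one_le_log j
  have := hE.coupling.pos j
  unfold logWeight; positivity

theorem logWeight_le (hE : FlowEnv Ω B C S lam₀ L Z δ P χ g z μ) (j : ℕ) :
    logWeight (g j) ≤ δ * g j := by
  have := hE.log_le j
  have := hE.coupling.pos j
  unfold logWeight; nlinarith

theorem sq_le_logWeight (hE : FlowEnv Ω B C S lam₀ L Z δ P χ g z μ) (j : ℕ) :
    g j ^ 2 ≤ logWeight (g j) := by
  have := hE.one_le_log j
  unfold logWeight; nlinarith [sq_nonneg (g j)]

theorem delta_pos (hE : FlowEnv Ω B C S lam₀ L Z δ P χ g z μ) : 0 < δ :=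
  (hE.coupling.pos 0).trans_le (hE.g_le 0)

theorem sq_le_four (hE : FlowEnv Ω B C S lam₀ L Z δ P χ g z μ) (hδ : δ ≤ 1) (j : ℕ) :
    g j ^ 2 ≤ 4 * g (j + 1) ^ 2 := by
  have h1 := hE.le_succ j
  have h2 := hE.coupling.pos j
  have h3 := hE.coupling.pos (j + 1)
  have : g j ≤ 2 * g (j + 1) := by nlinarith
  nlinarith

/-- Divided by `g_j²`, the difference grows at each step only by the source over `g_{j+1}²`, of
order `χ_j g_j`, and these sum to `|log g_j|`. With the reference flow as second argument the same
estimate bounds the deviation itself. -/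
theorem gNext_sub_le (hE : FlowEnv Ω B C S lam₀ L Z δ P χ g z μ) (hδ : δ ≤ 1) (hB : 0 ≤ B)
    {h A d u u' : ℝ} {r r' x x' : ℕ → ℝ} (hh : 0 ≤ h) (hA : 0 ≤ A) (hd : 0 ≤ d)
    (hsmall : (B ^ 2 * h + 2 * B * h ^ 2) * δ ≤ A)
    (hx : ∀ j, |x j - g j| ≤ h * logWeight (g j)) (hx' : ∀ j, |x' j - g j| ≤ h * logWeight (g j))
    (hxx : ∀ j, |x j - x' j| ≤ d * (h * logWeight (g j)))
    (hr : ∀ j, |r j - r' j| ≤ d * (A * (χ j * g j ^ 3))) (hu : |u - u'| ≤ d * (A * g 0 ^ 2))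
    (j : ℕ) :
    |gNext P g u r x j - gNext P g u' r' x' j| ≤ d * (A * (1 + 8 * L) * logWeight (g j)) := by
  have key : ∀ j, |gNext P g u r x j - gNext P g u' r' x' j|
      ≤ d * A * (1 + 8 * ∑ k ∈ Finset.range j, χ k * g k) * g j ^ 2 := by
    intro j
    induction j with
    | zero => simp only [gNext]; simpa [mul_assoc] using hu
    | succ j ih =>
      have hg := hE.coupling.pos j
      have hχ := hE.weight.pos j
      have hχ1 := hE.weight.le_one j
      have hω := hE.logWeight_pos j
      have hl := hE.log_le j
      have hl2 := hE.log_sq_le j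
      have hb := hE.beta_le j
      have hδ0 := hE.delta_pos
      have e0 : gNext P g u r x (j + 1) - gNext P g u' r' x' (j + 1)
          = (1 - P.beta j * g j) ^ 2 * (gNext P g u r x j - gNext P g u' r' x' j)
            + ((r j - r' j) - (P.beta j * g j) ^ 2 * (x j - x' j)
              - P.beta j * ((x j - x' j) * ((x j - g j) + (x' j - g j)))) := by
        simp only [gNext]; ring
      have e1 : |(P.beta j * g j) ^ 2 * (x j - x' j)| ≤ d * (B ^ 2 * h * δ) * (χ j * g j ^ 3) := by
        rw [abs_mul, abs_pow, abs_mul, abs_of_pos hg]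
        calc (|P.beta j| * g j) ^ 2 * |x j - x' j|
            ≤ (B * χ j * g j) ^ 2 * (d * (h * logWeight (g j))) := by gcongr; exact hxx j
          _ = d * (B ^ 2 * h) * (g j * |Real.log (g j)|) * (χ j * χ j * g j ^ 3) := by
              unfold logWeight; ring
          _ ≤ d * (B ^ 2 * h) * δ * (χ j * 1 * g j ^ 3) := by gcongr
          _ = _ := by ring
      have e2 : |P.beta j * ((x j - x' j) * ((x j - g j) + (x' j - g j)))|
          ≤ d * (2 * B * h ^ 2 * δ) * (χ j * g j ^ 3) := by
        have h1 : |(x j - g j) + (x' j - g j)| ≤ 2 * (h * logWeight (g j)) :=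
          (abs_add_le _ _).trans (by linarith [hx j, hx' j])
        rw [abs_mul, abs_mul]
        calc |P.beta j| * (|x j - x' j| * |(x j - g j) + (x' j - g j)|)
            ≤ (B * χ j) * ((d * (h * logWeight (g j))) * (2 * (h * logWeight (g j)))) := by
              gcongr; exact hxx j
          _ = d * (2 * B * h ^ 2) * (g j * |Real.log (g j)| ^ 2) * (χ j * g j ^ 3) := by
              unfold logWeight; ring
          _ ≤ d * (2 * B * h ^ 2) * δ * (χ j * g j ^ 3) := by gcongr
          _ = _ := by ring
      -- The perturbation and the nonlinear remainder each contribute `A χ g³`, and `g_j² ≤ 4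
      -- g_{j+1}²`: hence the factor 8.
      have e3 : |(r j - r' j) - (P.beta j * g j) ^ 2 * (x j - x' j)
              - P.beta j * ((x j - x' j) * ((x j - g j) + (x' j - g j)))|
          ≤ d * A * (8 * (χ j * g j)) * g (j + 1) ^ 2 := by
        have h1 : d * ((B ^ 2 * h + 2 * B * h ^ 2) * δ) * (χ j * g j ^ 3)
            ≤ d * A * (χ j * g j ^ 3) := by gcongr
        have h2 : d * A * (2 * (χ j * g j)) * g j ^ 2
            ≤ d * A * (2 * (χ j * g j)) * (4 * g (j + 1) ^ 2) := by
          gcongr; exact hE.sq_le_four hδ j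
        have h3 := abs_sub (r j - r' j - (P.beta j * g j) ^ 2 * (x j - x' j))
          (P.beta j * ((x j - x' j) * ((x j - g j) + (x' j - g j))))
        have h4 := abs_sub (r j - r' j) ((P.beta j * g j) ^ 2 * (x j - x' j))
        have h5 := hr j
        nlinarith
      have e4 : (1 - P.beta j * g j) ^ 2 * g j ^ 2 = g (j + 1) ^ 2 := by
        rw [hE.g_step j]; ring
      rw [e0]
      calc _ ≤ (1 - P.beta j * g j) ^ 2 * |gNext P g u r x j - gNext P g u' r' x' j|
              + d * A * (8 * (χ j * g j)) * g (j + 1) ^ 2 := by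
            refine (abs_add_le _ _).trans (add_le_add ?_ e3)
            rw [abs_mul, abs_of_nonneg (sq_nonneg _)]
        _ ≤ (1 - P.beta j * g j) ^ 2 *
              (d * A * (1 + 8 * ∑ k ∈ Finset.range j, χ k * g k) * g j ^ 2)
              + d * A * (8 * (χ j * g j)) * g (j + 1) ^ 2 := by gcongr
        _ = d * A * (1 + 8 * ∑ k ∈ Finset.range (j + 1), χ k * g k) * g (j + 1) ^ 2 := by
            rw [← e4, Finset.sum_range_succ]; ring
  refine (key j).trans ?_
  have h1 := hE.sum_le_log j
  have h2 := hE.one_le_log j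
  calc d * A * (1 + 8 * ∑ k ∈ Finset.range j, χ k * g k) * g j ^ 2
      ≤ d * A * (|Real.log (g j)| + 8 * (L * |Real.log (g j)|)) * g j ^ 2 := by gcongr
    _ = _ := by unfold logWeight; ring

/-- `t |log t|` is monotone near 0 up to constants. Write `-log t = -log s + log(s/t)` and use `log
u ≤ u - 1`; the resulting `s - t` is absorbed because `|log s| ≥ 1`. -/
theorem mul_abs_log_le {s t : ℝ} (hs : 0 < s) (ht : 0 < t) (hts : t ≤ 2 * s) (ht1 : t ≤ 1)
    (hs1 : s ≤ 1) (hlog : 1 ≤ |Real.log s|) : t * |Real.log t| ≤ 2 * (s * |Real.log s|) := by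
  rw [abs_of_nonpos (Real.log_nonpos hs.le hs1)] at hlog ⊢
  rw [abs_of_nonpos (Real.log_nonpos ht.le ht1)]
  have h1 : Real.log s - Real.log t ≤ s / t - 1 := by
    rw [← Real.log_div hs.ne' ht.ne']
    exact Real.log_le_sub_one_of_pos (by positivity)
  have h2 : t * (Real.log s - Real.log t) ≤ s - t := by
    have := mul_le_mul_of_nonneg_left h1 ht.le
    rwa [mul_sub t (s / t), mul_div_cancel₀ _ ht.ne', mul_one] at this
  nlinarith

theorem sum_logWeight_le (hE : FlowEnv Ω B C S lam₀ L Z δ P χ g z μ) (j n : ℕ) :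
    ∑ k ∈ Finset.range n, χ (j + k) * (g (j + k) * logWeight (g (j + k)))
      ≤ 2 * L * (χ j * logWeight (g j)) := by
  have hg := hE.coupling.pos j
  calc _ ≤ ∑ k ∈ Finset.range n, (χ (j + k) * g (j + k) ^ 2) * (2 * (g j * |Real.log (g j)|)) := by
        refine Finset.sum_le_sum fun k _ => ?_
        have h1 := mul_abs_log_le hg (hE.coupling.pos (j + k)) (hE.coupling.quasi_antitone j k)
          (hE.coupling.le_one _) (hE.coupling.le_one _) (hE.one_le_log j)
        have h2 : 0 ≤ χ (j + k) * g (j + k) ^ 2 := mul_nonneg (hE.weight.pos _).le (sq_nonneg _)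
        calc _ = (χ (j + k) * g (j + k) ^ 2) * (g (j + k) * |Real.log (g (j + k))|) := by
              unfold logWeight; ring
          _ ≤ _ := by gcongr
    _ = (∑ k ∈ Finset.range n, χ (j + k) * g (j + k) ^ 2) * (2 * (g j * |Real.log (g j)|)) := by
        rw [Finset.sum_mul]
    _ ≤ (L * (χ j * g j)) * (2 * (g j * |Real.log (g j)|)) := by
        gcongr; exact hE.coupling.sum_sq_le j n
    _ = _ := by unfold logWeight; ring

/-- Source terms of the size `χ g ω` give solutions from infinity of the size `χ ω`. -/
theorem sum_backTerm_le (hE : FlowEnv Ω B C S lam₀ L Z δ P χ g z μ) {f : ℕ → ℝ} {Q : ℝ}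
    (hQ : 0 ≤ Q) (hf : ∀ j, |f j| ≤ Q * (χ j * (g j * logWeight (g j)))) (j n : ℕ) :
    ∑ l ∈ Finset.range n, |backTerm (fun j => 1 - P.zeta j * g j) f j l|
      ≤ 4 * L * Q * (χ j * logWeight (g j)) := by
  calc _ ≤ ∑ l ∈ Finset.range n, 2 * Q * (χ (j + l) * (g (j + l) * logWeight (g (j + l)))) := by
        refine Finset.sum_le_sum fun l _ => ?_
        refine (abs_backTerm_le_of_prod (m := 1 / 2) (by norm_num)
          (fun j l => (hE.half_le_prod j l).trans (le_abs_self _)) j l).trans ?_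
        norm_num
        linarith [hf (j + l)]
    _ = 2 * Q * ∑ l ∈ Finset.range n, χ (j + l) * (g (j + l) * logWeight (g (j + l))) := by
        rw [Finset.mul_sum]
    _ ≤ 2 * Q * (2 * L * (χ j * logWeight (g j))) := by gcongr; exact hE.sum_logWeight_le j n
    _ = _ := by ring

/-- Source terms of the size `χ g²` are summable. -/
theorem sum_backTerm_sq_le (hE : FlowEnv Ω B C S lam₀ L Z δ P χ g z μ) {f : ℕ → ℝ} {Q : ℝ}
    (hQ : 0 ≤ Q) (hf : ∀ j, |f j| ≤ Q * (χ j * g j ^ 2)) (j n : ℕ) :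
    ∑ l ∈ Finset.range n, |backTerm (fun j => 1 - P.zeta j * g j) f j l|
      ≤ 2 * L * Q * (χ j * g j) := by
  calc _ ≤ ∑ l ∈ Finset.range n, 2 * Q * (χ (j + l) * g (j + l) ^ 2) := by
        refine Finset.sum_le_sum fun l _ => ?_
        refine (abs_backTerm_le_of_prod (m := 1 / 2) (by norm_num)
          (fun j l => (hE.half_le_prod j l).trans (le_abs_self _)) j l).trans ?_
        norm_num
        linarith [hf (j + l)]
    _ = 2 * Q * ∑ l ∈ Finset.range n, χ (j + l) * g (j + l) ^ 2 := by
        rw [Finset.mul_sum]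
    _ ≤ 2 * Q * (L * (χ j * g j)) := by gcongr; exact hE.coupling.sum_sq_le j n
    _ = _ := by ring

end FlowEnv


theorem abs_mul_sub_mul_le {p q p' q' G T : ℝ} (hq : |q| ≤ G) (hp' : |p'| ≤ G)
    (hpp : |p - p'| ≤ T) (hqq : |q - q'| ≤ T) : |p * q - p' * q'| ≤ 2 * G * T := by
  have h0 : p * q - p' * q' = (p - p') * q + p' * (q - q') := by ring
  have hT : 0 ≤ T := (abs_nonneg _).trans hpp
  have hG : 0 ≤ G := (abs_nonneg _).trans hq
  rw [h0]
  refine (abs_add_le _ _).trans ?_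
  rw [abs_mul, abs_mul]
  have h1 := mul_le_mul hpp hq (abs_nonneg _) hT
  have h2 := mul_le_mul hp' hqq (abs_nonneg _) hG
  linarith

namespace FlowEnv

variable {Ω B C S lam₀ L Z δ : ℝ} {P : Coeffs} {χ g z μ : ℕ → ℝ}

theorem mul_logWeight_le (hE : FlowEnv Ω B C S lam₀ L Z δ P χ g z μ) {h : ℝ} (hh : 0 ≤ h)
    (hhδ : h * δ ≤ 1) (j : ℕ) : h * logWeight (g j) ≤ g j := by
  have h1 := mul_le_mul_of_nonneg_left (hE.logWeight_le j) hh
  have := hE.coupling.pos j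
  nlinarith

theorem mul_chi_logWeight_le (hE : FlowEnv Ω B C S lam₀ L Z δ P χ g z μ) {h : ℝ} (hh : 0 ≤ h)
    (hhδ : h * δ ≤ 1) (j : ℕ) : h * (χ j * logWeight (g j)) ≤ g j := by
  have h1 := hE.mul_logWeight_le hh hhδ j
  have h2 : 0 ≤ h * logWeight (g j) := mul_nonneg hh (hE.logWeight_pos j).le
  nlinarith [hE.weight.le_one j]

theorem abs_le_of_dev (hE : FlowEnv Ω B C S lam₀ L Z δ P χ g z μ) (hZ : 0 ≤ Z) {y w : ℝ} {j : ℕ}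
    (hy : |y| ≤ Z * (χ j * g j)) (hw : |w - y| ≤ g j) : |w| ≤ (Z + 1) * g j := by
  have h1 : |w| ≤ |w - y| + |y| := by simpa using abs_add_le (w - y) y
  have h2 : Z * (χ j * g j) ≤ Z * g j := by
    gcongr
    nlinarith [hE.weight.le_one j, hE.coupling.pos j]
  linarith

theorem abs_zSource_le (hE : FlowEnv Ω B C S lam₀ L Z δ P χ g z μ) (hC : 0 ≤ C)
    (hZ : 0 ≤ Z) {h A : ℝ} (hh : 0 ≤ h) (hhδ : h * δ ≤ 1) (hA : 0 ≤ A) {r x w : ℕ → ℝ}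
    (hx : ∀ j, |x j - g j| ≤ h * logWeight (g j))
    (hw : ∀ j, |w j - z j| ≤ h * (χ j * logWeight (g j)))
    (hr : ∀ j, |r j| ≤ A * (χ j * g j ^ 3)) (j : ℕ) :
    |zSource P g r x w j| ≤ (C * (5 + Z) + A) * (χ j * g j ^ 2) := by
  have hg := hE.coupling.pos j
  have hg1 := hE.coupling.le_one j
  have hχ := hE.weight.pos j
  have hxg := (hx j).trans (hE.mul_logWeight_le hh hhδ j)
  have hx2 : |x j| ≤ 2 * g j := by
    have : |x j| ≤ |x j - g j| + |g j| := by simpa using abs_add_le (x j - g j) (g j)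
    rw [abs_of_pos hg] at this; linarith
  have hw2 := hE.abs_le_of_dev hZ (hE.z_le j) ((hw j).trans (hE.mul_chi_logWeight_le hh hhδ j))
  have e1 : |P.theta j * x j ^ 2| ≤ C * χ j * (2 * g j) ^ 2 := by
    rw [abs_mul, abs_pow]; gcongr; exact hE.coeff.theta_le j
  have e2 : |P.zeta j * (x j - g j) * w j| ≤ C * χ j * g j * ((Z + 1) * g j) := by
    rw [abs_mul, abs_mul]; gcongr; exact hE.coeff.zeta_le j
  have e3 : |r j| ≤ A * (χ j * g j ^ 2) := (hr j).trans (by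
    gcongr A * (χ j * ?_)
    exact pow_le_pow_of_le_one hg.le hg1 (by norm_num))
  have h0 : |zSource P g r x w j| ≤ |P.theta j * x j ^ 2| + |P.zeta j * (x j - g j) * w j|
      + |r j| := by
    unfold zSource
    refine (abs_add_le _ _).trans (add_le_add ((abs_sub _ _).trans ?_) le_rfl)
    rw [abs_neg]
  nlinarith

theorem zNext_summable (hE : FlowEnv Ω B C S lam₀ L Z δ P χ g z μ) (hC : 0 ≤ C)
    (hZ : 0 ≤ Z) {h A : ℝ} (hh : 0 ≤ h) (hhδ : h * δ ≤ 1) (hA : 0 ≤ A) {r x w : ℕ → ℝ}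
    (hx : ∀ j, |x j - g j| ≤ h * logWeight (g j))
    (hw : ∀ j, |w j - z j| ≤ h * (χ j * logWeight (g j)))
    (hr : ∀ j, |r j| ≤ A * (χ j * g j ^ 3)) (j : ℕ) :
    Summable (backTerm (fun j => 1 - P.zeta j * g j) (zSource P g r x w) j) :=
  backTerm_summable (hE.sum_backTerm_sq_le (by positivity)
    (hE.abs_zSource_le hC hZ hh hhδ hA hx hw hr) j)

/-- The arguments `x`, `x'` stand for new `g`-components, whose deviations are of size `A₁` and not
`h`, so the bound does not grow with `h`. In `Z + 6 = 4 + (Z + 1) + 1` the 4 comes from the `θ`-term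
and the rest from the two parts of the `ζ`-term. -/
theorem zNext_sub_le (hE : FlowEnv Ω B C S lam₀ L Z δ P χ g z μ) (hC : 0 ≤ C)
    (hZ : 0 ≤ Z) {h A A₁ A' d : ℝ} (hh : 0 ≤ h) (hhδ : h * δ ≤ 1) (hA : 0 ≤ A) (hA' : 0 ≤ A')
    (hA₁ : 0 ≤ A₁) (hA₁h : A₁ ≤ h) (hd : 0 ≤ d) {r r' x x' w w' : ℕ → ℝ}
    (hx : ∀ j, |x j - g j| ≤ A₁ * logWeight (g j))
    (hx' : ∀ j, |x' j - g j| ≤ A₁ * logWeight (g j))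
    (hxx : ∀ j, |x j - x' j| ≤ d * (A₁ * logWeight (g j)))
    (hw : ∀ j, |w j - z j| ≤ h * (χ j * logWeight (g j)))
    (hw' : ∀ j, |w' j - z j| ≤ h * (χ j * logWeight (g j)))
    (hww : ∀ j, |w j - w' j| ≤ d * (h * (χ j * logWeight (g j))))
    (hr : ∀ j, |r j| ≤ A' * (χ j * g j ^ 3)) (hr' : ∀ j, |r' j| ≤ A' * (χ j * g j ^ 3))
    (hrr : ∀ j, |r j - r' j| ≤ d * (A * (χ j * g j ^ 3))) (j : ℕ) :
    |zNext P g r x w j - zNext P g r' x' w' j|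
      ≤ d * (4 * L * (C * A₁ * (Z + 6) + A) * (χ j * logWeight (g j))) := by
  have hxh : ∀ j, A₁ * logWeight (g j) ≤ h * logWeight (g j) := fun j =>
    mul_le_mul_of_nonneg_right hA₁h (hE.logWeight_pos j).le
  unfold zNext
  rw [backSum_sub (hE.zNext_summable hC hZ hh hhδ hA' (fun j => (hx j).trans (hxh j)) hw hr j)
    (hE.zNext_summable hC hZ hh hhδ hA' (fun j => (hx' j).trans (hxh j)) hw' hr' j)]
  have hf : ∀ j, |zSource P g r x w j - zSource P g r' x' w' j|
      ≤ (d * (C * A₁ * (Z + 6) + A)) * (χ j * (g j * logWeight (g j))) := by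
    intro j
    have hg := hE.coupling.pos j
    have hχ := hE.weight.pos j
    have hχ1 := hE.weight.le_one j
    have hω := hE.logWeight_pos j
    have hxg := ((hx j).trans (hxh j)).trans (hE.mul_logWeight_le hh hhδ j)
    have hxg' := ((hx' j).trans (hxh j)).trans (hE.mul_logWeight_le hh hhδ j)
    have hsum : |x j + x' j| ≤ 4 * g j := by
      have e : x j + x' j = (x j - g j) + (x' j - g j) + 2 * g j := by ring
      rw [e]
      refine (abs_add_le _ _).trans ?_
      have := abs_add_le (x j - g j) (x' j - g j)
      rw [abs_of_pos (by linarith : 0 < 2 * g j)]; linarith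
    have hwb := hE.abs_le_of_dev hZ (hE.z_le j) ((hw j).trans (hE.mul_chi_logWeight_le hh hhδ j))
    have hwd : |w j - w' j| ≤ d * g j := (hww j).trans
      (mul_le_mul_of_nonneg_left (hE.mul_chi_logWeight_le hh hhδ j) hd)
    have e0 : zSource P g r x w j - zSource P g r' x' w' j
        = -(P.theta j * ((x j - x' j) * (x j + x' j)))
          - P.zeta j * ((x j - x' j) * w j + (x' j - g j) * (w j - w' j)) + (r j - r' j) := by
      unfold zSource; ring
    have e1 : |P.theta j * ((x j - x' j) * (x j + x' j))|
        ≤ C * χ j * ((d * (A₁ * logWeight (g j))) * (4 * g j)) := by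
      rw [abs_mul, abs_mul]
      gcongr
      · exact hE.coeff.theta_le j
      · exact hxx j
    have e2 : |P.zeta j * ((x j - x' j) * w j + (x' j - g j) * (w j - w' j))|
        ≤ C * χ j * ((d * (A₁ * logWeight (g j))) * ((Z + 1) * g j)
          + (A₁ * logWeight (g j)) * (d * g j)) := by
      rw [abs_mul]
      gcongr
      · exact hE.coeff.zeta_le j
      · refine (abs_add_le _ _).trans ?_
        rw [abs_mul, abs_mul]
        gcongr
        · exact hxx j
        · exact hx' j
    have e3 : |r j - r' j| ≤ d * A * (χ j * (g j * logWeight (g j))) := by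
      refine (hrr j).trans ?_
      have := hE.sq_le_logWeight j
      calc d * (A * (χ j * g j ^ 3)) = d * A * (χ j * (g j * g j ^ 2)) := by ring
        _ ≤ _ := by gcongr
    rw [e0]
    refine (abs_add_le _ _).trans (le_trans (add_le_add ((abs_sub _ _).trans
      (add_le_add ((abs_neg _).le.trans e1) e2)) e3) (le_of_eq ?_))
    ring
  refine (abs_backSum_le (hE.sum_backTerm_le (by positivity) hf j)).trans (le_of_eq ?_)
  ring

/-- Two factors `1 + δ` come from `g²` and one from the logarithm; `(1 + δ)³ ≤ 1 + 7δ` for `δ ≤ 1`.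
-/
theorem weight_succ_le (hE : FlowEnv Ω B C S lam₀ L Z δ P χ g z μ) (hδ : δ ≤ 1) (j : ℕ) :
    χ (j + 1) * logWeight (g (j + 1)) ≤ (1 + 7 * δ) * (χ j * logWeight (g j)) := by
  have hδ0 := hE.delta_pos
  have hg := hE.coupling.pos j
  have hg' := hE.coupling.pos (j + 1)
  have hχ := hE.weight.pos j
  have h3 : (1 + δ) ^ 3 ≤ 1 + 7 * δ := by nlinarith [mul_pos hδ0 hδ0]
  have h1 : logWeight (g (j + 1)) ≤ (1 + δ) ^ 3 * logWeight (g j) := by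
    unfold logWeight
    calc g (j + 1) ^ 2 * |Real.log (g (j + 1))|
        ≤ ((1 + δ) * g j) ^ 2 * ((1 + δ) * |Real.log (g j)|) := by
          gcongr
          · exact hE.succ_le j
          · exact hE.log_succ_le j
      _ = _ := by ring
  have hω := hE.logWeight_pos j
  calc χ (j + 1) * logWeight (g (j + 1)) ≤ χ j * ((1 + δ) ^ 3 * logWeight (g j)) :=
        mul_le_mul (hE.weight.succ_le j) h1 (hE.logWeight_pos _).le hχ.le
    _ ≤ χ j * ((1 + 7 * δ) * logWeight (g j)) := by gcongr
    _ = _ := by ring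

/-- The shifted term costs `1 + 7δ`, which `λ⁻¹` overcomes. The terms linear in `g` and `z`
contribute `C(A₁ + A₂)`, free of `h`; each of the five quadratic terms carries a factor `g_j ≤ δ`,
which gives the `10 C (Z + 2) δ h`. -/
theorem muNext_sub_le (hE : FlowEnv Ω B C S lam₀ L Z δ P χ g z μ) (hδ : δ ≤ 1) (hC : 0 ≤ C)
    (hZ : 0 ≤ Z) (hlam : 1 < lam₀) {h A A₁ A₂ d q : ℝ} (hh : 0 ≤ h) (hhδ : h * δ ≤ 1) (hA : 0 ≤ A)
    (hA₁ : 0 ≤ A₁) (hA₁h : A₁ ≤ h) (hA₂ : 0 ≤ A₂) (hA₂h : A₂ ≤ h) (hd : 0 ≤ d)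
    (hq : h * (1 + 7 * δ) + C * (A₁ + A₂) + A + 10 * C * (Z + 2) * δ * h ≤ lam₀ * (q * h))
    {r r' x x' w w' ν ν' : ℕ → ℝ}
    (hx : ∀ j, |x j - g j| ≤ A₁ * logWeight (g j))
    (hx' : ∀ j, |x' j - g j| ≤ A₁ * logWeight (g j))
    (hxx : ∀ j, |x j - x' j| ≤ d * (A₁ * logWeight (g j)))
    (hw : ∀ j, |w j - z j| ≤ A₂ * (χ j * logWeight (g j)))
    (hw' : ∀ j, |w' j - z j| ≤ A₂ * (χ j * logWeight (g j)))
    (hww : ∀ j, |w j - w' j| ≤ d * (A₂ * (χ j * logWeight (g j))))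
    (hν : ∀ j, |ν j - μ j| ≤ h * (χ j * logWeight (g j)))
    (hν' : ∀ j, |ν' j - μ j| ≤ h * (χ j * logWeight (g j)))
    (hνν : ∀ j, |ν j - ν' j| ≤ d * (h * (χ j * logWeight (g j))))
    (hrr : ∀ j, |r j - r' j| ≤ d * (A * (χ j * g j ^ 3))) (j : ℕ) :
    |muNext P r x w ν j - muNext P r' x' w' ν' j| ≤ d * (q * h * (χ j * logWeight (g j))) := by
  have hg := hE.coupling.pos j
  have hg1 := hE.coupling.le_one j
  have hχ := hE.weight.pos j
  have hχ1 := hE.weight.le_one j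
  have hω := hE.logWeight_pos j
  have hδ0 := hE.delta_pos
  set ω := logWeight (g j) with hωdef
  have hχω : χ j * ω ≤ ω := by nlinarith
  have hcw := hE.mul_chi_logWeight_le hh hhδ j
  have hcg := hE.mul_logWeight_le hh hhδ j
  rw [← hωdef] at hcw hcg
  have hA₁ω : A₁ * ω ≤ h * ω := mul_le_mul_of_nonneg_right hA₁h hω.le
  have hA₂ω : A₂ * (χ j * ω) ≤ h * (χ j * ω) := mul_le_mul_of_nonneg_right hA₂h (by positivity)
  set G := (Z + 2) * g j with hG
  have hG0 : 0 ≤ G := by positivity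
  have hGZ : (Z + 1) * g j ≤ G := by rw [hG]; nlinarith
  have bx : ∀ y, |y - g j| ≤ A₁ * ω → |y| ≤ G := by
    intro y hy
    have h1 : |y| ≤ |y - g j| + |g j| := by simpa using abs_add_le (y - g j) (g j)
    rw [abs_of_pos hg] at h1
    have : 2 * g j ≤ G := by rw [hG]; nlinarith
    linarith
  have bw : ∀ y, |y - z j| ≤ A₂ * (χ j * ω) → |y| ≤ G := fun y hy =>
    (hE.abs_le_of_dev hZ (hE.z_le j) (hy.trans (hA₂ω.trans hcw))).trans hGZ
  have bν : ∀ y, |y - μ j| ≤ h * (χ j * ω) → |y| ≤ G := fun y hy =>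
    (hE.abs_le_of_dev hZ (hE.mu_le j) (hy.trans hcw)).trans hGZ
  have b1 := bx _ (hx j)
  have b1' := bx _ (hx' j)
  have b2 := bw _ (hw j)
  have b2' := bw _ (hw' j)
  have b3 := bν _ (hν j)
  have b3' := bν _ (hν' j)
  set T := d * (h * ω) with hT
  have hT0 : 0 ≤ T := by positivity
  have t1 : |x j - x' j| ≤ T := (hxx j).trans (mul_le_mul_of_nonneg_left hA₁ω hd)
  have t2 : |w j - w' j| ≤ T := (hww j).trans (mul_le_mul_of_nonneg_left
    (hA₂ω.trans (mul_le_mul_of_nonneg_left hχω hh)) hd)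
  have t3 : |ν j - ν' j| ≤ T := (hνν j).trans (mul_le_mul_of_nonneg_left
    (mul_le_mul_of_nonneg_left hχω hh) hd)
  have quad : ∀ (c p q p' q' : ℝ), |c| ≤ C * χ j → |q| ≤ G → |p'| ≤ G → |p - p'| ≤ T →
      |q - q'| ≤ T → |c * (p * q - p' * q')| ≤ C * χ j * (2 * G * T) := by
    intro c p q p' q' hc h1 h2 h3 h4
    rw [abs_mul]
    exact mul_le_mul hc (abs_mul_sub_mul_le h1 h2 h3 h4) (abs_nonneg _) (by positivity)
  have q1 := quad _ _ _ _ _ (hE.coeff.ups_gg_le j) b1 b1' t1 t1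
  have q2 := quad _ _ _ _ _ (hE.coeff.ups_gz_le j) b2 b1' t1 t2
  have q3 := quad _ _ _ _ _ (hE.coeff.ups_gmu_le j) b3 b1' t1 t3
  have q4 := quad _ _ _ _ _ (hE.coeff.ups_zz_le j) b2 b2' t2 t2
  have q5 := quad _ _ _ _ _ (hE.coeff.ups_zmu_le j) b3 b2' t2 t3
  have l1 : |P.eta j * (x j - x' j)| ≤ C * χ j * (d * (A₁ * ω)) := by
    rw [abs_mul]; exact mul_le_mul (hE.coeff.eta_le j) (hxx j) (abs_nonneg _) (by positivity)
  have l2 : |P.gamma j * (w j - w' j)| ≤ C * χ j * (d * (A₂ * ω)) := by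
    rw [abs_mul]
    refine mul_le_mul (hE.coeff.gamma_le j) ((hww j).trans ?_) (abs_nonneg _) (by positivity)
    gcongr
  have l3 : |r j - r' j| ≤ d * (A * (χ j * ω)) := by
    refine (hrr j).trans ?_
    have h1 := hE.sq_le_logWeight j
    have h2 : g j ^ 3 ≤ g j ^ 2 := pow_le_pow_of_le_one hg.le hg1 (by norm_num)
    gcongr
    exact h2.trans h1
  have l4 : |ν (j + 1) - ν' (j + 1)| ≤ d * (h * ((1 + 7 * δ) * (χ j * ω))) := by
    exact (hνν (j + 1)).trans (mul_le_mul_of_nonneg_left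
      (mul_le_mul_of_nonneg_left (hE.weight_succ_le hδ j) hh) hd)
  have e0 : muNext P r x w ν j - muNext P r' x' w' ν' j = (P.lam j)⁻¹ *
      ((ν (j + 1) - ν' (j + 1)) - P.eta j * (x j - x' j) - P.gamma j * (w j - w' j)
        + P.ups_gg j * (x j * x j - x' j * x' j) + P.ups_gz j * (x j * w j - x' j * w' j)
        + P.ups_gmu j * (x j * ν j - x' j * ν' j) + P.ups_zz j * (w j * w j - w' j * w' j)
        + P.ups_zmu j * (w j * ν j - w' j * ν' j) - (r j - r' j)) := by
    unfold muNext; ring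
  have hlam0 : 0 < lam₀ := by linarith
  have hlamj := hE.coeff.le_lam j
  rw [e0, abs_mul, abs_inv, abs_of_pos (hlam0.trans_le hlamj), inv_mul_eq_div,
    div_le_iff₀ (hlam0.trans_le hlamj)]
  have e1 : 10 * (C * χ j * (G * T)) ≤ d * (10 * C * (Z + 2) * δ * h * (χ j * ω)) := by
    have := hE.g_le j
    calc 10 * (C * χ j * (G * T)) = d * (10 * C * (Z + 2) * g j * h * (χ j * ω)) := by
          rw [hG, hT]; ring
      _ ≤ _ := by gcongr
  have e2 := mul_le_mul_of_nonneg_left hq (show 0 ≤ d * (χ j * ω) by positivity)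
  have hq0 : 0 ≤ q * h := by
    have : 0 ≤ lam₀ * (q * h) := le_trans (by positivity) hq
    exact nonneg_of_mul_nonneg_right this hlam0
  have e3 : d * (q * h * (χ j * ω)) * lam₀ ≤ d * (q * h * (χ j * ω)) * P.lam j := by gcongr
  refine le_trans ?_ e3
  rw [abs_le] at *
  constructor <;> linarith

/-- With zero source the reference flow reproduces itself. Difference estimates with this second
argument thereby become bounds on the distance from the centre of the tube. -/
theorem gNext_center (P : Coeffs) (g : ℕ → ℝ) (j : ℕ) :
    gNext P g (g 0) (fun _ => 0) g j = g j := by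
  induction j with
  | zero => rfl
  | succ j ih => simp only [gNext, ih]; ring

theorem zNext_center (hE : FlowEnv Ω B C S lam₀ L Z δ P χ g z μ) (w : ℕ → ℝ) :
    zNext P g (fun _ => 0) g w = z := by
  rw [hE.z_eq, zNext, zBar]
  congr 1
  funext j
  simp [zSource]

theorem muNext_center (hE : FlowEnv Ω B C S lam₀ L Z δ P χ g z μ) (hlam : 1 < lam₀) (j : ℕ) :
    muNext P (fun _ => 0) g z μ j = μ j := by
  have h1 : P.lam j ≠ 0 := by have := hE.coeff.le_lam j; linarith
  rw [muNext, hE.mu_step j, inv_mul_eq_div, div_eq_iff h1]; ring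

end FlowEnv


/-! ### A contraction principle on sequence spaces -/

/-- A map of sequences which is a contraction for the supremum over the scales of the
distance functions `N j` has a unique fixed point, which is the limit of the iterates. -/
theorem exists_fixedPoint {X : ℕ → Type*} [∀ j, MetricSpace (X j)] [∀ j, CompleteSpace (X j)]
    (T : (∀ j, X j) → ∀ j, X j) (S S₀ : Set (∀ j, X j)) (N : ∀ j, X j → X j → ℝ) {q D c : ℝ}
    (hq0 : 0 ≤ q) (hq1 : q < 1) (hD : 0 ≤ D) (hc : 0 ≤ c)
    (hcont : ∀ j x, Continuous (N j x)) (hdist : ∀ j x y, dist x y ≤ c * N j x y)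
    (hS : S₀ ⊆ S) (hclosed : IsClosed S₀) (hmaps : ∀ x ∈ S₀, T x ∈ S₀)
    (hcontr : ∀ x ∈ S, ∀ y ∈ S, ∀ d, 0 ≤ d → (∀ j, N j (x j) (y j) ≤ d) →
      ∀ j, N j (T x j) (T y j) ≤ q * d)
    (hbdd : ∀ x ∈ S, ∀ y ∈ S, ∀ j, N j (x j) (y j) ≤ D) {x₀ : ∀ j, X j} (hx₀ : x₀ ∈ S₀) :
    ∃ x ∈ S₀, T x = x ∧ (∀ y ∈ S, T y = y → y = x) ∧
      ∀ k j, dist (T^[k] x₀ j) (x j) ≤ c * (q ^ k * D) := by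
  have hu : ∀ x ∈ S₀, ∀ k, T^[k] x ∈ S₀ := by
    intro x hx k
    induction k with
    | zero => exact hx
    | succ k ih => rw [Function.iterate_succ_apply']; exact hmaps _ ih
  -- Any two orbits in `S₀` approach each other at a geometric rate; applied to `x₀` and a later
  -- iterate of it, this is the Cauchy property in every coordinate.
  have hit : ∀ x ∈ S₀, ∀ y ∈ S₀, ∀ k j, N j (T^[k] x j) (T^[k] y j) ≤ q ^ k * D := by
    intro x hx y hy k
    induction k with
    | zero => intro j; simpa using hbdd x (hS hx) y (hS hy) j
    | succ k ih =>
      intro j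
      rw [Function.iterate_succ_apply', Function.iterate_succ_apply', pow_succ', mul_assoc]
      exact hcontr _ (hS (hu x hx k)) _ (hS (hu y hy k)) _ (by positivity) ih j
  have hlim0 : Tendsto (fun k => c * (q ^ k * D)) atTop (𝓝 0) := by
    simpa using ((tendsto_pow_atTop_nhds_zero_of_lt_one hq0 hq1).mul_const D).const_mul c
  have hpair : ∀ k n j, N j (T^[k] x₀ j) (T^[k + n] x₀ j) ≤ q ^ k * D := by
    intro k n j
    rw [Function.iterate_add_apply]
    exact hit _ hx₀ _ (hu x₀ hx₀ n) k j
  have hcau : ∀ j, CauchySeq fun k => T^[k] x₀ j := by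
    intro j
    refine cauchySeq_of_le_tendsto_0' (fun k => c * (q ^ k * D)) (fun n m hnm => ?_) hlim0
    obtain ⟨l, rfl⟩ := Nat.exists_eq_add_of_le hnm
    exact (hdist j _ _).trans (mul_le_mul_of_nonneg_left (hpair n l j) hc)
  choose x hx using fun j => cauchySeq_tendsto_of_complete (hcau j)
  have hxS : x ∈ S₀ := hclosed.mem_of_tendsto (tendsto_pi_nhds.2 hx)
    (Eventually.of_forall fun k => hu x₀ hx₀ k)
  have hNx : ∀ k j, N j (T^[k] x₀ j) (x j) ≤ q ^ k * D := by
    intro k j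
    refine le_of_tendsto' (((hcont j _).tendsto _).comp
      ((hx j).comp (tendsto_add_atTop_nat k))) fun n => ?_
    simpa [add_comm] using hpair k n j
  have hTx : T x = x := by
    funext j
    refine tendsto_nhds_unique ?_ ((hx j).comp (tendsto_add_atTop_nat 1))
    rw [tendsto_iff_dist_tendsto_zero]
    refine squeeze_zero (fun _ => dist_nonneg) (fun k => ?_) hlim0
    refine (hdist j _ _).trans (mul_le_mul_of_nonneg_left ?_ hc)
    have h1 := hcontr _ (hS (hu x₀ hx₀ k)) _ (hS hxS) _ (by positivity) (hNx k) j
    simp only [Function.comp_apply, Function.iterate_succ_apply']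
    refine h1.trans ?_
    have : 0 ≤ q ^ k * D := by positivity
    nlinarith
  refine ⟨x, hxS, hTx, fun y hy hTy => ?_, fun k j => (hdist j _ _).trans
    (mul_le_mul_of_nonneg_left (hNx k j) hc)⟩
  -- `S` need not be invariant: a fixed point in `S` stays there, so the contraction can be iterated
  -- on it.
  have hyx : ∀ k j, N j (y j) (x j) ≤ q ^ k * D := by
    intro k
    induction k with
    | zero => intro j; simpa using hbdd y hy x (hS hxS) j
    | succ k ih =>
      intro j
      have := hcontr _ hy _ (hS hxS) _ (by positivity) ih j
      rwa [hTy, hTx, ← mul_assoc, ← pow_succ'] at this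
  funext j
  refine dist_le_zero.1 (ge_of_tendsto' hlim0 fun k => ?_)
  exact (hdist j _ _).trans (mul_le_mul_of_nonneg_left (hyx k j) hc)

/-! ### The Picard map -/

section Picard

variable {W : ℕ → Type*} [∀ j, NormedAddCommGroup (W j)]

/-- The neighbourhood of `(0, g_j, z_j, μ_j)` with radii `a χ_j g_j³` and `h g_j² |log g_j|`,
`h χ_j g_j² |log g_j|`. -/
def tube (W : ℕ → Type*) [∀ j, NormedAddCommGroup (W j)] (χ g z μ : ℕ → ℝ) (a h : ℝ) (j : ℕ) :
    Set (W j × Coupling) :=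
  {p | ‖p.1‖ ≤ a * (χ j * g j ^ 3) ∧ |p.2.1 - g j| ≤ h * logWeight (g j) ∧
    |p.2.2.1 - z j| ≤ h * (χ j * logWeight (g j)) ∧
    |p.2.2.2 - μ j| ≤ h * (χ j * logWeight (g j))}

/-- The weighted distance on `W_j ⊕ ℝ³`. -/
noncomputable def wdist (χ g : ℕ → ℝ) (a h : ℝ) (j : ℕ) (p p' : W j × Coupling) : ℝ :=
  max (‖p.1 - p'.1‖ / (a * (χ j * g j ^ 3))) (max (|p.2.1 - p'.2.1| / (h * logWeight (g j)))
    (max (|p.2.2.1 - p'.2.2.1| / (h * (χ j * logWeight (g j))))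
      (|p.2.2.2 - p'.2.2.2| / (h * (χ j * logWeight (g j))))))

/-- Size and Lipschitz bounds of the perturbation. -/
structure PertBounds (κ R M : ℝ) (χ g : ℕ → ℝ) (D : ∀ j, Set (W j × Coupling))
    (ψ : ∀ j, W j × Coupling → W (j + 1)) (ρ : ∀ j, W j × Coupling → Coupling) : Prop where
  psi_zero_le : ∀ j, ∀ p ∈ D j, ‖ψ j (0, p.2)‖ ≤ R * (χ (j + 1) * g (j + 1) ^ 3)
  psi_lip : ∀ j, ∀ p ∈ D j, ∀ p' ∈ D j, ‖ψ j p - ψ j p'‖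
    ≤ κ * ‖p.1 - p'.1‖ + M * (χ (j + 1) * g (j + 1) ^ 2) * ‖p.2 - p'.2‖
  rho_le : ∀ j, ∀ p ∈ D j, ‖ρ j p‖ ≤ M * (χ (j + 1) * g (j + 1) ^ 3)
  rho_lip : ∀ j, ∀ p ∈ D j, ∀ p' ∈ D j, ‖ρ j p - ρ j p'‖
    ≤ M * ‖p.1 - p'.1‖ + M * (χ (j + 1) * g (j + 1) ^ 2) * ‖p.2 - p'.2‖

/-- The `K`-component of the Picard map. -/
def picardK (ψ : ∀ j, W j × Coupling → W (j + 1)) (K₀ : W 0) (x : ∀ j, W j × Coupling) : ∀ j, W j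
  | 0 => K₀
  | j + 1 => ψ j (x j)

/-- The `g`-component of the Picard map. -/
def picardG (P : Coeffs) (g : ℕ → ℝ) (ρ : ∀ j, W j × Coupling → Coupling) (g₀ : ℝ)
    (x : ∀ j, W j × Coupling) : ℕ → ℝ :=
  gNext P g g₀ (fun j => (ρ j (x j)).1) (fun j => (x j).2.1)

/-- The `z`-component of the Picard map. -/
noncomputable def picardZ (P : Coeffs) (g : ℕ → ℝ) (ρ : ∀ j, W j × Coupling → Coupling) (g₀ : ℝ)
    (x : ∀ j, W j × Coupling) : ℕ → ℝ :=
  zNext P g (fun j => (ρ j (x j)).2.1) (picardG P g ρ g₀ x) (fun j => (x j).2.2.1)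

/-- The `μ`-component of the Picard map. -/
noncomputable def picardMu (P : Coeffs) (g : ℕ → ℝ) (ρ : ∀ j, W j × Coupling → Coupling) (g₀ : ℝ)
    (x : ∀ j, W j × Coupling) : ℕ → ℝ :=
  muNext P (fun j => (ρ j (x j)).2.2) (picardG P g ρ g₀ x) (picardZ P g ρ g₀ x)
    (fun j => (x j).2.2.2)

/-- The Picard map, whose fixed points are the flows with the given boundary conditions. -/
noncomputable def picard (P : Coeffs) (g : ℕ → ℝ) (ψ : ∀ j, W j × Coupling → W (j + 1))
    (ρ : ∀ j, W j × Coupling → Coupling) (u₀ : W 0 × ℝ) (x : ∀ j, W j × Coupling) (j : ℕ) :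
    W j × Coupling :=
  (picardK ψ u₀.1 x j, picardG P g ρ u₀.2 x j, picardZ P g ρ u₀.2 x j, picardMu P g ρ u₀.2 x j)

/-- The numerical conditions under which the Picard map is a contraction with factor `q`, and maps
the tube of radii `a₁`, `r₀ h` into itself. -/
structure PicardConst (Ω B C lam₀ L Z δ a h κ R M A q r₀ a₁ : ℝ) : Prop where
  B_nonneg : 0 ≤ B
  C_nonneg : 0 ≤ C
  one_lt_lam : 1 < lam₀
  L_nonneg : 0 ≤ L
  Z_nonneg : 0 ≤ Z
  a_pos : 0 < a
  h_pos : 0 < h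
  Ω_pos : 0 < Ω
  κ_pos : 0 < κ
  M_pos : 0 < M
  A_nonneg : 0 ≤ A
  q_nonneg : 0 ≤ q
  q_lt_one : q < 1
  r₀_pos : 0 < r₀
  r₀_le : r₀ ≤ 1
  a₁_pos : 0 < a₁
  a₁_le : a₁ ≤ a
  δ_le : δ ≤ 1
  h_δ : h * δ ≤ 1
  g_cond : (B ^ 2 * h + 2 * B * h ^ 2) * δ ≤ A
  A₁_le : A * (1 + 8 * L) ≤ q * h
  A₂_le : 4 * L * (C * (A * (1 + 8 * L)) * (Z + 6) + A) ≤ q * h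
  mu_cond : h * (1 + 7 * δ) + C * (A * (1 + 8 * L) + 4 * L * (C * (A * (1 + 8 * L)) * (Z + 6) + A))
    + A + 10 * C * (Z + 2) * δ * h ≤ lam₀ * (q * h)
  K_cond : κ * Ω * (1 + 7 * δ) * a + 2 * M * h * δ ≤ q * a
  A_ge_lip : M * (a + 4 * (h * δ)) ≤ A
  A_ge_rho : 8 * M ≤ r₀ * A
  A_ge_one : 1 ≤ r₀ * A
  K_self : R + κ * Ω * (1 + 7 * δ) * a₁ ≤ a₁

namespace FlowEnv

variable {Ω B C S lam₀ L Z δ : ℝ} {P : Coeffs} {χ g z μ : ℕ → ℝ}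
  {a h κ R M A q r₀ a₁ : ℝ} {ψ : ∀ j, W j × Coupling → W (j + 1)}
  {ρ : ∀ j, W j × Coupling → Coupling}

theorem cube_le (hE : FlowEnv Ω B C S lam₀ L Z δ P χ g z μ) (hδ : δ ≤ 1) (hΩ : 0 < Ω) (j : ℕ) :
    χ j * g j ^ 3 ≤ Ω * (1 + 7 * δ) * (χ (j + 1) * g (j + 1) ^ 3) := by
  have hδ0 := hE.delta_pos
  have hg := hE.coupling.pos j
  have hg' := hE.coupling.pos (j + 1)
  have hχ := hE.weight.pos j
  have hχ' := hE.weight.pos (j + 1)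
  have h3 : (1 + δ) ^ 3 ≤ 1 + 7 * δ := by nlinarith [mul_pos hδ0 hδ0]
  calc χ j * g j ^ 3 ≤ (Ω * χ (j + 1)) * ((1 + δ) * g (j + 1)) ^ 3 := by
        gcongr
        · exact hE.weight.le_mul_succ j
        · exact hE.le_succ j
    _ = Ω * (1 + δ) ^ 3 * (χ (j + 1) * g (j + 1) ^ 3) := by ring
    _ ≤ _ := by gcongr

theorem cube_succ_le (hE : FlowEnv Ω B C S lam₀ L Z δ P χ g z μ) (j : ℕ) :
    χ (j + 1) * g (j + 1) ^ 3 ≤ 8 * (χ j * g j ^ 3) := by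
  have hg := hE.coupling.pos j
  have hg' := hE.coupling.pos (j + 1)
  have hχ := hE.weight.pos j
  calc χ (j + 1) * g (j + 1) ^ 3 ≤ χ j * (2 * g j) ^ 3 := by
        gcongr
        · exact hE.weight.succ_le j
        · exact hE.coupling.quasi_antitone j 1
    _ = _ := by ring

theorem sq_mul_logWeight_le (hE : FlowEnv Ω B C S lam₀ L Z δ P χ g z μ) (hδ : δ ≤ 1) (j : ℕ) :
    χ (j + 1) * g (j + 1) ^ 2 * logWeight (g j) ≤ 2 * δ * (χ (j + 1) * g (j + 1) ^ 3) := by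
  have hg := hE.coupling.pos j
  have hg' := hE.coupling.pos (j + 1)
  have hχ' := hE.weight.pos (j + 1)
  have hδ0 := hE.delta_pos
  have h1 : logWeight (g j) ≤ δ * (2 * g (j + 1)) :=
    (hE.logWeight_le j).trans (by
      have := hE.le_succ j
      gcongr
      nlinarith)
  calc χ (j + 1) * g (j + 1) ^ 2 * logWeight (g j)
      ≤ χ (j + 1) * g (j + 1) ^ 2 * (δ * (2 * g (j + 1))) := by gcongr
    _ = _ := by ring

theorem sq_mul_logWeight_le' (hE : FlowEnv Ω B C S lam₀ L Z δ P χ g z μ) (j : ℕ) :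
    χ (j + 1) * g (j + 1) ^ 2 * logWeight (g j) ≤ 4 * δ * (χ j * g j ^ 3) := by
  have hg := hE.coupling.pos j
  have hg' := hE.coupling.pos (j + 1)
  have hχ := hE.weight.pos j
  have hδ0 := hE.delta_pos
  calc χ (j + 1) * g (j + 1) ^ 2 * logWeight (g j)
      ≤ χ j * (2 * g j) ^ 2 * (δ * g j) := by
        gcongr
        · exact (hE.logWeight_pos j).le
        · exact hE.weight.succ_le j
        · exact hE.coupling.quasi_antitone j 1
        · exact hE.logWeight_le j
    _ = _ := by ring

theorem norm_coupling_le (hE : FlowEnv Ω B C S lam₀ L Z δ P χ g z μ) {d : ℝ} (hd : 0 ≤ d)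
    {v : Coupling} {j : ℕ} (h1 : |v.1| ≤ d * logWeight (g j))
    (h2 : |v.2.1| ≤ d * (χ j * logWeight (g j))) (h3 : |v.2.2| ≤ d * (χ j * logWeight (g j))) :
    ‖v‖ ≤ d * logWeight (g j) := by
  have hω := hE.logWeight_pos j
  have hle : d * (χ j * logWeight (g j)) ≤ d * logWeight (g j) := by
    gcongr
    nlinarith [hE.weight.le_one j]
  rw [Prod.norm_def, Prod.norm_def]
  exact max_le h1 (max_le (h2.trans hle) (h3.trans hle))

theorem rho_comp_le (hE : FlowEnv Ω B C S lam₀ L Z δ P χ g z μ)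
    (hc : PicardConst Ω B C lam₀ L Z δ a h κ R M A q r₀ a₁)
    (hp : PertBounds κ R M χ g (tube W χ g z μ a h) ψ ρ)
    {j : ℕ} {p : W j × Coupling} (hx : p ∈ tube W χ g z μ a h j) :
    ‖ρ j p‖ ≤ r₀ * (A * (χ j * g j ^ 3)) := by
  have hg := hE.coupling.pos j
  have hχ := hE.weight.pos j
  calc ‖ρ j p‖ ≤ M * (8 * (χ j * g j ^ 3)) := (hp.rho_le j _ hx).trans
        (mul_le_mul_of_nonneg_left (hE.cube_succ_le j) hc.M_pos.le)
    _ = 8 * M * (χ j * g j ^ 3) := by ring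
    _ ≤ r₀ * A * (χ j * g j ^ 3) := mul_le_mul_of_nonneg_right hc.A_ge_rho (by positivity)
    _ = _ := by ring

theorem tube_mono (hE : FlowEnv Ω B C S lam₀ L Z δ P χ g z μ) {a a' h h' : ℝ} (ha : a ≤ a')
    (hh : h ≤ h') (j : ℕ) : tube W χ g z μ a h j ⊆ tube W χ g z μ a' h' j := by
  have hg := hE.coupling.pos j
  have hχ := hE.weight.pos j
  have hω := hE.logWeight_pos j
  rintro p ⟨h1, h2, h3, h4⟩
  exact ⟨h1.trans (by gcongr), h2.trans (by gcongr), h3.trans (by gcongr), h4.trans (by gcongr)⟩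

theorem wdist_le_iff (hE : FlowEnv Ω B C S lam₀ L Z δ P χ g z μ) (ha : 0 < a) (hh : 0 < h) {j : ℕ}
    {p p' : W j × Coupling} {d : ℝ} :
    wdist χ g a h j p p' ≤ d ↔ ‖p.1 - p'.1‖ ≤ d * (a * (χ j * g j ^ 3)) ∧
      |p.2.1 - p'.2.1| ≤ d * (h * logWeight (g j)) ∧
      |p.2.2.1 - p'.2.2.1| ≤ d * (h * (χ j * logWeight (g j))) ∧
      |p.2.2.2 - p'.2.2.2| ≤ d * (h * (χ j * logWeight (g j))) := by
  have hg := hE.coupling.pos j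
  have hχ := hE.weight.pos j
  have hω := hE.logWeight_pos j
  rw [wdist, max_le_iff, max_le_iff, max_le_iff, div_le_iff₀ (by positivity),
    div_le_iff₀ (by positivity), div_le_iff₀ (by positivity), div_le_iff₀ (by positivity)]

theorem abs_le_norm_fst (v : Coupling) : |v.1| ≤ ‖v‖ := norm_fst_le v

theorem abs_le_norm_snd_fst (v : Coupling) : |v.2.1| ≤ ‖v‖ :=
  (norm_fst_le v.2).trans (norm_snd_le v)

theorem abs_le_norm_snd_snd (v : Coupling) : |v.2.2| ≤ ‖v‖ :=
  (norm_snd_le v.2).trans (norm_snd_le v)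

theorem const_nonneg (hc : PicardConst Ω B C lam₀ L Z δ a h κ R M A q r₀ a₁) :
    0 ≤ A * (1 + 8 * L) ∧ 0 ≤ 4 * L * (C * (A * (1 + 8 * L)) * (Z + 6) + A) ∧ q * h ≤ h := by
  have := hc.A_nonneg
  have := hc.L_nonneg
  have := hc.C_nonneg
  have := hc.Z_nonneg
  refine ⟨by positivity, by positivity, ?_⟩
  have := hc.h_pos; have := hc.q_lt_one
  nlinarith

theorem self_dev (hE : FlowEnv Ω B C S lam₀ L Z δ P χ g z μ) {k : ℝ} (hk : 0 ≤ k) (w : ℕ → ℝ)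
    (j : ℕ) : |w j - w j| ≤ k * logWeight (g j) ∧ |w j - w j| ≤ k * (χ j * logWeight (g j)) := by
  have := hE.logWeight_pos j
  have := hE.weight.pos j
  rw [sub_self, abs_zero]
  exact ⟨by positivity, by positivity⟩

theorem rho_radius_le (hE : FlowEnv Ω B C S lam₀ L Z δ P χ g z μ)
    (hc : PicardConst Ω B C lam₀ L Z δ a h κ R M A q r₀ a₁)
    (hp : PertBounds κ R M χ g (tube W χ g z μ a h) ψ ρ) {r : ℝ} (hr : r₀ ≤ r)
    {j : ℕ} {p : W j × Coupling} (hx : p ∈ tube W χ g z μ a h j) :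
    ‖ρ j p‖ ≤ r * (A * (χ j * g j ^ 3)) :=
  (hE.rho_comp_le hc hp hx).trans (by
    have := hE.coupling.pos j; have := hE.weight.pos j; have := hc.A_nonneg; gcongr)

/-- The radius `r` is free: `r = 1` gives an a priori bound on the large tube, `r = r₀` the
invariance of the small one. The condition `1 ≤ r₀ A` makes room for initial values within `g_0²` of
the reference one. -/
theorem picardG_dev (hE : FlowEnv Ω B C S lam₀ L Z δ P χ g z μ)
    (hc : PicardConst Ω B C lam₀ L Z δ a h κ R M A q r₀ a₁)
    (hp : PertBounds κ R M χ g (tube W χ g z μ a h) ψ ρ) {r : ℝ} (hr : r₀ ≤ r) {u : ℝ}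
    (hu : |u - g 0| ≤ g 0 ^ 2) {x : ∀ j, W j × Coupling}
    (hxD : ∀ j, x j ∈ tube W χ g z μ a h j)
    (hx : ∀ j, |(x j).2.1 - g j| ≤ r * (h * logWeight (g j))) (j : ℕ) :
    |picardG P g ρ u x j - g j| ≤ r * (A * (1 + 8 * L) * logWeight (g j)) := by
  have := hE.gNext_sub_le hc.δ_le hc.B_nonneg (u := u) (u' := g 0)
    (r := fun j => (ρ j (x j)).1) (r' := fun _ => 0) (x := fun j => (x j).2.1) (x' := g)
    hc.h_pos.le hc.A_nonneg (hc.r₀_pos.le.trans hr) hc.g_cond (fun j => (hxD j).2.1)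
    (fun j => (hE.self_dev hc.h_pos.le g j).1) hx
    (fun j => by
      rw [sub_zero]
      exact (abs_le_norm_fst _).trans (hE.rho_radius_le hc hp hr (hxD j)))
    (hu.trans (by
      have h1 := hc.A_ge_one
      have h2 := hc.A_nonneg
      have : 1 ≤ r * A := h1.trans (by gcongr)
      nlinarith [sq_nonneg (g 0)])) j
  rwa [gNext_center] at this

theorem picardZ_dev (hE : FlowEnv Ω B C S lam₀ L Z δ P χ g z μ)
    (hc : PicardConst Ω B C lam₀ L Z δ a h κ R M A q r₀ a₁)
    (hp : PertBounds κ R M χ g (tube W χ g z μ a h) ψ ρ) {r : ℝ} (hr : r₀ ≤ r) {u : ℝ}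
    (hu : |u - g 0| ≤ g 0 ^ 2) {x : ∀ j, W j × Coupling}
    (hxD : ∀ j, x j ∈ tube W χ g z μ a h j)
    (hx : ∀ j, |(x j).2.1 - g j| ≤ r * (h * logWeight (g j)))
    (hxz : ∀ j, |(x j).2.2.1 - z j| ≤ r * (h * (χ j * logWeight (g j)))) (j : ℕ) :
    |picardZ P g ρ u x j - z j|
      ≤ r * (4 * L * (C * (A * (1 + 8 * L)) * (Z + 6) + A) * (χ j * logWeight (g j))) := by
  obtain ⟨hA₁0, -, hqh⟩ := const_nonneg hc
  have h1 : ∀ j, |(x j).2.1 - g j| ≤ 1 * (h * logWeight (g j)) := fun j => by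
    rw [one_mul]; exact (hxD j).2.1
  have := hE.zNext_sub_le hc.C_nonneg hc.Z_nonneg (r := fun j => (ρ j (x j)).2.1)
    (r' := fun _ => 0) (x := picardG P g ρ u x) (x' := g) (w := fun j => (x j).2.2.1)
    (w' := z) hc.h_pos.le hc.h_δ hc.A_nonneg hc.A_nonneg hA₁0 (hc.A₁_le.trans hqh)
    (hc.r₀_pos.le.trans hr)
    (fun j => by simpa using hE.picardG_dev hc hp hc.r₀_le hu hxD h1 j)
    (fun j => (hE.self_dev hA₁0 g j).1) (hE.picardG_dev hc hp hr hu hxD hx)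
    (fun j => (hxD j).2.2.1) (fun j => (hE.self_dev hc.h_pos.le z j).2) hxz
    (fun j => (abs_le_norm_snd_fst _).trans
      (by simpa using hE.rho_radius_le hc hp hc.r₀_le (hxD j)))
    (fun j => by
      have := hE.coupling.pos j; have := hE.weight.pos j; have := hc.A_nonneg
      rw [abs_zero]; positivity)
    (fun j => by
      rw [sub_zero]
      exact (abs_le_norm_snd_fst _).trans (hE.rho_radius_le hc hp hr (hxD j))) j
  rwa [hE.zNext_center] at this

/-- The Picard map preserves tubes. -/
theorem picard_mem_tube (hE : FlowEnv Ω B C S lam₀ L Z δ P χ g z μ)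
    (hc : PicardConst Ω B C lam₀ L Z δ a h κ R M A q r₀ a₁)
    (hp : PertBounds κ R M χ g (tube W χ g z μ a h) ψ ρ) {a' r : ℝ}
    (ha' : a₁ ≤ a') (ha'a : a' ≤ a) (hr : r₀ ≤ r) (hr1 : r ≤ 1)
    (hK : R + κ * Ω * (1 + 7 * δ) * a' ≤ a') {u₀ : W 0 × ℝ} (hu1 : ‖u₀.1‖ ≤ a₁ * g 0 ^ 3)
    (hu2 : |u₀.2 - g 0| ≤ g 0 ^ 2) {x : ∀ j, W j × Coupling}
    (hx : ∀ j, x j ∈ tube W χ g z μ a' (r * h) j) (j : ℕ) :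
    picard P g ψ ρ u₀ x j ∈ tube W χ g z μ a' (r * h) j := by
  have hrh : r * h ≤ h := by have := hc.h_pos; nlinarith
  have hr0 : 0 ≤ r := hc.r₀_pos.le.trans hr
  have hxD : ∀ j, x j ∈ tube W χ g z μ a h j := fun j => hE.tube_mono ha'a hrh j (hx j)
  obtain ⟨hA₁0, hA₂0, hqh⟩ := const_nonneg hc
  have hω := hE.logWeight_pos
  have hxg : ∀ j, |(x j).2.1 - g j| ≤ r * (h * logWeight (g j)) := fun j => by
    rw [← mul_assoc]; exact (hx j).2.1
  have hxz : ∀ j, |(x j).2.2.1 - z j| ≤ r * (h * (χ j * logWeight (g j))) := fun j => by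
    rw [← mul_assoc]; exact (hx j).2.2.1
  have hG := hE.picardG_dev hc hp hr hu2 hxD hxg
  have hZ := hE.picardZ_dev hc hp hr hu2 hxD hxg hxz
  have hM : |picardMu P g ρ u₀.2 x j - μ j| ≤ r * (q * h * (χ j * logWeight (g j))) := by
    have := hE.muNext_sub_le hc.δ_le hc.C_nonneg hc.Z_nonneg hc.one_lt_lam
      (r := fun j => (ρ j (x j)).2.2) (r' := fun _ => 0) (x := picardG P g ρ u₀.2 x) (x' := g)
      (w := picardZ P g ρ u₀.2 x) (w' := z) (ν := fun j => (x j).2.2.2) (ν' := μ)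
      hc.h_pos.le hc.h_δ hc.A_nonneg hA₁0 (hc.A₁_le.trans hqh) hA₂0 (hc.A₂_le.trans hqh) hr0
      hc.mu_cond
      (fun j => (hG j).trans (mul_le_of_le_one_left (mul_nonneg hA₁0 (hω j).le) hr1))
      (fun j => (hE.self_dev hA₁0 g j).1) hG
      (fun j => (hZ j).trans (mul_le_of_le_one_left
        (mul_nonneg hA₂0 (mul_nonneg (hE.weight.pos j).le (hω j).le)) hr1))
      (fun j => (hE.self_dev hA₂0 z j).2) hZ (fun j => (hxD j).2.2.2)
      (fun j => (hE.self_dev hc.h_pos.le μ j).2)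
      (fun j => by rw [← mul_assoc]; exact (hx j).2.2.2)
      (fun j => by
        rw [sub_zero]
        exact (abs_le_norm_snd_snd _).trans (hE.rho_radius_le hc hp hr (hxD j))) j
    rwa [hE.muNext_center hc.one_lt_lam] at this
  have hχω : 0 ≤ χ j * logWeight (g j) := mul_nonneg (hE.weight.pos j).le (hω j).le
  refine ⟨?_, ?_, ?_, ?_⟩
  · cases j with
    | zero =>
      refine hu1.trans ?_
      have := hE.coupling.pos 0
      rw [hE.weight.zero, one_mul]
      gcongr
    | succ j =>
      have h1 := hp.psi_zero_le j _ (hxD j)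
      -- Comparison with the same couplings and `K = 0` splits `ψ` into a part bounded by `R` and a
      -- part Lipschitz in `K` with constant `κ`.
      have h0 : ((0, (x j).2) : W j × Coupling) ∈ tube W χ g z μ a h j := by
        refine ⟨?_, (hxD j).2⟩
        have := hE.coupling.pos j; have := hE.weight.pos j; have := hc.a_pos
        simp; positivity
      have h2 := hp.psi_lip j _ (hxD j) _ h0
      simp only [sub_zero, sub_self, norm_zero, mul_zero, add_zero] at h2
      have h3 : ‖ψ j (x j)‖ ≤ ‖ψ j (x j) - ψ j (0, (x j).2)‖ + ‖ψ j (0, (x j).2)‖ := by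
        simpa using norm_add_le (ψ j (x j) - ψ j (0, (x j).2)) (ψ j (0, (x j).2))
      have h4 : κ * ‖(x j).1‖ ≤ κ * (a' * (Ω * (1 + 7 * δ) * (χ (j + 1) * g (j + 1) ^ 3))) := by
        have ha'0 : 0 ≤ a' := hc.a₁_pos.le.trans ha'
        have hκ := hc.κ_pos.le
        gcongr
        exact (hx j).1.trans (mul_le_mul_of_nonneg_left (hE.cube_le hc.δ_le hc.Ω_pos j) ha'0)
      have h5 : 0 ≤ χ (j + 1) * g (j + 1) ^ 3 := by
        have := hE.coupling.pos (j + 1); have := hE.weight.pos (j + 1); positivity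
      have h6 := mul_le_mul_of_nonneg_right hK h5
      show ‖ψ j (x j)‖ ≤ _
      linarith
  · refine (hG j).trans ?_
    rw [mul_assoc r h]
    exact mul_le_mul_of_nonneg_left
      (mul_le_mul_of_nonneg_right (hc.A₁_le.trans hqh) (hω j).le) hr0
  · refine (hZ j).trans ?_
    rw [mul_assoc r h]
    exact mul_le_mul_of_nonneg_left
      (mul_le_mul_of_nonneg_right (hc.A₂_le.trans hqh) hχω) hr0
  · refine hM.trans ?_
    rw [mul_assoc r h]
    exact mul_le_mul_of_nonneg_left (mul_le_mul_of_nonneg_right hqh hχω) hr0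

/-- The Picard map is a contraction for the weighted distance. -/
theorem picard_contraction (hE : FlowEnv Ω B C S lam₀ L Z δ P χ g z μ)
    (hc : PicardConst Ω B C lam₀ L Z δ a h κ R M A q r₀ a₁)
    (hp : PertBounds κ R M χ g (tube W χ g z μ a h) ψ ρ) {u₀ : W 0 × ℝ}
    (hu2 : |u₀.2 - g 0| ≤ g 0 ^ 2) {x y : ∀ j, W j × Coupling}
    (hx : ∀ j, x j ∈ tube W χ g z μ a h j) (hy : ∀ j, y j ∈ tube W χ g z μ a h j) {d : ℝ}
    (hd : 0 ≤ d) (hxy : ∀ j, wdist χ g a h j (x j) (y j) ≤ d) (j : ℕ) :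
    wdist χ g a h j (picard P g ψ ρ u₀ x j) (picard P g ψ ρ u₀ y j) ≤ q * d := by
  have hiff := fun j (p p' : W j × Coupling) (d : ℝ) =>
    hE.wdist_le_iff hc.a_pos hc.h_pos (j := j) (p := p) (p' := p') (d := d)
  have hxy' := fun j => (hiff j _ _ _).1 (hxy j)
  obtain ⟨hA₁0, hA₂0, hqh⟩ := const_nonneg hc
  have hω := hE.logWeight_pos
  have hχω := fun j => mul_nonneg (hE.weight.pos j).le (hω j).le
  have hV : ∀ j, ‖(x j).2 - (y j).2‖ ≤ d * h * logWeight (g j) := fun j => by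
    obtain ⟨-, h2, h3, h4⟩ := hxy' j
    refine hE.norm_coupling_le (mul_nonneg hd hc.h_pos.le) ?_ ?_ ?_
    · rw [mul_assoc]; exact h2
    · rw [mul_assoc]; exact h3
    · rw [mul_assoc]; exact h4
  have hρ : ∀ j, ‖ρ j (x j) - ρ j (y j)‖ ≤ d * (A * (χ j * g j ^ 3)) := fun j => by
    have hg := hE.coupling.pos j
    have hg' := hE.coupling.pos (j + 1)
    have hχ := hE.weight.pos j
    have hχ' := hE.weight.pos (j + 1)
    have hM := hc.M_pos
    have hh := hc.h_pos
    refine (hp.rho_lip j _ (hx j) _ (hy j)).trans ?_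
    calc _ ≤ M * (d * (a * (χ j * g j ^ 3)))
          + M * (χ (j + 1) * g (j + 1) ^ 2) * (d * h * logWeight (g j)) := by
          gcongr
          · exact (hxy' j).1
          · exact hV j
      _ = d * (M * (a * (χ j * g j ^ 3)
          + h * (χ (j + 1) * g (j + 1) ^ 2 * logWeight (g j)))) := by ring
      _ ≤ d * (M * (a * (χ j * g j ^ 3) + h * (4 * δ * (χ j * g j ^ 3)))) := by
          have h1 := mul_le_mul_of_nonneg_left (hE.sq_mul_logWeight_le' j) hh.le
          exact mul_le_mul_of_nonneg_left (mul_le_mul_of_nonneg_left (by linarith) hM.le) hd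
      _ = d * (M * (a + 4 * (h * δ)) * (χ j * g j ^ 3)) := by ring
      _ ≤ _ := mul_le_mul_of_nonneg_left
          (mul_le_mul_of_nonneg_right hc.A_ge_lip (by positivity)) hd
  have dev : ∀ {w : ∀ j, W j × Coupling}, (∀ j, w j ∈ tube W χ g z μ a h j) →
      (∀ j, |picardG P g ρ u₀.2 w j - g j| ≤ A * (1 + 8 * L) * logWeight (g j)) ∧
      ∀ j, |picardZ P g ρ u₀.2 w j - z j|
        ≤ 4 * L * (C * (A * (1 + 8 * L)) * (Z + 6) + A) * (χ j * logWeight (g j)) := by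
    intro w hw
    have h1 : ∀ j, |(w j).2.1 - g j| ≤ 1 * (h * logWeight (g j)) := fun j => by
      rw [one_mul]; exact (hw j).2.1
    have h2 : ∀ j, |(w j).2.2.1 - z j| ≤ 1 * (h * (χ j * logWeight (g j))) := fun j => by
      rw [one_mul]; exact (hw j).2.2.1
    exact ⟨fun j => by simpa using hE.picardG_dev hc hp hc.r₀_le hu2 hw h1 j,
      fun j => by simpa using hE.picardZ_dev hc hp hc.r₀_le hu2 hw h1 h2 j⟩
  have hρA : ∀ {w : ∀ j, W j × Coupling}, (∀ j, w j ∈ tube W χ g z μ a h j) → ∀ j,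
      ‖ρ j (w j)‖ ≤ A * (χ j * g j ^ 3) := fun hw j => by
    simpa using hE.rho_radius_le hc hp hc.r₀_le (hw j)
  have hG : ∀ j, |picardG P g ρ u₀.2 x j - picardG P g ρ u₀.2 y j|
      ≤ d * (A * (1 + 8 * L) * logWeight (g j)) :=
    hE.gNext_sub_le hc.δ_le hc.B_nonneg hc.h_pos.le hc.A_nonneg hd hc.g_cond
      (fun j => (hx j).2.1) (fun j => (hy j).2.1) (fun j => (hxy' j).2.1)
      (fun j => (abs_le_norm_fst (ρ j (x j) - ρ j (y j))).trans (hρ j))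
      (by rw [sub_self, abs_zero]; exact mul_nonneg hd (mul_nonneg hc.A_nonneg (sq_nonneg _)))
  have hZ : ∀ j, |picardZ P g ρ u₀.2 x j - picardZ P g ρ u₀.2 y j|
      ≤ d * (4 * L * (C * (A * (1 + 8 * L)) * (Z + 6) + A) * (χ j * logWeight (g j))) :=
    hE.zNext_sub_le hc.C_nonneg hc.Z_nonneg hc.h_pos.le hc.h_δ hc.A_nonneg hc.A_nonneg hA₁0
      (hc.A₁_le.trans hqh) hd (dev hx).1 (dev hy).1 hG (fun j => (hx j).2.2.1)
      (fun j => (hy j).2.2.1) (fun j => (hxy' j).2.2.1)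
      (fun j => (abs_le_norm_snd_fst _).trans (hρA hx j))
      (fun j => (abs_le_norm_snd_fst _).trans (hρA hy j))
      (fun j => (abs_le_norm_snd_fst (ρ j (x j) - ρ j (y j))).trans (hρ j))
  have hMu : |picardMu P g ρ u₀.2 x j - picardMu P g ρ u₀.2 y j|
      ≤ d * (q * h * (χ j * logWeight (g j))) :=
    hE.muNext_sub_le hc.δ_le hc.C_nonneg hc.Z_nonneg hc.one_lt_lam hc.h_pos.le hc.h_δ hc.A_nonneg
      hA₁0 (hc.A₁_le.trans hqh) hA₂0 (hc.A₂_le.trans hqh) hd hc.mu_cond (dev hx).1 (dev hy).1 hG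
      (dev hx).2 (dev hy).2 hZ (fun j => (hx j).2.2.2) (fun j => (hy j).2.2.2)
      (fun j => (hxy' j).2.2.2)
      (fun j => (abs_le_norm_snd_snd (ρ j (x j) - ρ j (y j))).trans (hρ j)) j
  refine (hiff j _ _ _).2 ⟨?_, ?_, ?_, ?_⟩
  · cases j with
    | zero =>
      have := hE.coupling.pos 0; have := hE.weight.pos 0; have := hc.a_pos; have := hc.q_nonneg
      simp only [picard, picardK, sub_self, norm_zero]
      positivity
    | succ j =>
      have hg := hE.coupling.pos j
      have hg' := hE.coupling.pos (j + 1)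
      have hχ := hE.weight.pos j
      have hχ' := hE.weight.pos (j + 1)
      have hM := hc.M_pos
      have hh := hc.h_pos
      have hκ := hc.κ_pos
      have ha := hc.a_pos
      refine (hp.psi_lip j _ (hx j) _ (hy j)).trans ?_
      -- The weight `χ g³` drops by a factor of at most `Ω(1 + 7δ)` per step, which `κ` outweighs;
      -- the dependence on the couplings is smaller by `h δ`.
      calc _ ≤ κ * (d * (a * (χ j * g j ^ 3)))
            + M * (χ (j + 1) * g (j + 1) ^ 2) * (d * h * logWeight (g j)) := by
            gcongr
            · exact (hxy' j).1
            · exact hV j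
        _ = d * (κ * a * (χ j * g j ^ 3)
            + M * h * (χ (j + 1) * g (j + 1) ^ 2 * logWeight (g j))) := by ring
        _ ≤ d * (κ * a * (Ω * (1 + 7 * δ) * (χ (j + 1) * g (j + 1) ^ 3))
            + M * h * (2 * δ * (χ (j + 1) * g (j + 1) ^ 3))) := by
            refine mul_le_mul_of_nonneg_left (add_le_add ?_ ?_) hd
            · exact mul_le_mul_of_nonneg_left (hE.cube_le hc.δ_le hc.Ω_pos j) (by positivity)
            · exact mul_le_mul_of_nonneg_left (hE.sq_mul_logWeight_le hc.δ_le j) (by positivity)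
        _ = d * ((κ * Ω * (1 + 7 * δ) * a + 2 * M * h * δ) * (χ (j + 1) * g (j + 1) ^ 3)) := by
            ring
        _ ≤ d * (q * a * (χ (j + 1) * g (j + 1) ^ 3)) := mul_le_mul_of_nonneg_left
            (mul_le_mul_of_nonneg_right hc.K_cond (by positivity)) hd
        _ = _ := by ring
  · refine (hG j).trans (le_trans (mul_le_mul_of_nonneg_left
      (mul_le_mul_of_nonneg_right hc.A₁_le (hω j).le) hd) (le_of_eq (by ring)))
  · refine (hZ j).trans (le_trans (mul_le_mul_of_nonneg_left
      (mul_le_mul_of_nonneg_right hc.A₂_le (hχω j)) hd) (le_of_eq (by ring)))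
  · exact hMu.trans (le_of_eq (by ring))

end FlowEnv

end Picard


/-! ### Fixed points of the Picard map and flows -/

namespace FlowEnv

variable {W : ℕ → Type*} [∀ j, NormedAddCommGroup (W j)]
  {Ω B C S lam₀ L Z δ : ℝ} {P : Coeffs} {χ g z μ : ℕ → ℝ}
  {a h κ R M A q r₀ a₁ : ℝ} {ψ : ∀ j, W j × Coupling → W (j + 1)}
  {ρ : ∀ j, W j × Coupling → Coupling}

theorem tendsto_zero_of_dev (hE : FlowEnv Ω B C S lam₀ L Z δ P χ g z μ) {k : ℝ} (hk : 0 ≤ k)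
    {w y : ℕ → ℝ} (hy : ∀ j, |y j| ≤ Z * (χ j * g j))
    (hw : ∀ j, |w j - y j| ≤ k * (χ j * logWeight (g j))) : Tendsto w atTop (𝓝 0) := by
  have h1 : ∀ j, ‖w j‖ ≤ (Z + k * δ) * (χ j * g j) := by
    intro j
    have h2 : |w j| ≤ |w j - y j| + |y j| := by simpa using abs_add_le (w j - y j) (y j)
    have h3 : k * (χ j * logWeight (g j)) ≤ k * (χ j * (δ * g j)) := by
      have := (hE.weight.pos j).le
      gcongr
      exact hE.logWeight_le j
    rw [Real.norm_eq_abs]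
    linarith [hy j, hw j]
  refine squeeze_zero_norm h1 ?_
  simpa using hE.coupling.tendsto_mul.const_mul (Z + k * δ)

theorem one_sub_zeta_ne (hE : FlowEnv Ω B C S lam₀ L Z δ P χ g z μ) (j : ℕ) :
    1 - P.zeta j * g j ≠ 0 := by
  have := hE.half_le_prod j 1
  simp at this
  linarith

theorem picardZ_summable (hE : FlowEnv Ω B C S lam₀ L Z δ P χ g z μ)
    (hc : PicardConst Ω B C lam₀ L Z δ a h κ R M A q r₀ a₁)
    (hp : PertBounds κ R M χ g (tube W χ g z μ a h) ψ ρ) {u : ℝ}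
    (hu : |u - g 0| ≤ g 0 ^ 2) {x : ∀ j, W j × Coupling}
    (hx : ∀ j, x j ∈ tube W χ g z μ a h j) (j : ℕ) :
    |zSource P g (fun j => (ρ j (x j)).2.1) (picardG P g ρ u x) (fun j => (x j).2.2.1) j|
      ≤ (C * (5 + Z) + A) * (χ j * g j ^ 2) ∧
    Summable (backTerm (fun j => 1 - P.zeta j * g j)
      (zSource P g (fun j => (ρ j (x j)).2.1) (picardG P g ρ u x) (fun j => (x j).2.2.1)) j) := by
  obtain ⟨-, -, hqh⟩ := const_nonneg hc
  have h1 : ∀ j, |(x j).2.1 - g j| ≤ 1 * (h * logWeight (g j)) := fun j => by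
    rw [one_mul]; exact (hx j).2.1
  have h2 : ∀ j, |picardG P g ρ u x j - g j| ≤ h * logWeight (g j) := fun j => by
    have := hE.picardG_dev hc hp hc.r₀_le hu hx h1 j
    rw [one_mul] at this
    exact this.trans (mul_le_mul_of_nonneg_right (hc.A₁_le.trans hqh) (hE.logWeight_pos j).le)
  have h3 : ∀ j, |(ρ j (x j)).2.1| ≤ A * (χ j * g j ^ 3) := fun j =>
    (abs_le_norm_snd_fst _).trans (by simpa using hE.rho_radius_le hc hp hc.r₀_le (hx j))
  exact ⟨hE.abs_zSource_le hc.C_nonneg hc.Z_nonneg hc.h_pos.le hc.h_δ hc.A_nonneg h2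
    (fun j => (hx j).2.2.1) h3 j, hE.zNext_summable hc.C_nonneg hc.Z_nonneg hc.h_pos.le hc.h_δ
    hc.A_nonneg h2 (fun j => (hx j).2.2.1) h3 j⟩

/-- At a fixed point old and new arguments agree, so the completed square cancels and the exact
recursion remains. The final conditions follow from membership in the tube, since `χ g → 0`. -/
theorem isGlobalFlow_of_fixed (hE : FlowEnv Ω B C S lam₀ L Z δ P χ g z μ)
    (hc : PicardConst Ω B C lam₀ L Z δ a h κ R M A q r₀ a₁)
    (hp : PertBounds κ R M χ g (tube W χ g z μ a h) ψ ρ) {u₀ : W 0 × ℝ}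
    (hu : |u₀.2 - g 0| ≤ g 0 ^ 2) {x : ∀ j, W j × Coupling}
    (hx : ∀ j, x j ∈ tube W χ g z μ a h j) (hfix : picard P g ψ ρ u₀ x = x) :
    IsGlobalFlow P ψ ρ u₀ x := by
  have fK : ∀ j, (x j).1 = picardK ψ u₀.1 x j := fun j => (congrArg Prod.fst (congrFun hfix j)).symm
  have fG : ∀ j, (x j).2.1 = picardG P g ρ u₀.2 x j := fun j =>
    (congrArg (fun p => p.2.1) (congrFun hfix j)).symm
  have fZ : ∀ j, (x j).2.2.1 = picardZ P g ρ u₀.2 x j := fun j =>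
    (congrArg (fun p => p.2.2.1) (congrFun hfix j)).symm
  have fM : ∀ j, (x j).2.2.2 = picardMu P g ρ u₀.2 x j := fun j =>
    (congrArg (fun p => p.2.2.2) (congrFun hfix j)).symm
  refine ⟨fK 0, fG 0, fun j => ?_, ?_, ?_⟩
  · refine Prod.ext (fK (j + 1)) (Prod.ext ?_ (Prod.ext ?_ ?_))
    · rw [fG (j + 1)]
      unfold picardG
      rw [gNext, ← picardG, ← fG j, hE.g_step j]
      simp only [evolution, quadMap, Prod.fst_add]
      ring
    · have h1 := backSum_succ (hE.one_sub_zeta_ne j) (hE.picardZ_summable hc hp hu hx j).2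
      rw [fZ (j + 1)]
      refine h1.trans ?_
      have h2 : backSum (fun j => 1 - P.zeta j * g j) (zSource P g (fun j => (ρ j (x j)).2.1)
        (picardG P g ρ u₀.2 x) (fun j => (x j).2.2.1)) j = (x j).2.2.1 := (fZ j).symm
      rw [h2, zSource, ← fG j]
      simp only [evolution, quadMap, Prod.fst_add, Prod.snd_add]
      ring
    · have h1 : P.lam j ≠ 0 := by have := hE.coeff.le_lam j; have := hc.one_lt_lam; linarith
      have h2 := fM j
      unfold picardMu at h2
      rw [muNext, ← fG j, ← fZ j, inv_mul_eq_div, eq_div_iff h1] at h2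
      simp only [evolution, quadMap, Prod.snd_add]
      linarith
  · exact hE.tendsto_zero_of_dev hc.h_pos.le hE.z_le fun j => (hx j).2.2.1
  · exact hE.tendsto_zero_of_dev hc.h_pos.le hE.mu_le fun j => (hx j).2.2.2

/-- Given the flow, its `z`-component and the series from infinity obey the same recursion and both
tend to zero, so they coincide; the other components are matched scale by scale. -/
theorem fixed_of_isGlobalFlow (hE : FlowEnv Ω B C S lam₀ L Z δ P χ g z μ)
    (hc : PicardConst Ω B C lam₀ L Z δ a h κ R M A q r₀ a₁)
    (hp : PertBounds κ R M χ g (tube W χ g z μ a h) ψ ρ) {u₀ : W 0 × ℝ}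
    (hu : |u₀.2 - g 0| ≤ g 0 ^ 2) {x : ∀ j, W j × Coupling}
    (hx : ∀ j, x j ∈ tube W χ g z μ a h j) (hflow : IsGlobalFlow P ψ ρ u₀ x) :
    picard P g ψ ρ u₀ x = x := by
  have fK : ∀ j, picardK ψ u₀.1 x j = (x j).1 := by
    intro j
    cases j with
    | zero => exact hflow.init_K.symm
    | succ j => rw [hflow.step j]; rfl
  have fG : ∀ j, picardG P g ρ u₀.2 x j = (x j).2.1 := by
    intro j
    induction j with
    | zero => exact hflow.init_g.symm
    | succ j ih =>
      unfold picardG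
      rw [gNext, ← picardG, ih, hE.g_step j, hflow.step j]
      simp only [evolution, quadMap, Prod.fst_add]
      ring
  have fG' : picardG P g ρ u₀.2 x = fun j => (x j).2.1 := funext fG
  have fZ : ∀ j, picardZ P g ρ u₀.2 x j - (x j).2.2.1 = 0 := by
    refine eq_zero_of_recursion (a := fun j => 1 - P.zeta j * g j)
      (d := fun j => picardZ P g ρ u₀.2 x j - (x j).2.2.1) (m := 1 / 2) (by norm_num)
      (fun j l => (hE.half_le_prod j l).trans (le_abs_self _)) (fun j => ?_) ?_
    · have h1 : picardZ P g ρ u₀.2 x (j + 1) = (1 - P.zeta j * g j) * picardZ P g ρ u₀.2 x j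
          + zSource P g (fun j => (ρ j (x j)).2.1) (picardG P g ρ u₀.2 x)
            (fun j => (x j).2.2.1) j :=
        backSum_succ (hE.one_sub_zeta_ne j) (hE.picardZ_summable hc hp hu hx j).2
      simp only [h1, zSource, fG, hflow.step j, evolution, quadMap, Prod.fst_add, Prod.snd_add]
      ring
    · have h1 : ∀ j, |(x j).2.1 - g j| ≤ 1 * (h * logWeight (g j)) := fun j => by
        rw [one_mul]; exact (hx j).2.1
      have h2 : ∀ j, |(x j).2.2.1 - z j| ≤ 1 * (h * (χ j * logWeight (g j))) := fun j => by
        rw [one_mul]; exact (hx j).2.2.1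
      have h3 := hE.tendsto_zero_of_dev (const_nonneg hc).2.1 hE.z_le
        fun j => (by simpa using hE.picardZ_dev hc hp hc.r₀_le hu hx h1 h2 j)
      simpa using h3.sub hflow.z_lim
  have fZ' : picardZ P g ρ u₀.2 x = fun j => (x j).2.2.1 := funext fun j => sub_eq_zero.1 (fZ j)
  have fM : ∀ j, picardMu P g ρ u₀.2 x j = (x j).2.2.2 := by
    intro j
    have h1 : P.lam j ≠ 0 := by have := hE.coeff.le_lam j; have := hc.one_lt_lam; linarith
    unfold picardMu
    rw [muNext, fG', fZ', inv_mul_eq_div, div_eq_iff h1, hflow.step j]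
    simp only [evolution, quadMap, Prod.snd_add]
    ring
  funext j
  exact Prod.ext (fK j) (Prod.ext (fG j) (Prod.ext (congrFun fZ' j) (fM j)))

/-- The factor `a + 1` does not involve the reference flow, so weighted convergence becomes
convergence in norm uniformly in all parameters. -/
theorem dist_le_wdist (hE : FlowEnv Ω B C S lam₀ L Z δ P χ g z μ) (ha : 0 < a) (hh : 0 < h)
    (hhδ : h * δ ≤ 1) (j : ℕ) (p p' : W j × Coupling) :
    dist p p' ≤ (a + 1) * wdist χ g a h j p p' := by
  obtain ⟨h1, h2, h3, h4⟩ := (hE.wdist_le_iff ha hh (p := p) (p' := p')).1 le_rfl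
  have hg := hE.coupling.pos j
  have hg1 := hE.coupling.le_one j
  have hχ := hE.weight.pos j
  have hχ1 := hE.weight.le_one j
  have hd : 0 ≤ wdist χ g a h j p p' := le_max_of_le_left (by positivity)
  set d := wdist χ g a h j p p'
  have w1 : a * (χ j * g j ^ 3) ≤ a + 1 := by
    have : χ j * g j ^ 3 ≤ 1 := mul_le_one₀ hχ1 (by positivity) (pow_le_one₀ hg.le hg1)
    nlinarith
  have w2 : h * logWeight (g j) ≤ a + 1 := (hE.mul_logWeight_le hh.le hhδ j).trans (by linarith)
  have w3 : h * (χ j * logWeight (g j)) ≤ a + 1 :=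
    (hE.mul_chi_logWeight_le hh.le hhδ j).trans (by linarith)
  rw [mul_comm, dist_eq_norm, Prod.norm_def, Prod.norm_def, Prod.norm_def]
  exact max_le (h1.trans (by gcongr)) (max_le (h2.trans (by gcongr))
    (max_le (h3.trans (by gcongr)) (h4.trans (by gcongr))))

theorem isClosed_tube (j : ℕ) : IsClosed (tube W χ g z μ a h j) := by
  unfold tube
  refine IsClosed.and ?_ (IsClosed.and ?_ (IsClosed.and ?_ ?_))
  all_goals
    refine isClosed_le ?_ continuous_const
    fun_prop

theorem center_mem_tube (hE : FlowEnv Ω B C S lam₀ L Z δ P χ g z μ) (ha : 0 ≤ a) (hh : 0 ≤ h)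
    (j : ℕ) : ((0, g j, z j, μ j) : W j × Coupling) ∈ tube W χ g z μ a h j := by
  have := hE.coupling.pos j
  have := hE.weight.pos j
  refine ⟨?_, (hE.self_dev hh g j).1, (hE.self_dev hh z j).2, (hE.self_dev hh μ j).2⟩
  simp only [norm_zero]; positivity

/-- Existence and uniqueness of the flow, and convergence of the Picard iteration to it. -/
theorem exists_flow [∀ j, CompleteSpace (W j)] (hE : FlowEnv Ω B C S lam₀ L Z δ P χ g z μ)
    (hc : PicardConst Ω B C lam₀ L Z δ a h κ R M A q r₀ a₁)
    (hp : PertBounds κ R M χ g (tube W χ g z μ a h) ψ ρ) {u₀ : W 0 × ℝ}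
    (hu1 : ‖u₀.1‖ ≤ a₁ * g 0 ^ 3) (hu2 : |u₀.2 - g 0| ≤ g 0 ^ 2) :
    ∃ x : ∀ j, W j × Coupling, (∀ j, x j ∈ tube W χ g z μ a₁ (r₀ * h) j) ∧
      IsGlobalFlow P ψ ρ u₀ x ∧
      (∀ y : ∀ j, W j × Coupling, (∀ j, y j ∈ tube W χ g z μ a h j) →
        IsGlobalFlow P ψ ρ u₀ y → y = x) ∧
      ∀ k j, dist ((picard P g ψ ρ u₀)^[k] (fun j => (0, g j, z j, μ j)) j) (x j)
        ≤ (a + 1) * (q ^ k * 2) := by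
  have hr : r₀ * h ≤ h := by have := hc.h_pos; have := hc.r₀_le; nlinarith
  have hsub : ∀ {x : ∀ j, W j × Coupling}, (∀ j, x j ∈ tube W χ g z μ a₁ (r₀ * h) j) →
    ∀ j, x j ∈ tube W χ g z μ a h j := fun hx j => hE.tube_mono hc.a₁_le hr j (hx j)
  obtain ⟨x, hxS, hfix, huniq, hconv⟩ := exists_fixedPoint (X := fun j => W j × Coupling)
    (picard P g ψ ρ u₀) {x | ∀ j, x j ∈ tube W χ g z μ a h j}
    {x | ∀ j, x j ∈ tube W χ g z μ a₁ (r₀ * h) j} (wdist χ g a h) (D := 2) (c := a + 1)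
    hc.q_nonneg hc.q_lt_one (by norm_num) (by have := hc.a_pos; linarith)
    (fun j x => by unfold wdist; fun_prop)
    (hE.dist_le_wdist hc.a_pos hc.h_pos hc.h_δ) (fun x hx => hsub hx)
    (by
      rw [Set.ofPred_forall]
      exact isClosed_iInter fun j => (isClosed_tube j).preimage (continuous_apply j))
    (fun x hx => hE.picard_mem_tube hc hp le_rfl hc.a₁_le le_rfl hc.r₀_le hc.K_self hu1 hu2 hx)
    (fun x hx y hy d hd hxy => hE.picard_contraction hc hp hu2 hx hy hd hxy)
    -- Two points of a tube are within twice its radii of each other, whence the diameter 2.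
    (fun x hx y hy j => (hE.wdist_le_iff hc.a_pos hc.h_pos).2 (by
      obtain ⟨h1, h2, h3, h4⟩ := hx j
      obtain ⟨k1, k2, k3, k4⟩ := hy j
      have tri : ∀ p p' w k : ℝ, |p - w| ≤ k → |p' - w| ≤ k → |p - p'| ≤ 2 * k := by
        intro p p' w k e e'
        rw [abs_le] at *
        constructor <;> linarith
      refine ⟨(norm_sub_le _ _).trans ?_, tri _ _ _ _ h2 k2, tri _ _ _ _ h3 k3, tri _ _ _ _ h4 k4⟩
      linarith))
    (x₀ := fun j => (0, g j, z j, μ j))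
    (fun j => hE.center_mem_tube hc.a₁_pos.le
      (mul_nonneg hc.r₀_pos.le hc.h_pos.le) j)
  exact ⟨x, hxS, hE.isGlobalFlow_of_fixed hc hp hu2 (hsub hxS) hfix,
    fun y hy hflow => huniq y hy (hE.fixed_of_isGlobalFlow hc hp hu2 hy hflow), hconv⟩

end FlowEnv


/-! ### Continuity in the external parameter -/

/-- The terms are dominated, uniformly in the parameter, by a summable sequence; the factor 2 is the
inverse of the lower bound on the products. -/
theorem continuous_backSum_of_decay {X : Type*} [TopologicalSpace X]
    {a f : X → ℕ → ℝ} (ha : ∀ j, Continuous (fun x => a x j))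
    (hf : ∀ j, Continuous (fun x => f x j))
    (hprod : ∀ x, ∀ j l, 1 / 2 ≤ ∏ k ∈ Finset.range l, a x (j + k)) {A : ℝ}
    (hA : ∀ x, ∀ l : ℕ, |f x l| ≤ A * (1 / ((l : ℝ) + 1) ^ 2)) (j : ℕ) :
    Continuous (fun x => backSum (a x) (f x) j) := by
  refine continuousOn_univ.1 <| continuousOn_backSum (fun j => (ha j).continuousOn)
    (fun j => (hf j).continuousOn) (fun x _ j => ?_)
    (((summable_nat_add_iff j).2 summable_one_div_succ_sq).mul_left (2 * A)) fun x _ l => ?_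
  · have := hprod x j 1
    simp at this
    linarith
  · refine (abs_backTerm_le_of_prod (m := 1 / 2) (by norm_num)
      (fun j l => (hprod x j l).trans (le_abs_self _)) j l).trans ?_
    have := hA x (l + j)
    rw [add_comm j l]
    norm_num at this ⊢
    linarith

theorem continuous_muBar {X : Type*} [TopologicalSpace X]
    {P : X → Coeffs} {g z : X → ℕ → ℝ}
    (ha : ∀ j, Continuous (fun x => muCoeff (P x) (g x) (z x) j))
    (hf : ∀ j, Continuous (fun x => muSource (P x) (g x) (z x) j)) {q F : ℝ} (hq : 1 < q)
    (hlow : ∀ x, ∀ j, q ≤ muCoeff (P x) (g x) (z x) j)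
    (hF : ∀ x, ∀ j, |muSource (P x) (g x) (z x) j| ≤ F) (j : ℕ) :
    Continuous (fun x => muBar (P x) (g x) (z x) j) := by
  have hq0 : 0 < q := by linarith
  refine continuousOn_univ.1 <| continuousOn_backSum (fun j => (ha j).continuousOn)
    (fun j => (hf j).continuousOn) (fun x _ j => by have := hlow x j; linarith)
    (u := fun l => q⁻¹ ^ (l + 1) * F) ?_ fun x _ l => ?_
  · exact ((summable_nat_add_iff 1).2 (summable_geometric_of_lt_one (by positivity)
      (inv_lt_one_of_one_lt₀ hq))).mul_right F
  · refine (abs_backTerm_le_of_pow hq0 (fun j => (hlow x j).trans (le_abs_self _)) j l).trans ?_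
    gcongr
    exact hF x _

section

variable {W : ℕ → Type*} [∀ j, NormedAddCommGroup (W j)] {X : Type*} [TopologicalSpace X]

theorem ContinuousCoeffs.comp {E : Type*} [TopologicalSpace E] {P : E → Coeffs}
    (hP : ContinuousCoeffs P) {m : X → E} (hm : Continuous m) :
    ContinuousCoeffs fun x => P (m x) :=
  ⟨fun j => (hP.eta j).comp hm, fun j => (hP.gamma j).comp hm, fun j => (hP.lam j).comp hm,
    fun j => (hP.beta j).comp hm, fun j => (hP.theta j).comp hm, fun j => (hP.zeta j).comp hm,
    fun j => (hP.ups_gg j).comp hm, fun j => (hP.ups_gz j).comp hm, fun j => (hP.ups_gmu j).comp hm,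
    fun j => (hP.ups_zz j).comp hm, fun j => (hP.ups_zmu j).comp hm⟩

theorem continuous_quadMap {P : X → Coeffs} (hP : ContinuousCoeffs P)
    {V : X → Coupling} (hV : Continuous V) (j : ℕ) :
    Continuous (fun x => quadMap (P x) j (V x)) := by
  have h1 := (hP.eta j)
  have h2 := (hP.gamma j)
  have h3 := (hP.lam j)
  have h4 := (hP.beta j)
  have h5 := (hP.theta j)
  have h6 := (hP.zeta j)
  have h7 := (hP.ups_gg j)
  have h8 := (hP.ups_gz j)
  have h9 := (hP.ups_gmu j)
  have h10 := (hP.ups_zz j)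
  have h11 := (hP.ups_zmu j)
  unfold quadMap
  fun_prop

/-- No continuity of `χ` is asked for: the cut-off time may jump with the parameter, but it enters
only through the bounds. -/
theorem continuous_picard {P : X → Coeffs} (hP : ContinuousCoeffs P)
    {g χ : X → ℕ → ℝ} (hg : ∀ j, Continuous (fun p => g p j))
    {ψ : X → ∀ j, W j × Coupling → W (j + 1)} {ρ : X → ∀ j, W j × Coupling → Coupling}
    {u : X → W 0 × ℝ} (hu : Continuous u) {x : X → ∀ j, W j × Coupling}
    (hx : ∀ j, Continuous (fun p => x p j))
    (hψ : ∀ j, Continuous (fun p => ψ p j (x p j)))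
    (hρ : ∀ j, Continuous (fun p => ρ p j (x p j)))
    (hlam : ∀ p, ∀ j, (P p).lam j ≠ 0)
    (hprod : ∀ p, ∀ j l, 1 / 2 ≤ ∏ k ∈ Finset.range l, (1 - (P p).zeta (j + k) * g p (j + k)))
    {Q A : ℝ} (hQ : 0 ≤ Q)
    (hsrc : ∀ p, ∀ j, |zSource (P p) (g p) (fun j => (ρ p j (x p j)).2.1)
      (picardG (P p) (g p) (ρ p) (u p).2 (x p)) (fun j => (x p j).2.2.1) j|
        ≤ Q * (χ p j * g p j ^ 2))
    (hdecay : ∀ p, ∀ l : ℕ, χ p l * g p l ^ 2 ≤ A * (1 / ((l : ℝ) + 1) ^ 2)) (j : ℕ) :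
    Continuous (fun p => picard (P p) (g p) (ψ p) (ρ p) (u p) (x p) j) := by
  have hK : Continuous (fun p => picardK (ψ p) (u p).1 (x p) j) := by
    cases j with
    | zero => exact hu.fst
    | succ j => exact hψ j
  have hG : ∀ j, Continuous (fun p => picardG (P p) (g p) (ρ p) (u p).2 (x p) j) := by
    intro j
    induction j with
    | zero => exact hu.snd
    | succ j ih =>
      have key : ∀ b c c' G r y : X → ℝ, Continuous b → Continuous c → Continuous c' →
          Continuous G → Continuous r → Continuous y → Continuous fun p =>
            c' p + (1 - b p * c p) ^ 2 * (G p - c p)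
              + (r p - (b p * c p) ^ 2 * (y p - c p) - b p * (y p - c p) ^ 2) := by
        intros; fun_prop
      exact key _ _ _ _ _ _ (hP.beta j) (hg j) (hg (j + 1)) ih (hρ j).fst (hx j).snd.fst
  have hZ : ∀ j, Continuous (fun p => picardZ (P p) (g p) (ρ p) (u p).2 (x p) j) := by
    refine continuous_backSum_of_decay (A := Q * A)
      (fun j => continuous_const.sub ((hP.zeta j).mul (hg j))) (fun j => ?_) hprod fun p l => ?_
    · have key : ∀ t b c G r y : X → ℝ, Continuous t → Continuous b → Continuous c →
          Continuous G → Continuous r → Continuous y → Continuous fun p =>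
            -(t p * G p ^ 2) - b p * (G p - c p) * y p + r p := by
        intros; fun_prop
      exact key _ _ _ _ _ _ (hP.theta j) (hP.zeta j) (hg j) (hG j) (hρ j).snd.fst
        (hx j).snd.snd.fst
    · refine (hsrc p l).trans ?_
      rw [mul_assoc]
      exact mul_le_mul_of_nonneg_left (hdecay p l) hQ
  have hM : Continuous (fun p => picardMu (P p) (g p) (ρ p) (u p).2 (x p) j) := by
    have key : ∀ l e c u₁ u₂ u₃ u₄ u₅ G Y y y' r : X → ℝ, Continuous l → Continuous e →
        Continuous c → Continuous u₁ → Continuous u₂ → Continuous u₃ → Continuous u₄ →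
        Continuous u₅ → Continuous G → Continuous Y → Continuous y → Continuous y' →
        Continuous r → Continuous fun p => l p * (y' p - (e p * G p + c p * Y p)
          + (u₁ p * G p ^ 2 + u₂ p * G p * Y p + u₃ p * G p * y p + u₄ p * Y p ^ 2
            + u₅ p * Y p * y p) - r p) := by
      intros; fun_prop
    exact key _ _ _ _ _ _ _ _ _ _ _ _ _ ((hP.lam j).inv₀ fun p => hlam p j) (hP.eta j)
      (hP.gamma j) (hP.ups_gg j) (hP.ups_gz j) (hP.ups_gmu j) (hP.ups_zz j) (hP.ups_zmu j)
      (hG j) (hZ j) (hx j).snd.snd.snd (hx (j + 1)).snd.snd.snd (hρ j).snd.snd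
  exact hK.prodMk ((hG j).prodMk ((hZ j).prodMk hM))

end


/-! ### Consequences of the assumptions -/

/-- With `s = t^{1/4}` one has `|log t| s < 4`, hence `t |log t|² = (s |log t|)² s² ≤ 16 s²`. -/
theorem exists_small_log {δ : ℝ} (hδ : 0 < δ) : ∃ t₁ : ℝ, 0 < t₁ ∧ ∀ t, 0 < t → t ≤ t₁ →
    t ≤ 1 ∧ Real.log t ≤ -1 ∧ t * |Real.log t| ^ 2 ≤ δ := by
  refine ⟨min (Real.exp (-1)) ((δ / 16) ^ 2), by positivity, fun t ht htt => ?_⟩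
  have h1 : t ≤ Real.exp (-1) := htt.trans (min_le_left _ _)
  have h2 : t ≤ (δ / 16) ^ 2 := htt.trans (min_le_right _ _)
  have hlog : Real.log t ≤ -1 := by
    have := Real.log_le_log ht h1
    rwa [Real.log_exp] at this
  have ht1 : t ≤ 1 := h1.trans (Real.exp_le_one_iff.2 (by norm_num))
  refine ⟨ht1, hlog, ?_⟩
  have h3 := (Real.abs_log_mul_self_rpow_lt t (1 / 4) ht ht1 (by norm_num)).le
  have h4 : (t ^ (1 / 4 : ℝ)) ^ 4 = t := by
    rw [← Real.rpow_natCast, ← Real.rpow_mul ht.le]; norm_num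
  set s := t ^ (1 / 4 : ℝ) with hs
  have hs0 : 0 < s := Real.rpow_pos_of_pos ht _
  have h5 : s ^ 2 ≤ δ / 16 := by
    rw [← h4] at h2
    have : (s ^ 2) ^ 2 ≤ (δ / 16) ^ 2 := by rw [← pow_mul]; exact h2
    exact (pow_le_pow_iff_left₀ (by positivity) (by positivity) (by norm_num)).1 this
  rw [abs_mul, abs_of_pos hs0] at h3
  have h6 : (|Real.log t| * s) ^ 2 ≤ 16 := by
    have := pow_le_pow_left₀ (by positivity) h3 2
    norm_num at this ⊢
    exact this
  calc t * |Real.log t| ^ 2 = (|Real.log t| * s) ^ 2 * s ^ 2 := by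
        nth_rw 1 [← h4]; ring
    _ ≤ 16 * (δ / 16) := by gcongr
    _ = δ := by ring

theorem sum_shift_le {e : ℕ → ℝ} {S : ℝ} (h : ∀ F : Finset ℕ, ∑ j ∈ F, e j ≤ S) (j n : ℕ) :
    ∑ k ∈ Finset.range n, e (j + k) ≤ S := by
  have := h ((Finset.range n).map (addLeftEmbedding j))
  simpa using this

theorem betaBounds_of_assumption {Ω B c : ℝ} {P : Coeffs} (hΩ : 1 < Ω) (hc : 0 < c)
    (h : AssumptionA1 Ω B c P) :
    BetaBounds Ω |B| c ((c + |B|) * (c⁻¹ + (Ω - 1)⁻¹)) (chi Ω P.beta) P.beta := by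
  have hB : ∀ j, |P.beta j| ≤ |B| := fun j => (h.beta_bdd j).trans (le_abs_self B)
  have hw := cutoffWeight_chi hΩ P.beta
  refine ⟨hw, abs_beta_le_chi hΩ hB, ?_⟩
  obtain ⟨e, he0, hes, he⟩ := exists_error_weight hΩ P.beta (fun j => P.beta j < c)
    h.exceptional_finite h.exceptional_card
  have hcB : 0 ≤ c + |B| := by positivity
  -- Where `e = χ`, the bound `β ≥ -|B| χ` makes `(c + |B|) χ` a sufficient correction; where `e =
  -- 0`, the weight is 1 and `β ≥ c`.
  refine ⟨fun j => (c + |B|) * e j, fun j => mul_nonneg hcB (he0 j), fun j n => ?_, fun j => ?_⟩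
  · rw [← Finset.mul_sum]
    exact mul_le_mul_of_nonneg_left (sum_shift_le hes j n) hcB
  · rcases he j with h1 | ⟨h1, h2, h3⟩
    · have := (abs_le.1 (abs_beta_le_chi hΩ hB j)).1
      dsimp only
      rw [h1]; linarith
    · dsimp only
      rw [h1, h2]; linarith [not_lt.1 h3]

theorem coeffBounds_of_assumption {Ω c lam₀ C : ℝ} {P : Coeffs} (hΩ : 1 < Ω)
    (h : AssumptionA2 Ω c lam₀ C P) :
    CoeffBounds |C| (|C| * (c⁻¹ + (Ω - 1)⁻¹)) lam₀ (chi Ω P.beta) P := by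
  have hw := cutoffWeight_chi hΩ P.beta
  have hC : ∀ j, C * chi Ω P.beta j ≤ |C| * chi Ω P.beta j := fun j =>
    mul_le_mul_of_nonneg_right (le_abs_self C) (hw.pos j).le
  refine ⟨h.le_lam, ?_, fun j => (h.eta_le j).trans (hC j), fun j => (h.gamma_le j).trans (hC j),
    fun j => (h.theta_le j).trans (hC j), fun j => (h.zeta_le j).trans (hC j),
    fun j => (h.ups_gg_le j).trans (hC j), fun j => (h.ups_gz_le j).trans (hC j),
    fun j => (h.ups_gmu_le j).trans (hC j), fun j => (h.ups_zz_le j).trans (hC j),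
    fun j => (h.ups_zmu_le j).trans (hC j)⟩
  obtain ⟨e, he0, hes, he⟩ := exists_error_weight hΩ P.beta (fun j => 0 < P.zeta j)
    h.exceptional_finite h.exceptional_card
  refine ⟨fun j => |C| * e j, fun j => mul_nonneg (abs_nonneg C) (he0 j), fun j n => ?_,
    fun j => ?_⟩
  · rw [← Finset.mul_sum]
    exact mul_le_mul_of_nonneg_left (sum_shift_le hes j n) (abs_nonneg C)
  · rcases he j with h1 | ⟨h1, h2, h3⟩
    · dsimp only
      rw [h1]
      exact (le_abs_self _).trans ((h.zeta_le j).trans (hC j))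
    · dsimp only
      rw [h2, mul_zero]; exact not_lt.1 h3

theorem coupling_step_bounds {t b δ : ℝ} (ht : 0 < t) (hδ1 : δ ≤ 1)
    (hb : |b * t| ≤ δ / 2) (hlog : Real.log t ≤ -1) (ht' : t - b * t ^ 2 ≤ 1) :
    t - b * t ^ 2 ≤ (1 + δ) * t ∧ t ≤ (1 + δ) * (t - b * t ^ 2) ∧
      |Real.log (t - b * t ^ 2)| ≤ (1 + δ) * |Real.log t| := by
  obtain ⟨h1, h2⟩ := abs_le.1 hb
  set y := b * t with hy
  have e : t - b * t ^ 2 = t * (1 - y) := by rw [hy]; ring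
  rw [e] at ht' ⊢
  have hδ0 : 0 ≤ δ := by linarith
  have hy1 : 1 / 2 ≤ 1 - y := by linarith
  have hy0 : 0 < 1 - y := by linarith
  refine ⟨by nlinarith, ?_, ?_⟩
  · have : 1 ≤ (1 + δ) * (1 - y) := by nlinarith
    nlinarith
  · rw [abs_of_nonpos (Real.log_nonpos (by positivity) ht'), abs_of_nonpos (by linarith),
      Real.log_mul ht.ne' hy0.ne']
    have h3 : -Real.log (1 - y) ≤ δ := by
      rw [← Real.log_inv]
      refine (Real.log_le_sub_one_of_pos (by positivity)).trans ?_
      rw [inv_eq_one_div, div_sub_one hy0.ne', div_le_iff₀ hy0]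
      nlinarith
    nlinarith

set_option maxHeartbeats 1000000 in
/-- Under the assumptions on the quadratic map, its flow exists for small initial values, is unique
and satisfies the bounds on which the perturbation theory rests. -/
theorem exists_flowEnv {Ω c lam₀ : ℝ} (B C : ℝ) (hΩ : 1 < Ω) (hc : 0 < c) (hlam : 1 < lam₀) :
    ∃ S L Z A F : ℝ, 0 ≤ L ∧ 0 ≤ Z ∧ ∀ δ, 0 < δ → δ ≤ 1 → ∃ g₁, 0 < g₁ ∧
      ∀ P : Coeffs, AssumptionA1 Ω B c P → AssumptionA2 Ω c lam₀ C P →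
      ∀ (g₀ : ℝ) (g : ℕ → ℝ), 0 < g₀ → g₀ ≤ g₁ → g = gSeq P.beta g₀ →
      FlowEnv Ω |B| |C| S lam₀ L Z δ P (chi Ω P.beta) g (zBar P g) (muBar P g (zBar P g)) ∧
      (∃! V, IsQuadFlow P g₀ V) ∧
      (quadFlow P g₀ = fun j => (g j, zBar P g j, muBar P g (zBar P g) j)) ∧
      (∀ l : ℕ, chi Ω P.beta l * g l ^ 2 ≤ A * (1 / ((l : ℝ) + 1) ^ 2)) ∧
      (∀ j, (1 + lam₀) / 2 ≤ muCoeff P g (zBar P g) j) ∧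
      ∀ j, |muSource P g (zBar P g) j| ≤ F := by
  obtain ⟨A, hA0, hA⟩ := exists_chi_mul_sq_le hΩ
  set Sβ := (c + |B|) * (c⁻¹ + (Ω - 1)⁻¹) with hSβ
  set S := |C| * (c⁻¹ + (Ω - 1)⁻¹) with hS
  set L := 3 * c⁻¹ + (1 - Ω⁻¹)⁻¹ with hL
  have hΩ1 : 0 < Ω - 1 := by linarith
  have hΩ2 : 0 < 1 - Ω⁻¹ := by have := inv_lt_one_of_one_lt₀ hΩ; linarith
  have hL0 : 0 ≤ L := by positivity
  have hS0 : 0 ≤ S := by positivity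
  have hSβ0 : 0 ≤ Sβ := by positivity
  set Z₁ := 2 * |C| * L with hZ₁
  have hZ₁0 : 0 ≤ Z₁ := by positivity
  set Z₂ := 8 * |C| * (1 + Z₁) ^ 2 / (lam₀ - 1) with hZ₂
  have hZ₂0 : 0 ≤ Z₂ := by have : 0 < lam₀ - 1 := by linarith
                           positivity
  -- These constants are fixed before `δ`, since the later choices of `h` and `δ` depend on them.
  refine ⟨S, L, Z₁ + Z₂, A / (min 1 c) ^ 2, 2 * |C| * (1 + Z₁) ^ 2, hL0, by positivity,
    fun δ hδ hδ1 => ?_⟩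
  obtain ⟨t₁, ht₁, hlogt⟩ := exists_small_log hδ
  set ε := min 1 (min (lam₀ - 1) δ) with hε
  have hε0 : 0 < ε := lt_min one_pos (lt_min (by linarith) hδ)
  -- Apart from the logarithmic conditions, all smallness requirements have the form coefficient
  -- times `g₀` at most `ε`; `K` adds up the coefficients.
  set K := 8 + 4 * |B| + 4 * Sβ + 4 * S + 4 * |C| * (1 + Z₁) with hK
  have hK0 : 0 < K := by positivity
  refine ⟨min (t₁ / 2) (ε / K), by positivity, fun P h1 h2 g₀ g hg₀ hg₁ hgd => ?_⟩
  have hgt : 2 * g₀ ≤ t₁ := by have := hg₁.trans (min_le_left _ _); linarith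
  have hKg : K * g₀ ≤ ε := by
    have := hg₁.trans (min_le_right _ _)
    rwa [le_div_iff₀ hK0, mul_comm] at this
  have hε1 : ε ≤ 1 := min_le_left _ _
  have hεl : ε ≤ lam₀ - 1 := (min_le_right _ _).trans (min_le_left _ _)
  have hεδ : ε ≤ δ := (min_le_right _ _).trans (min_le_right _ _)
  have p1 : 0 ≤ |B| * g₀ := by positivity
  have p2 : 0 ≤ Sβ * g₀ := by positivity
  have p3 : 0 ≤ S * g₀ := by positivity
  have p4 : 0 ≤ |C| * (1 + Z₁) * g₀ := by positivity
  have hKexp : K * g₀ = 8 * g₀ + 4 * (|B| * g₀) + 4 * (Sβ * g₀) + 4 * (S * g₀)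
    + 4 * (|C| * (1 + Z₁) * g₀) := by rw [hK]; ring
  have hb := betaBounds_of_assumption hΩ hc h1
  have hP := coeffBounds_of_assumption hΩ h2
  have hBg : 4 * |B| * g₀ ≤ 1 := by linarith
  have hSg : 4 * Sβ * g₀ ≤ 1 := by linarith
  have hg8 : 8 * g₀ ≤ 1 := by linarith
  have hB0 := abs_nonneg B
  have hC0 := abs_nonneg C
  have hbd : ∀ j, 0 < g j ∧ g j ≤ 2 * g₀ := by
    rw [hgd]; exact hb.gSeq_bounds hB0 hc hg₀ hBg hSg
  have hl := fun j => hlogt (g j) (hbd j).1 ((hbd j).2.trans hgt)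
  have hstep : ∀ j, g (j + 1) = g j - P.beta j * g j ^ 2 := by intro j; rw [hgd]; rfl
  have hdec : ∀ l : ℕ, chi Ω P.beta l * g l ^ 2 ≤ A / (min 1 c) ^ 2 * (1 / ((l : ℝ) + 1) ^ 2) := by
    rw [hgd]; exact fun l => hb.chi_gSeq_sq_decay hB0 hc hg₀ hBg hSg hg8 (hA P.beta l)
  have hcp : CouplingBounds L (chi Ω P.beta) g := by
    refine ⟨hb.weight.pos, hb.weight.le_one, hb.weight.antitone, fun j => (hbd j).1,
      fun j => (hl j).1, ?_, ?_, ⟨_, hdec⟩⟩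
    · rw [hgd]; exact hb.gSeq_quasi_antitone hB0 hc hg₀ hBg hSg
    · rw [hgd]; exact hb.sum_chi_gSeq_sq_le hΩ hB0 hc hg₀ hBg hSg hg8
  have hprod : ∀ j l, 1 / 2 ≤ ∏ k ∈ Finset.range l, (1 - P.zeta (j + k) * g (j + k)) :=
    hP.half_le_prod (fun j => (hbd j).1) (fun j => (hbd j).2) (by linarith)
  have hsmall : ∀ j, 2 * |C| * (1 + Z₁) * g j ≤ lam₀ - 1 := by
    intro j
    have h3 : 2 * |C| * (1 + Z₁) * g j ≤ 2 * |C| * (1 + Z₁) * (2 * g₀) := by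
      gcongr; exact (hbd j).2
    linarith
  obtain ⟨hflow, hz, hm⟩ := isQuadFlow_bar hlam hP hgd hcp hC0 hL0 hprod hsmall
  have huniq : ∀ V, IsQuadFlow P g₀ V → V = fun j => (g j, zBar P g j, muBar P g (zBar P g) j) := by
    intro V hV
    refine isQuadFlow_unique (Z := Z₁) hlam hP (by rw [← hgd]; exact hcp) hC0
      (by rw [← hgd]; exact hprod) hZ₁0 ?_ (by rw [← hgd]; exact hsmall) hflow hV
    rw [← hgd]; exact hz
  refine ⟨?_, ⟨_, hflow, huniq⟩, ?_, hdec, le_muCoeff hP hcp hC0 hZ₁0 hz hsmall, fun j => ?_⟩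
  · have hχg : ∀ j, 0 ≤ chi Ω P.beta j * g j := fun j =>
      mul_nonneg (hb.weight.pos j).le (hbd j).1.le
    have habs : ∀ j, |Real.log (g j)| = -Real.log (g j) := fun j =>
      abs_of_nonpos (by linarith [(hl j).2.1])
    have hstepb : ∀ j, g (j + 1) ≤ (1 + δ) * g j ∧ g j ≤ (1 + δ) * g (j + 1) ∧
        |Real.log (g (j + 1))| ≤ (1 + δ) * |Real.log (g j)| := by
      intro j
      have h3 : |P.beta j * g j| ≤ δ / 2 := by
        rw [abs_mul, abs_of_pos (hbd j).1]
        have h4 : |P.beta j| ≤ |B| := (h1.beta_bdd j).trans (le_abs_self B)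
        have h5 : |P.beta j| * g j ≤ |B| * (2 * g₀) :=
          mul_le_mul h4 (hbd j).2 (hbd j).1.le hB0
        linarith
      rw [hstep j]
      exact coupling_step_bounds (hbd j).1 hδ1 h3 (hl j).2.1
        (by rw [← hstep j]; exact (hl (j + 1)).1)
    refine
      { weight := hb.weight
        beta_le := hb.abs_beta_le
        coeff := hP
        coupling := hcp
        g_step := hstep
        z_step := fun j => congrArg (fun v => v.2.1) (hflow.step j)
        mu_step := fun j => congrArg (fun v => v.2.2) (hflow.step j)
        z_eq := rfl
        z_le := fun j => (hz j).trans (mul_le_mul_of_nonneg_right (by linarith) (hχg j))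
        mu_le := fun j => (hm j).trans (mul_le_mul_of_nonneg_right (by linarith) (hχg j))
        half_le_prod := hprod
        sum_le_log := fun j => ?_
        one_le_log := fun j => by rw [habs]; linarith [(hl j).2.1]
        log_sq_le := fun j => (hl j).2.2
        succ_le := fun j => (hstepb j).1
        le_succ := fun j => (hstepb j).2.1
        log_succ_le := fun j => (hstepb j).2.2 }
    have hlog0 := (hlogt g₀ hg₀ (by linarith)).2.1
    have h3 := hb.sum_chi_gSeq_le hB0 hc hg₀ hBg hSg hlog0 j
    rw [← hgd] at h3
    rw [habs]
    refine h3.trans (mul_le_mul_of_nonneg_right ?_ (by linarith [(hl j).2.1]))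
    have h4 : 0 < c⁻¹ := by positivity
    have h5 : 0 < (1 - Ω⁻¹)⁻¹ := by positivity
    rw [hL]; linarith
  · exact huniq _ (Classical.epsilon_spec ⟨_, hflow⟩)
  · refine (abs_muSource_le hP hcp hC0 hZ₁0 hz j).trans (mul_le_of_le_one_right (by positivity) ?_)
    exact mul_le_one₀ (hb.weight.le_one j) (hbd j).1.le (hl j).1

/-! ### Lipschitz bounds of the perturbation -/

section Lipschitz

variable {A F : Type*} [NormedAddCommGroup A] [NormedSpace ℝ A] [NormedAddCommGroup F]
  [NormedSpace ℝ F]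

/-- Bounds on the partial derivatives on a product of convex sets give Lipschitz bounds. -/
theorem norm_sub_le_of_partial {f : A × Coupling → F} {s : Set A} {t : Set Coupling}
    (hs : Convex ℝ s) (ht : Convex ℝ t) (hf : DifferentiableOn ℝ f (s ×ˢ t)) {c₁ c₂ : ℝ}
    (h1 : ∀ x ∈ s ×ˢ t, ‖derivK f (s ×ˢ t) x‖ ≤ c₁)
    (h2 : ∀ x ∈ s ×ˢ t, ‖derivV f (s ×ˢ t) x‖ ≤ c₂) {p p' : A × Coupling}
    (hp : p ∈ s ×ˢ t) (hp' : p' ∈ s ×ˢ t) :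
    ‖f p - f p'‖ ≤ c₁ * ‖p.1 - p'.1‖ + c₂ * ‖p.2 - p'.2‖ := by
  have e1 : ‖f (p.1, p.2) - f (p'.1, p.2)‖ ≤ c₁ * ‖p.1 - p'.1‖ := by
    refine hs.norm_image_sub_le_of_norm_hasFDerivWithin_le (f := fun k => f (k, p.2))
      (f' := fun k => derivK f (s ×ˢ t) (k, p.2)) (fun k hk => ?_)
      (fun k hk => h1 _ ⟨hk, hp.2⟩) hp'.1 hp.1
    exact ((hf (k, p.2) ⟨hk, hp.2⟩).hasFDerivWithinAt).comp k
      (hasFDerivAt_prodMk_left k p.2).hasFDerivWithinAt (fun k hk => Set.mk_mem_prod hk hp.2)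
  have e2 : ‖f (p'.1, p.2) - f (p'.1, p'.2)‖ ≤ c₂ * ‖p.2 - p'.2‖ := by
    refine ht.norm_image_sub_le_of_norm_hasFDerivWithin_le (f := fun k => f (p'.1, k))
      (f' := fun k => derivV f (s ×ˢ t) (p'.1, k)) (fun k hk => ?_)
      (fun k hk => h2 _ ⟨hp'.1, hk⟩) hp'.2 hp.2
    exact ((hf (p'.1, k) ⟨hp'.1, hk⟩).hasFDerivWithinAt).comp k
      (hasFDerivAt_prodMk_right p'.1 k).hasFDerivWithinAt
      (fun k hk => Set.mk_mem_prod hp'.1 hk)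
  calc ‖f p - f p'‖ = ‖(f (p.1, p.2) - f (p'.1, p.2)) + (f (p'.1, p.2) - f (p'.1, p'.2))‖ := by
        rw [sub_add_sub_cancel]
    _ ≤ _ := (norm_add_le _ _).trans (add_le_add e1 e2)

end Lipschitz

section Perturbation

variable {W : ℕ → Type*} [∀ j, NormedAddCommGroup (W j)]

theorem domain_eq_tube {Ω a h g₀ : ℝ} {P : Coeffs} {g z μ : ℕ → ℝ}
    (hq : quadFlow P g₀ = fun j => (g j, z j, μ j)) :
    domain W Ω a h g₀ P = tube W (chi Ω P.beta) g z μ a h := by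
  funext j
  simp only [domain, tube, gbar, hq, logWeight, mul_assoc]

/-- A product of balls is convex in `K` and in `V` separately, as the mean value inequality in each
variable needs. -/
theorem tube_eq_prod (χ g z μ : ℕ → ℝ) (a h : ℝ) (j : ℕ) :
    tube W χ g z μ a h j = Metric.closedBall 0 (a * (χ j * g j ^ 3)) ×ˢ
      (Metric.closedBall (g j) (h * logWeight (g j)) ×ˢ
        (Metric.closedBall (z j) (h * (χ j * logWeight (g j))) ×ˢ
          Metric.closedBall (μ j) (h * (χ j * logWeight (g j))))) := by
  ext p
  simp [tube, dist_eq_norm]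

theorem pertBounds_of_assumption [∀ j, NormedSpace ℝ (W j)] {Ω a h κ R M g₀ : ℝ} {P : Coeffs}
    {ψ : ∀ j, W j × Coupling → W (j + 1)} {ρ : ∀ j, W j × Coupling → Coupling} {g z μ : ℕ → ℝ}
    (hq : quadFlow P g₀ = fun j => (g j, z j, μ j)) (h3 : AssumptionA3 Ω a h κ R M g₀ P ψ ρ) :
    PertBounds κ R M (chi Ω P.beta) g (tube W (chi Ω P.beta) g z μ a h) ψ ρ := by
  have hD : ∀ j, domain W Ω a h g₀ P j = tube W (chi Ω P.beta) g z μ a h j :=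
    fun j => congrFun (domain_eq_tube hq) j
  have hgb : ∀ j, gbar P g₀ j = g j := fun j => by rw [gbar, hq]
  constructor
  · intro j p hp
    rw [← hD j] at hp
    simpa only [hgb] using h3.psi_le j p hp
  · intro j p hp p' hp'
    have h4 := h3.derivK_psi_le j
    have h5 := h3.derivV_psi_le j
    have h6 := h3.psi_contDiff j
    rw [hD j, tube_eq_prod] at h4 h5 h6
    rw [tube_eq_prod] at hp hp'
    have := norm_sub_le_of_partial (convex_closedBall _ _)
      ((convex_closedBall _ _).prod ((convex_closedBall _ _).prod (convex_closedBall _ _)))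
      (h6.differentiableOn (by norm_num)) h4 h5 hp hp'
    simpa only [hgb] using this
  · intro j p hp
    rw [← hD j] at hp
    simpa only [hgb] using h3.rho_le j p hp
  · intro j p hp p' hp'
    have h4 := h3.derivK_rho_le j
    have h5 := h3.derivV_rho_le j
    have h6 := h3.rho_contDiff j
    rw [hD j, tube_eq_prod] at h4 h5 h6
    rw [tube_eq_prod] at hp hp'
    have := norm_sub_le_of_partial (convex_closedBall _ _)
      ((convex_closedBall _ _).prod ((convex_closedBall _ _).prod (convex_closedBall _ _)))
      (h6.differentiableOn (by norm_num)) h4 h5 hp hp'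
    simpa only [hgb] using this

end Perturbation


/-! ### Choice of the constants -/

theorem eventually_mul_le (k : ℝ) {e : ℝ} (he : 0 < e) : ∀ᶠ δ in 𝓝[>] (0 : ℝ), k * δ ≤ e := by
  have h : Tendsto (fun δ : ℝ => k * δ) (𝓝 0) (𝓝 0) := by
    simpa using (continuous_const_mul k).tendsto (0 : ℝ)
  exact (h.mono_left nhdsWithin_le_nhds).eventually_le_const he

/-- What makes the choice possible is its order: `r₀` from `b`, `A` from `M` and `r₀`, then `q`,
then `h` large compared with constants free of `h`, and finally `δ` small depending on `h`. -/
theorem exists_picardConst {Ω κ R M a aStar b lam₀ B C L Z : ℝ} (hΩ : 1 < Ω) (hlam : 1 < lam₀)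
    (ha : 0 < a) (hκ : 0 < κ) (hκΩ : κ < Ω⁻¹) (hR : 0 < R) (hM : 0 < M)
    (haStar : R / (1 - κ * Ω) < aStar) (haStar_lt : aStar < a) (hb : 0 < b) (hb1 : b < 1)
    (hB : 0 ≤ B) (hC : 0 ≤ C) (hL : 0 ≤ L) (hZ : 0 ≤ Z) :
    ∃ A q r₀ hStar : ℝ, r₀ ≤ b / 4 ∧ r₀ ≤ (1 - b) / 4 ∧ 0 < hStar ∧ ∀ h, hStar ≤ h → ∃ δ, 0 < δ ∧
      PicardConst Ω B C lam₀ L Z δ a h κ R M A q r₀ (aStar + (1 - b) * (a - aStar) / 4) ∧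
      h * δ ≤ (1 - b) / 10 ∧
      κ * Ω * (1 + 7 * δ) * (b * (a - aStar) / 2) + 4 * M * h * δ ≤ b * (a - aStar) / 2 := by
  have hΩ0 : 0 < Ω := by linarith
  have hκ1 : κ * Ω < 1 := by
    have := mul_lt_mul_of_pos_right hκΩ hΩ0
    rwa [inv_mul_cancel₀ hΩ0.ne'] at this
  have hκ0 : 0 < κ * Ω := by positivity
  have hR1 : R < aStar * (1 - κ * Ω) := by rwa [div_lt_iff₀ (by linarith)] at haStar
  have haS : 0 < aStar := lt_of_le_of_lt (div_nonneg hR.le (by linarith)) haStar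
  obtain ⟨k, hk⟩ : ∃ k, k = κ * Ω := ⟨_, rfl⟩
  rw [← hk] at hκ1 hκ0 hR1
  obtain ⟨r₀, hr⟩ : ∃ r₀, r₀ = min b (1 - b) / 4 := ⟨_, rfl⟩
  have hr0 : 0 < r₀ := by rw [hr]; have : 0 < min b (1 - b) := lt_min hb (by linarith)
                          positivity
  have hrb : r₀ ≤ b / 4 := by rw [hr]; have := min_le_left b (1 - b); linarith
  have hrb' : r₀ ≤ (1 - b) / 4 := by rw [hr]; have := min_le_right b (1 - b); linarith
  -- `a₁` exceeds `aStar`, leaving room for a neighbourhood of `K₀'`, and by little enough that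
  -- adding the allowed deviation of `K` stays below `a`.
  obtain ⟨a₁, ha₁⟩ : ∃ a₁, a₁ = aStar + (1 - b) * (a - aStar) / 4 := ⟨_, rfl⟩
  have hpos : 0 < (1 - b) * (a - aStar) := mul_pos (by linarith) (by linarith)
  have ha₁S : aStar < a₁ := by rw [ha₁]; linarith
  have ha₁a : a₁ ≤ a := by rw [ha₁]; nlinarith
  -- The first summand puts the size of `ρ` and the shift of the initial value within the fraction
  -- `r₀` of `A`; the second dominates the Lipschitz constant of `ρ`.
  obtain ⟨A, hA⟩ : ∃ A, A = (8 * M + 1) / r₀ + M * (a + 1) := ⟨_, rfl⟩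
  have hA0 : 0 < A := by rw [hA]; positivity
  have hrA : 8 * M + 1 ≤ r₀ * A := by
    have h1 : r₀ * A = 8 * M + 1 + r₀ * (M * (a + 1)) := by rw [hA]; field_simp
    have : 0 ≤ r₀ * (M * (a + 1)) := by positivity
    linarith
  have hMA : M * (a + 1) ≤ A := by
    rw [hA]
    have : 0 ≤ (8 * M + 1) / r₀ := by positivity
    linarith
  obtain ⟨A₁, hA₁⟩ : ∃ A₁, A₁ = A * (1 + 8 * L) := ⟨_, rfl⟩
  obtain ⟨A₂, hA₂⟩ : ∃ A₂, A₂ = 4 * L * (C * A₁ * (Z + 6) + A) := ⟨_, rfl⟩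
  have hA₁0 : 0 ≤ A₁ := by rw [hA₁]; positivity
  have hA₂0 : 0 ≤ A₂ := by rw [hA₂]; positivity
  -- Halfway from the rates `κΩ` and `λ⁻¹` of the `K`- and `μ`-directions to 1.
  obtain ⟨q, hq⟩ : ∃ q, q = max ((1 + k) / 2) ((1 + lam₀⁻¹) / 2) := ⟨_, rfl⟩
  have hlam0 : 0 < lam₀ := by linarith
  have hli : lam₀⁻¹ < 1 := inv_lt_one_of_one_lt₀ hlam
  have hq1 : q < 1 := by rw [hq]; exact max_lt (by linarith) (by linarith)
  have hqk : (1 + k) / 2 ≤ q := by rw [hq]; exact le_max_left _ _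
  have hql : (1 + lam₀⁻¹) / 2 ≤ q := by rw [hq]; exact le_max_right _ _
  have hqlam : (lam₀ + 1) / 2 ≤ lam₀ * q := by
    have := mul_le_mul_of_nonneg_left hql hlam0.le
    have h1 : lam₀ * ((1 + lam₀⁻¹) / 2) = (lam₀ + 1) / 2 := by field_simp
    linarith
  have hl1 : 0 < lam₀ - 1 := by linarith
  obtain ⟨T, hT⟩ : ∃ T, T = C * (A₁ + A₂) + A := ⟨_, rfl⟩
  have hT0 : 0 ≤ T := by rw [hT]; positivity
  -- As `q ≥ 1/2`, taking `h ≥ 2A₁, 2A₂` puts the new `g`- and `z`-deviations below `q h`. The last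
  -- term uses half of the slack `λq - 1 ≥ (λ - 1)/2`; the other half is kept for the terms with
  -- `δ`.
  refine ⟨A, q, r₀, 1 + 2 * A₁ + 2 * A₂ + 4 * T / (lam₀ - 1), hrb, hrb', by positivity,
    fun h hh => ?_⟩
  have hT' : 0 ≤ 4 * T / (lam₀ - 1) := by positivity
  have hh1 : 1 ≤ h := by linarith
  have hhA₁ : 2 * A₁ ≤ h := by linarith
  have hhA₂ : 2 * A₂ ≤ h := by linarith
  have hhT : T ≤ (lam₀ - 1) / 4 * h := by
    have h1 : 4 * T / (lam₀ - 1) ≤ h := by linarith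
    rw [div_le_iff₀ hl1] at h1
    linarith
  have hX : 0 < b * (a - aStar) / 2 := by
    have := mul_pos hb (sub_pos.2 haStar_lt); linarith
  obtain ⟨X, hXd⟩ : ∃ X, X = b * (a - aStar) / 2 := ⟨_, rfl⟩
  rw [← hXd] at hX
  have hs1 : 0 < a₁ * (1 - k) - R := by
    have := mul_lt_mul_of_pos_right ha₁S (show 0 < 1 - k by linarith)
    linarith
  have ev := (((((((eventually_mul_le 1 one_pos).and
    (eventually_mul_le h (show 0 < (1 - b) / 10 by linarith))).and
    (eventually_mul_le (B ^ 2 * h + 2 * B * h ^ 2) hA0)).and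
    (eventually_mul_le (7 * k * a + 2 * M * h) (show 0 < (1 - k) / 2 * a by
      have : 0 < 1 - k := by linarith
      positivity))).and
    (eventually_mul_le (7 * k * a₁) hs1)).and
    (eventually_mul_le (7 + 10 * C * (Z + 2)) (show 0 < (lam₀ - 1) / 4 by linarith))).and
    (eventually_mul_le (7 * k * X + 4 * M * h) (show 0 < (1 - k) * X by
      have : 0 < 1 - k := by linarith
      positivity))).and self_mem_nhdsWithin
  obtain ⟨δ, ⟨⟨⟨⟨⟨⟨e1, e2⟩, e3⟩, e4⟩, e5⟩, e6⟩, e7⟩, hδ⟩ := ev.exists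
  have hδ0 : 0 < δ := hδ
  have hqh : h / 2 ≤ q * h := by
    have h1 : 1 / 2 ≤ q := by linarith
    have h2 := mul_le_mul_of_nonneg_right h1 (show 0 ≤ h by linarith)
    linarith
  refine ⟨δ, hδ0, ?_, e2, ?_⟩
  · rw [← ha₁]
    refine
      { B_nonneg := hB
        C_nonneg := hC
        one_lt_lam := hlam
        L_nonneg := hL
        Z_nonneg := hZ
        a_pos := ha
        h_pos := by linarith
        Ω_pos := hΩ0
        κ_pos := hκ
        M_pos := hM
        A_nonneg := hA0.le
        q_nonneg := by linarith
        q_lt_one := hq1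
        r₀_pos := hr0
        r₀_le := by linarith
        a₁_pos := by linarith
        a₁_le := ha₁a
        δ_le := by linarith
        h_δ := by linarith
        g_cond := e3
        A₁_le := by rw [← hA₁]; linarith
        A₂_le := by rw [← hA₁, ← hA₂]; linarith
        mu_cond := ?_
        K_cond := ?_
        A_ge_lip := ?_
        A_ge_rho := by linarith
        A_ge_one := by linarith
        K_self := ?_ }
    · rw [← hA₁, ← hA₂]
      have h1 := mul_le_mul_of_nonneg_right e6 (show 0 ≤ h by linarith)
      have h2 := mul_le_mul_of_nonneg_right hqlam (show 0 ≤ h by linarith)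
      have h3 : C * (A₁ + A₂) + A = T := hT.symm
      linarith
    · rw [← hk]
      have h1 := mul_le_mul_of_nonneg_right hqk ha.le
      linarith
    · refine le_trans (mul_le_mul_of_nonneg_left ?_ hM.le) hMA
      linarith
    · rw [← hk]; linarith
  · rw [← hk, ← hXd]; linarith

/-! ### Comparison with the approximate flow -/

/-- The tube is measured in the weights of the reference flow, the stated bounds in those of the
flow from `u₀`; a small relative change of the coupling changes the weights little. -/
theorem logWeight_compare {s t η : ℝ} (hs : 0 < s) (hs1 : s ≤ 1) (hlog : 1 ≤ |Real.log s|)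
    (hη : η ≤ 1 / 10) (ht : |t - s| ≤ η * s) :
    0 < t ∧ logWeight t ≤ (1 + 5 * η) * logWeight s ∧ logWeight s ≤ 2 * logWeight t ∧
      t ^ 3 ≤ (1 + 5 * η) * s ^ 3 ∧ s ^ 3 ≤ 2 * t ^ 3 := by
  have hη0 : 0 ≤ η := by
    have := (abs_nonneg _).trans ht
    exact nonneg_of_mul_nonneg_left this hs
  obtain ⟨h1, h2⟩ := abs_le.1 ht
  rw [abs_of_nonpos (Real.log_nonpos hs.le hs1)] at hlog
  have hs2 : s ≤ 1 / 2 := by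
    have h3 : Real.log s ≤ -1 := by linarith
    have h4 : s ≤ Real.exp (-1) := (Real.log_le_iff_le_exp hs).1 h3
    have h5 : Real.exp (-1) ≤ 1 / 2 := by
      rw [Real.exp_neg, inv_eq_one_div]
      refine one_div_le_one_div_of_le (by norm_num) ?_
      have := Real.add_one_le_exp (1 : ℝ)
      linarith
    linarith
  have hlo : (1 - η) * s ≤ t := by linarith
  have hhi : t ≤ (1 + η) * s := by linarith
  have ht0 : 0 < t := lt_of_lt_of_le (mul_pos (by linarith) hs) hlo
  have ht1 : t ≤ 1 := by nlinarith
  have l1 : -Real.log t ≤ (1 + 2 * η) * -Real.log s := by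
    have h3 : Real.log s - Real.log t ≤ s / t - 1 := by
      rw [← Real.log_div hs.ne' ht0.ne']; exact Real.log_le_sub_one_of_pos (by positivity)
    have h4 : s / t - 1 ≤ 2 * η := by
      rw [div_sub_one ht0.ne', div_le_iff₀ ht0]
      nlinarith [mul_nonneg hη0 hs.le]
    nlinarith
  have l2 : (1 - η) * -Real.log s ≤ -Real.log t := by
    have h3 : Real.log t - Real.log s ≤ t / s - 1 := by
      rw [← Real.log_div ht0.ne' hs.ne']; exact Real.log_le_sub_one_of_pos (by positivity)
    have h4 : t / s - 1 ≤ η := by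
      rw [div_sub_one hs.ne', div_le_iff₀ hs]; linarith
    nlinarith
  have hls : 0 ≤ -Real.log s := by linarith
  have hη1 : 0 ≤ 1 - η := by linarith
  have q1 : (1 + η) ^ 2 * (1 + 2 * η) ≤ 1 + 5 * η := by nlinarith [mul_nonneg hη0 hη0]
  have q2 : (1 + η) ^ 3 ≤ 1 + 5 * η := by nlinarith [mul_nonneg hη0 hη0]
  have q3 : 1 / 2 ≤ (1 - η) ^ 3 := by
    have : (9 / 10 : ℝ) ^ 3 ≤ (1 - η) ^ 3 := pow_le_pow_left₀ (by norm_num) (by linarith) 3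
    norm_num at this ⊢; linarith
  refine ⟨ht0, ?_, ?_, ?_, ?_⟩
  · unfold logWeight
    rw [abs_of_nonpos (Real.log_nonpos ht0.le ht1), abs_of_nonpos (Real.log_nonpos hs.le hs1)]
    calc t ^ 2 * -Real.log t ≤ ((1 + η) * s) ^ 2 * ((1 + 2 * η) * -Real.log s) := by
          gcongr
          linarith [Real.log_nonpos ht0.le ht1]
      _ = (1 + η) ^ 2 * (1 + 2 * η) * (s ^ 2 * -Real.log s) := by ring
      _ ≤ _ := by gcongr
  · unfold logWeight
    rw [abs_of_nonpos (Real.log_nonpos ht0.le ht1), abs_of_nonpos (Real.log_nonpos hs.le hs1)]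
    have h3 : (1 - η) ^ 3 * (s ^ 2 * -Real.log s) ≤ t ^ 2 * -Real.log t := by
      calc (1 - η) ^ 3 * (s ^ 2 * -Real.log s)
          = ((1 - η) * s) ^ 2 * ((1 - η) * -Real.log s) := by ring
        _ ≤ _ := by gcongr
    have h4 : 0 ≤ s ^ 2 * -Real.log s := by positivity
    nlinarith
  · calc t ^ 3 ≤ ((1 + η) * s) ^ 3 := by gcongr
      _ = (1 + η) ^ 3 * s ^ 3 := by ring
      _ ≤ _ := by gcongr
  · have h3 : (1 - η) ^ 3 * s ^ 3 ≤ t ^ 3 := by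
      rw [← mul_pow]; gcongr
    have h4 : 0 ≤ s ^ 3 := by positivity
    nlinarith

namespace FlowEnv

variable {W : ℕ → Type*} [∀ j, NormedAddCommGroup (W j)]
  {Ω B C S lam₀ L Z δ : ℝ} {P : Coeffs} {g z μ : ℕ → ℝ}
  {a aStar b h κ R M A q r₀ a₁ : ℝ} {ψ : ∀ j, W j × Coupling → W (j + 1)}
  {ρ : ∀ j, W j × Coupling → Coupling} {u₀ : W 0 × ℝ} {x xb y : ∀ j, W j × Coupling}

theorem compare_of_mem_tube {χ : ℕ → ℝ} (hE : FlowEnv Ω B C S lam₀ L Z δ P χ g z μ)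
    (hc : PicardConst Ω B C lam₀ L Z δ a h κ R M A q r₀ a₁) (hb : 0 < b)
    (hhδ : h * δ ≤ (1 - b) / 10) {j : ℕ} {p : W j × Coupling}
    (hp : p ∈ tube W χ g z μ a₁ (r₀ * h) j) :
    0 < p.2.1 ∧ logWeight p.2.1 ≤ (1 + (1 - b) / 2) * logWeight (g j) ∧
      logWeight (g j) ≤ 2 * logWeight p.2.1 ∧
      p.2.1 ^ 3 ≤ (1 + (1 - b) / 2) * g j ^ 3 ∧ g j ^ 3 ≤ 2 * p.2.1 ^ 3 := by
  have hg := hE.coupling.pos j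
  have hω := hE.logWeight_pos j
  have hr := hc.r₀_le
  have hh := hc.h_pos
  have h1 : |p.2.1 - g j| ≤ (h * δ) * g j := by
    refine hp.2.1.trans ?_
    calc r₀ * h * logWeight (g j) ≤ 1 * h * (δ * g j) := by
          gcongr
          exact hE.logWeight_le j
      _ = _ := by ring
  obtain ⟨h0, h2, h3, h4, h5⟩ := logWeight_compare hg (hE.coupling.le_one j) (hE.one_le_log j)
    (by linarith) h1
  have h6 : 1 + 5 * (h * δ) ≤ 1 + (1 - b) / 2 := by linarith
  exact ⟨h0, h2.trans (by gcongr), h3, h4.trans (by gcongr), h5⟩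

/-- In the couplings both sequences are within `r₀ h` of the centre, hence `2 r₀ h` apart; the
change of weights costs another factor 2, and `r₀ ≤ b/4`. For `K` the tube is too wide, and the
common initial value must be used. -/
theorem flowBounds_of_mem_tube
    (hE : FlowEnv Ω B C S lam₀ L Z δ P (chi Ω P.beta) g z μ)
    (hc : PicardConst Ω B C lam₀ L Z δ a h κ R M A q r₀ a₁)
    (hp : PertBounds κ R M (chi Ω P.beta) g (tube W (chi Ω P.beta) g z μ a h) ψ ρ)
    (hb : 0 < b) (haa : aStar ≤ a) (hr : r₀ ≤ b / 4) (hhδ : h * δ ≤ (1 - b) / 10)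
    (hK : κ * Ω * (1 + 7 * δ) * (b * (a - aStar) / 2) + 4 * M * h * δ ≤ b * (a - aStar) / 2)
    (hxb : ∀ j, xb j ∈ tube W (chi Ω P.beta) g z μ a₁ (r₀ * h) j)
    (hx : ∀ j, x j ∈ tube W (chi Ω P.beta) g z μ a₁ (r₀ * h) j)
    (happ : approxFlow P ψ u₀ = xb) (hinit : (x 0).1 = u₀.1)
    (hstep : ∀ j, (x (j + 1)).1 = ψ j (x j)) :
    FlowBounds Ω a aStar h b P ψ u₀ x := by
  have hγ : ∀ j, gbar P u₀.2 j = (xb j).2.1 := fun j => by rw [← happ]; rfl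
  have hrh : r₀ * h ≤ h := by have := hc.h_pos; have := hc.r₀_le; nlinarith
  have hχ := hE.weight.pos
  have hh := hc.h_pos
  have hr0 := hc.r₀_pos
  have cmp := fun j => hE.compare_of_mem_tube hc hb hhδ (hxb j)
  have tri : ∀ p p' w k : ℝ, |p - w| ≤ k → |p' - w| ≤ k → |p - p'| ≤ 2 * k := by
    intro p p' w k e e'
    rw [abs_le] at *
    constructor <;> linarith
  have d1 := fun j => tri _ _ _ _ (hx j).2.1 (hxb j).2.1
  have d2 := fun j => tri _ _ _ _ (hx j).2.2.1 (hxb j).2.2.1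
  have d3 := fun j => tri _ _ _ _ (hx j).2.2.2 (hxb j).2.2.2
  have fin : ∀ w w' : ℝ, 0 ≤ w' → w ≤ 2 * w' → 2 * (r₀ * h * w) ≤ b * h * w' := by
    intro w w' hw' hww
    have e1 : r₀ * h * w ≤ r₀ * h * (2 * w') := by gcongr
    have e2 : r₀ * (h * w') ≤ b / 4 * (h * w') := by gcongr
    linarith
  have lw0 : ∀ j, 0 ≤ logWeight (xb j).2.1 := fun j => by unfold logWeight; positivity
  have f2 : ∀ j, 2 * (r₀ * h * (chi Ω P.beta j * logWeight (g j)))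
      ≤ b * h * (chi Ω P.beta j * logWeight (xb j).2.1) := fun j => by
    refine fin _ _ (mul_nonneg (hχ j).le (lw0 j)) ?_
    have := mul_le_mul_of_nonneg_left (cmp j).2.2.1 (hχ j).le
    linarith
  have hbX : 0 ≤ b * (a - aStar) := mul_nonneg hb.le (by linarith)
  -- The difference starts at zero and is propagated with factor `κΩ(1 + 7δ) < 1`; half of `b(a -
  -- aStar)` is aimed at because the change of weights may double it.
  have kd : ∀ j, ‖(x j).1 - (xb j).1‖ ≤ b * (a - aStar) / 2 * (chi Ω P.beta j * g j ^ 3) := by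
    intro j
    induction j with
    | zero =>
      have : (xb 0).1 = u₀.1 := by rw [← happ]; rfl
      rw [hinit, this, sub_self, norm_zero]
      have := hE.coupling.pos 0; have := hχ 0
      positivity
    | succ j ih =>
      have hxbs : (xb (j + 1)).1 = ψ j (xb j) := by rw [← happ]; rfl
      have hg := hE.coupling.pos j
      have hg' := hE.coupling.pos (j + 1)
      have hχ' := hχ (j + 1)
      have hM := hc.M_pos
      have hκ := hc.κ_pos
      have hV : ‖(x j).2 - (xb j).2‖ ≤ 2 * (r₀ * h) * logWeight (g j) := by
        refine hE.norm_coupling_le (by positivity) ?_ ?_ ?_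
        · have := d1 j; rw [← mul_assoc] at this; exact this
        · have := d2 j; rw [← mul_assoc] at this; exact this
        · have := d3 j; rw [← mul_assoc] at this; exact this
      have hV' : ‖(x j).2 - (xb j).2‖ ≤ 2 * h * logWeight (g j) := hV.trans (by
        have := hE.logWeight_pos j
        gcongr)
      rw [hstep j, hxbs]
      refine (hp.psi_lip j _ (hE.tube_mono hc.a₁_le hrh j (hx j)) _
        (hE.tube_mono hc.a₁_le hrh j (hxb j))).trans ?_
      calc _ ≤ κ * (b * (a - aStar) / 2 * (chi Ω P.beta j * g j ^ 3))
            + M * (chi Ω P.beta (j + 1) * g (j + 1) ^ 2) * (2 * h * logWeight (g j)) := by gcongr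
        _ = κ * (b * (a - aStar) / 2) * (chi Ω P.beta j * g j ^ 3)
            + 2 * M * h * (chi Ω P.beta (j + 1) * g (j + 1) ^ 2 * logWeight (g j)) := by ring
        _ ≤ κ * (b * (a - aStar) / 2) * (Ω * (1 + 7 * δ) * (chi Ω P.beta (j + 1) * g (j + 1) ^ 3))
            + 2 * M * h * (2 * δ * (chi Ω P.beta (j + 1) * g (j + 1) ^ 3)) :=
            add_le_add
              (mul_le_mul_of_nonneg_left (hE.cube_le hc.δ_le hc.Ω_pos j) (by positivity))
              (mul_le_mul_of_nonneg_left (hE.sq_mul_logWeight_le hc.δ_le j) (by positivity))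
        _ = (κ * Ω * (1 + 7 * δ) * (b * (a - aStar) / 2) + 4 * M * h * δ)
            * (chi Ω P.beta (j + 1) * g (j + 1) ^ 3) := by ring
        _ ≤ _ := mul_le_mul_of_nonneg_right hK (by positivity)
  constructor
  · intro j
    rw [happ, hγ]
    refine (kd j).trans ?_
    have h1 := mul_le_mul_of_nonneg_left (cmp j).2.2.2.2 (hχ j).le
    have h2 := mul_le_mul_of_nonneg_left h1 (show 0 ≤ b * (a - aStar) / 2 by linarith)
    linarith
  · intro j
    rw [happ, hγ]
    exact (d1 j).trans (fin _ _ (lw0 j) (cmp j).2.2.1)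
  · intro j
    rw [happ, hγ, mul_assoc (chi Ω P.beta j)]
    exact (d2 j).trans (f2 j)
  · intro j
    rw [happ, hγ, mul_assoc (chi Ω P.beta j)]
    exact (d3 j).trans (f2 j)

/-- This turns uniqueness in the tube into uniqueness under the stated bounds. Room is left because
`b(1 + (1 - b)/2) + (1 - b)/4 ≤ 1`, where the first term is the deviation in changed weights and the
second the offset of the approximate flow. -/
theorem mem_tube_of_flowBounds
    (hE : FlowEnv Ω B C S lam₀ L Z δ P (chi Ω P.beta) g z μ)
    (hc : PicardConst Ω B C lam₀ L Z δ a h κ R M A q r₀ (aStar + (1 - b) * (a - aStar) / 4))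
    (hb : 0 < b) (hb1 : b < 1) (haa : aStar ≤ a) (hr : r₀ ≤ (1 - b) / 4)
    (hhδ : h * δ ≤ (1 - b) / 10)
    (hxb : ∀ j, xb j ∈ tube W (chi Ω P.beta) g z μ (aStar + (1 - b) * (a - aStar) / 4) (r₀ * h) j)
    (happ : approxFlow P ψ u₀ = xb) (hy : FlowBounds Ω a aStar h b P ψ u₀ y) (j : ℕ) :
    y j ∈ tube W (chi Ω P.beta) g z μ a h j := by
  have hγ : gbar P u₀.2 j = (xb j).2.1 := by rw [← happ]; rfl
  have hχ := hE.weight.pos j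
  have hh := hc.h_pos
  have hω := hE.logWeight_pos j
  have hg := hE.coupling.pos j
  obtain ⟨c0, c1, -, c3, -⟩ := hE.compare_of_mem_tube hc hb hhδ (hxb j)
  obtain ⟨t1, t2, t3, t4⟩ := hxb j
  have y1 := hy.K_le j
  have y2 := hy.g_le j
  have y3 := hy.z_le j
  have y4 := hy.mu_le j
  rw [happ, hγ] at y1 y2 y3 y4
  rw [mul_assoc (chi Ω P.beta j)] at y3 y4
  change _ ≤ b * h * logWeight (xb j).2.1 at y2
  change _ ≤ b * h * (chi Ω P.beta j * logWeight (xb j).2.1) at y3 y4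
  have hsum : b * (1 + (1 - b) / 2) + r₀ ≤ 1 := by nlinarith
  have tri : ∀ p p' v w w' : ℝ, 0 ≤ w → w' ≤ (1 + (1 - b) / 2) * w → |p - p'| ≤ b * h * w' →
      |p' - v| ≤ r₀ * h * w → |p - v| ≤ h * w := by
    intro p p' v w w' hw hww e1 e2
    have h1 : |p - v| ≤ |p - p'| + |p' - v| := abs_sub_le _ _ _
    have h2 : b * h * w' ≤ b * h * ((1 + (1 - b) / 2) * w) := by gcongr
    have h3 := mul_le_mul_of_nonneg_right hsum (show 0 ≤ h * w by positivity)
    linarith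
  have hχω : chi Ω P.beta j * logWeight (xb j).2.1
      ≤ (1 + (1 - b) / 2) * (chi Ω P.beta j * logWeight (g j)) := by
    have := mul_le_mul_of_nonneg_left c1 hχ.le
    linarith
  refine ⟨?_, tri _ _ _ _ _ hω.le c1 y2 t2, tri _ _ _ _ _ (by positivity) hχω y3 t3,
    tri _ _ _ _ _ (by positivity) hχω y4 t4⟩
  have h1 : ‖(y j).1‖ ≤ ‖(y j).1 - (xb j).1‖ + ‖(xb j).1‖ := by
    simpa using norm_add_le ((y j).1 - (xb j).1) (xb j).1
  have h2 : chi Ω P.beta j * (xb j).2.1 ^ 3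
      ≤ (1 + (1 - b) / 2) * (chi Ω P.beta j * g j ^ 3) := by
    have := mul_le_mul_of_nonneg_left c3 hχ.le
    linarith
  have h3 := mul_le_mul_of_nonneg_left h2 (mul_nonneg hb.le (sub_nonneg.2 haa))
  have h4 : (b * (a - aStar) * (1 + (1 - b) / 2) + (aStar + (1 - b) * (a - aStar) / 4))
      * (chi Ω P.beta j * g j ^ 3) ≤ a * (chi Ω P.beta j * g j ^ 3) := by
    refine mul_le_mul_of_nonneg_right ?_ (by positivity)
    have h5 : b * (1 + (1 - b) / 2) + (1 - b) / 4 ≤ 1 := by nlinarith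
    have h6 := mul_le_mul_of_nonneg_right h5 (sub_nonneg.2 haa)
    linarith
  linarith

end FlowEnv

/-- The approximate flow is the flow of the unperturbed equation. -/
theorem approxFlow_eq {W : ℕ → Type*} {P : Coeffs} {ψ : ∀ j, W j × Coupling → W (j + 1)}
    {u₀ : W 0 × ℝ} {xb : ∀ j, W j × Coupling} (huniq : ∃! V, IsQuadFlow P u₀.2 V)
    (hxb : IsGlobalFlow P ψ (fun _ _ => 0) u₀ xb) : approxFlow P ψ u₀ = xb := by
  have hV : IsQuadFlow P u₀.2 fun j => (xb j).2 :=
    ⟨hxb.init_g, fun j => by rw [hxb.step j]; simp [evolution], hxb.z_lim, hxb.mu_lim⟩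
  have hq : quadFlow P u₀.2 = fun j => (xb j).2 :=
    huniq.unique (Classical.epsilon_spec huniq.exists) hV
  have hK : ∀ j, approxK ψ (quadFlow P u₀.2) u₀.1 j = (xb j).1 := by
    intro j
    induction j with
    | zero => exact hxb.init_K.symm
    | succ j ih => rw [approxK, ih, hxb.step j, hq]; rfl
  funext j
  exact Prod.ext (hK j) (congrFun hq j)


/-! ### Continuity of the flow -/

section

variable {W : ℕ → Type*} [∀ j, NormedAddCommGroup (W j)] {X : Type*} [TopologicalSpace X]

theorem continuous_zBar {Ω B C S lam₀ L Z δ A : ℝ} {P : X → Coeffs} (hP : ContinuousCoeffs P)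
    {χ g z μ : X → ℕ → ℝ} (hg : ∀ j, Continuous fun p => g p j)
    (hE : ∀ p, FlowEnv Ω B C S lam₀ L Z δ (P p) (χ p) (g p) (z p) (μ p)) (hC : 0 ≤ C)
    (hdecay : ∀ p, ∀ l : ℕ, χ p l * g p l ^ 2 ≤ A * (1 / ((l : ℝ) + 1) ^ 2)) (j : ℕ) :
    Continuous fun p => zBar (P p) (g p) j := by
  refine continuous_backSum_of_decay (A := C * A)
    (fun j => continuous_const.sub ((hP.zeta j).mul (hg j)))
    (fun j => ((hP.theta j).mul ((hg j).pow 2)).neg) (fun p => (hE p).half_le_prod) (fun p l => ?_) j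
  change |-((P p).theta l * g p l ^ 2)| ≤ _
  rw [abs_neg, abs_mul, abs_of_nonneg (sq_nonneg (g p l)), mul_assoc C A]
  calc |(P p).theta l| * g p l ^ 2 ≤ C * χ p l * g p l ^ 2 := by
        gcongr
        exact (hE p).coeff.theta_le l
    _ = C * (χ p l * g p l ^ 2) := by ring
    _ ≤ _ := mul_le_mul_of_nonneg_left (hdecay p l) hC

/-- The flow is continuous in a parameter on which the iterates of the Picard map depend
continuously, since these converge uniformly. -/
theorem continuous_flow {Ω B C S lam₀ L Z δ a h κ R M A q r₀ a₁ A' : ℝ} {P : X → Coeffs}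
    (hP : ContinuousCoeffs P) {χ g z μ : X → ℕ → ℝ} {ψ : X → ∀ j, W j × Coupling → W (j + 1)}
    {ρ : X → ∀ j, W j × Coupling → Coupling} {u : X → W 0 × ℝ} {x : X → ∀ j, W j × Coupling}
    (hE : ∀ p, FlowEnv Ω B C S lam₀ L Z δ (P p) (χ p) (g p) (z p) (μ p))
    (hc : PicardConst Ω B C lam₀ L Z δ a h κ R M A q r₀ a₁)
    (hp : ∀ p, PertBounds κ R M (χ p) (g p) (tube W (χ p) (g p) (z p) (μ p) a h) (ψ p) (ρ p))
    (hg : ∀ j, Continuous fun p => g p j) (hz : ∀ j, Continuous fun p => z p j)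
    (hμ : ∀ j, Continuous fun p => μ p j) (hu : Continuous u)
    (hu1 : ∀ p, ‖(u p).1‖ ≤ a₁ * g p 0 ^ 3) (hu2 : ∀ p, |(u p).2 - g p 0| ≤ g p 0 ^ 2)
    (hcont : ∀ (j : ℕ) (y : X → W j × Coupling), Continuous y →
      (∀ p, y p ∈ tube W (χ p) (g p) (z p) (μ p) a h j) →
      Continuous fun p => evolution (P p) (ψ p) (ρ p) j (y p))
    (hdecay : ∀ p, ∀ l : ℕ, χ p l * g p l ^ 2 ≤ A' * (1 / ((l : ℝ) + 1) ^ 2))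
    (hx : ∀ p k j, dist ((picard (P p) (g p) (ψ p) (ρ p) (u p))^[k]
      (fun j => (0, g p j, z p j, μ p j)) j) (x p j) ≤ (a + 1) * (q ^ k * 2)) (j : ℕ) :
    Continuous fun p => x p j := by
  have hr : r₀ * h ≤ h := by have := hc.h_pos; have := hc.r₀_le; nlinarith
  have hQ : 0 ≤ C * (5 + Z) + A := by
    have := hc.C_nonneg; have := hc.Z_nonneg; have := hc.A_nonneg
    positivity
  have key : ∀ k, (∀ p j, (picard (P p) (g p) (ψ p) (ρ p) (u p))^[k]
        (fun j => (0, g p j, z p j, μ p j)) j ∈ tube W (χ p) (g p) (z p) (μ p) a₁ (r₀ * h) j) ∧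
      ∀ j, Continuous fun p => (picard (P p) (g p) (ψ p) (ρ p) (u p))^[k]
        (fun j => (0, g p j, z p j, μ p j)) j := by
    intro k
    induction k with
    | zero =>
      exact ⟨fun p j => (hE p).center_mem_tube hc.a₁_pos.le
        (mul_nonneg hc.r₀_pos.le hc.h_pos.le) j,
        fun j => continuous_const.prodMk ((hg j).prodMk ((hz j).prodMk (hμ j)))⟩
    | succ k ih =>
      simp only [Function.iterate_succ_apply']
      obtain ⟨ih1, ih2⟩ := ih
      refine ⟨fun p => (hE p).picard_mem_tube hc (hp p) le_rfl hc.a₁_le le_rfl hc.r₀_le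
        hc.K_self (hu1 p) (hu2 p) (ih1 p), ?_⟩
      generalize hy : (fun p => (picard (P p) (g p) (ψ p) (ρ p) (u p))^[k]
        (fun j => (0, g p j, z p j, μ p j))) = y
      have hy' : ∀ p, (picard (P p) (g p) (ψ p) (ρ p) (u p))^[k]
        (fun j => (0, g p j, z p j, μ p j)) = y p := fun p => congrFun hy p
      simp only [hy'] at ih1 ih2 ⊢
      have hmem : ∀ p j, y p j ∈ tube W (χ p) (g p) (z p) (μ p) a h j := fun p j =>
        (hE p).tube_mono hc.a₁_le hr j (ih1 p j)
      have hev := fun j => hcont j (fun p => y p j) (ih2 j) fun p => hmem p j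
      refine continuous_picard hP hg hu ih2 (fun j => (hev j).fst) (fun j => ?_) (fun p j => ?_)
        (fun p => (hE p).half_le_prod) hQ
        (fun p j => ((hE p).picardZ_summable hc (hp p) (hu2 p) (hmem p) j).1) hdecay
      -- Only `Φ` is known to be continuous; `ρ` is recovered by subtracting the continuous
      -- quadratic map.
      · have := (hev j).snd.sub (continuous_quadMap hP (ih2 j).snd j)
        refine this.congr fun p => ?_
        simp only [evolution, Pi.sub_apply, add_sub_cancel_left]
      · have := (hE p).coeff.le_lam j
        have := hc.one_lt_lam
        linarith
  have hlim : Tendsto (fun k => (a + 1) * (q ^ k * 2)) atTop (𝓝 0) := by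
    simpa using ((tendsto_pow_atTop_nhds_zero_of_lt_one hc.q_nonneg hc.q_lt_one).mul_const
      2).const_mul (a + 1)
  have hunif : TendstoUniformly (fun k p => (picard (P p) (g p) (ψ p) (ρ p) (u p))^[k]
      (fun j => (0, g p j, z p j, μ p j)) j) (fun p => x p j) atTop := by
    rw [Metric.tendstoUniformly_iff]
    intro ε hε
    filter_upwards [hlim.eventually_lt_const hε] with k hk p
    rw [dist_comm]
    exact (hx p k j).trans_lt hk
  exact hunif.continuous (Frequently.of_forall fun k => (key k).2 j)

end

end QuadFlow

/-! ### Assembly of the main theorem. -/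

theorem corollary1p6
    (Ω B c lam₀ C a κ R M aStar b : ℝ)
    (hΩ : 1 < Ω) (hc : 0 < c) (hlam : 1 < lam₀) (ha : 0 < a)
    (hκ : 0 < κ) (hκΩ : κ < Ω⁻¹) (hR : 0 < R) (hRa : R < a * (1 - κ * Ω)) (hM : 0 < M)
    (haStar : R / (1 - κ * Ω) < aStar) (haStar_lt : aStar < a) (hb : 0 < b) (hb1 : b < 1) :
    ∃ hStar : ℝ, 0 < hStar ∧ ∀ h : ℝ, hStar ≤ h →
    ∃ gStar : ℝ, 0 < gStar ∧
    ∀ (W : ℕ → Type*) [∀ j, NormedAddCommGroup (W j)] [∀ j, NormedSpace ℝ (W j)]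
      [∀ j, CompleteSpace (W j)] (E : Type*) [MetricSpace E]
      (P : E → Coeffs)
      (ψ : E → ∀ j, W j × Coupling → W (j + 1)) (ρ : E → ∀ j, W j × Coupling → Coupling)
      (K₀' : W 0) (g₀' : ℝ),
      0 < g₀' → g₀' ≤ gStar → ‖K₀'‖ ≤ aStar * g₀' ^ 3 →
      ContinuousCoeffs P →
      (∀ j, ContinuousOn
        (fun p : (W j × Coupling) × E => evolution (P p.2) (ψ p.2) (ρ p.2) j p.1)
        ((⋃ m, domain W Ω a h g₀' (P m) j) ×ˢ Set.univ)) →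
      (∀ m, AssumptionA1 Ω B c (P m)) →
      (∀ m, AssumptionA2 Ω c lam₀ C (P m)) →
      (∀ m, AssumptionA3 Ω a h κ R M g₀' (P m) (ψ m) (ρ m)) →
      ∃ N ∈ 𝓝 (K₀', g₀'), ∃ x : E → W 0 × ℝ → ∀ j, W j × Coupling,
        (∀ m, ∀ u₀ ∈ N,
          (∃! V, IsQuadFlow (P m) u₀.2 V) ∧
          (∀ j, approxFlow (P m) (ψ m) u₀ j ∈ domain W Ω a h g₀' (P m) j) ∧
          (∀ j, x m u₀ j ∈ domain W Ω a h g₀' (P m) j) ∧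
          IsGlobalFlow (P m) (ψ m) (ρ m) u₀ (x m u₀) ∧
          FlowBounds Ω a aStar h b (P m) (ψ m) u₀ (x m u₀) ∧
          ∀ y : ∀ j, W j × Coupling, IsGlobalFlow (P m) (ψ m) (ρ m) u₀ y →
            FlowBounds Ω a aStar h b (P m) (ψ m) u₀ y → y = x m u₀) ∧
        ∀ j, ContinuousOn (fun p : E × (W 0 × ℝ) => x p.1 p.2 j) (Set.univ ×ˢ N) := by
  obtain ⟨S, L, Z, A', F, hL, hZ, hEnv⟩ := exists_flowEnv B C hΩ hc hlam
  obtain ⟨A, q, r₀, hStar, hrb, hrb', hpos, hconst⟩ := exists_picardConst hΩ hlam ha hκ hκΩ hR hM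
    haStar haStar_lt hb hb1 (abs_nonneg B) (abs_nonneg C) hL hZ
  refine ⟨hStar, hpos, fun h hh => ?_⟩
  obtain ⟨δ, hδ, hPC, hhδ, hKc⟩ := hconst h hh
  obtain ⟨g₁, hg₁, hEnv⟩ := hEnv δ hδ hPC.δ_le
  -- With `g₀' ≤ 1/2`, initial values within `g₀'²` of `g₀'` are positive and at most `2 g₀' ≤ g₁`,
  -- so their quadratic flows exist and are unique.
  refine ⟨min (g₁ / 2) (1 / 2), lt_min (by linarith) one_half_pos, ?_⟩
  intro W _ _ _ E _ P ψ ρ K₀' g₀' hg₀ hg₀le hK₀ hP hev h1 h2 h3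
  have hg₀1 : g₀' ≤ g₁ / 2 := hg₀le.trans (min_le_left _ _)
  have hg₀1' : g₀' ≤ 1 / 2 := hg₀le.trans (min_le_right _ _)
  have env := fun m => hEnv (P m) (h1 m) (h2 m) g₀' _ hg₀ (by linarith) rfl
  choose hE _ hq hdecay hmuC hmuS using env
  have hpert := fun m => pertBounds_of_assumption (hq m) (h3 m)
  have hdom : ∀ m j, domain W Ω a h g₀' (P m) j = _ :=
    fun m j => congrFun (domain_eq_tube (hq m)) j
  have hr : r₀ * h ≤ h := by have := hPC.h_pos; have := hPC.r₀_le; nlinarith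
  have hsub := fun m j => (hE m).tube_mono (W := W) hPC.a₁_le hr j
  set a₁ := aStar + (1 - b) * (a - aStar) / 4 with ha₁
  have haa : aStar < a₁ := by
    have : 0 < (1 - b) * (a - aStar) := mul_pos (by linarith) (by linarith)
    linarith
  -- Described by `a₁` and `g₀'` alone, hence the same for all `m`.
  let N : Set (W 0 × ℝ) := {u | ‖u.1‖ ≤ a₁ * g₀' ^ 3 ∧ |u.2 - g₀'| ≤ g₀' ^ 2}
  have hN : N ∈ 𝓝 (K₀', g₀') := by
    have o1 : ∀ᶠ u : W 0 × ℝ in 𝓝 (K₀', g₀'), ‖u.1‖ < a₁ * g₀' ^ 3 :=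
      (continuous_fst.norm.tendsto (K₀', g₀')).eventually_lt_const
        (hK₀.trans_lt (mul_lt_mul_of_pos_right haa (by positivity)))
    have o2 : ∀ᶠ u : W 0 × ℝ in 𝓝 (K₀', g₀'), |u.2 - g₀'| < g₀' ^ 2 := by
      refine (((continuous_snd.sub continuous_const).abs).tendsto
        (K₀', g₀')).eventually_lt_const ?_
      simpa using pow_pos hg₀ 2
    filter_upwards [o1, o2] with u e1 e2 using ⟨e1.le, e2.le⟩
  have hflow : ∀ m (u : N), _ := fun m u =>
    (hE m).exists_flow hPC (hpert m) (u₀ := u.1) u.2.1 u.2.2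
  choose x hxmem hxflow hxuniq hxconv using hflow
  -- Off `N` the value is irrelevant and set to zero.
  refine ⟨N, hN, fun m u => by classical exact if hu : u ∈ N then x m ⟨u, hu⟩ else fun _ => 0, ?_, ?_⟩
  · intro m u hu
    simp only [hu, dif_pos]
    have hu2 := abs_le.1 hu.2
    have hsq : g₀' ^ 2 ≤ 1 / 2 * g₀' := by
      rw [sq]; exact mul_le_mul_of_nonneg_right hg₀1' hg₀.le
    have huniq : ∃! V, IsQuadFlow (P m) u.2 V :=
      (hEnv (P m) (h1 m) (h2 m) u.2 _ (by linarith) (by linarith) rfl).2.1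
    -- Dropping `ρ` preserves the bounds, so the approximate flow is obtained from the same
    -- fixed-point theorem, in the same small tube.
    have hpert0 : PertBounds κ R M _ _ _ (ψ m) fun _ _ => 0 :=
      { psi_zero_le := (hpert m).psi_zero_le
        psi_lip := (hpert m).psi_lip
        rho_le := fun j p hp => by
          simpa using (norm_nonneg _).trans ((hpert m).rho_le j p hp)
        rho_lip := fun j p hp p' hp' => by
          simpa using (norm_nonneg _).trans ((hpert m).rho_lip j p hp p' hp') }
    obtain ⟨xb, hxb, hxbflow, -, -⟩ := (hE m).exists_flow hPC hpert0 hu.1 hu.2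
    have happ := approxFlow_eq huniq hxbflow
    refine ⟨huniq, fun j => ?_, fun j => ?_, hxflow m ⟨u, hu⟩, ?_, fun y hy hyb => ?_⟩
    · rw [hdom, happ]; exact hsub m j (hxb j)
    · rw [hdom]; exact hsub m j (hxmem m ⟨u, hu⟩ j)
    · exact (hE m).flowBounds_of_mem_tube hPC (hpert m) hb haStar_lt.le hrb hhδ hKc hxb
        (hxmem m ⟨u, hu⟩) happ (hxflow m ⟨u, hu⟩).init_K
        fun j => congrArg Prod.fst ((hxflow m ⟨u, hu⟩).step j)
    · exact hxuniq m ⟨u, hu⟩ y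
        ((hE m).mem_tube_of_flowBounds hPC hb hb1 haStar_lt.le hrb' hhδ hxb happ hyb) hy
  · intro j
    rw [continuousOn_iff_continuous_domRestrict]
    let X := ↥((Set.univ : Set E) ×ˢ N)
    have hm : Continuous fun p : X => p.1.1 := continuous_subtype_val.fst
    have hg : ∀ j, Continuous fun m => gSeq (P m).beta g₀' j :=
      continuous_gSeq hP.beta g₀'
    have hz : ∀ j, Continuous fun m => zBar (P m) (gSeq (P m).beta g₀') j :=
      continuous_zBar hP hg hE (abs_nonneg C) hdecay
    have hμ : ∀ j, Continuous fun m => muBar (P m) (gSeq (P m).beta g₀')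
        (zBar (P m) (gSeq (P m).beta g₀')) j := by
      refine continuous_muBar (fun j => ?_) (fun j => ?_) (q := (1 + lam₀) / 2) (by linarith)
        hmuC hmuS
      · exact ((hP.lam j).sub ((hP.ups_gmu j).mul (hg j))).sub ((hP.ups_zmu j).mul (hz j))
      · exact (((hP.eta j).mul (hg j)).add ((hP.gamma j).mul (hz j))).sub
          ((((hP.ups_gg j).mul ((hg j).pow 2)).add (((hP.ups_gz j).mul (hg j)).mul (hz j))).add
            ((hP.ups_zz j).mul ((hz j).pow 2)))
    have := continuous_flow (hP.comp hm) (fun p : X => hE p.1.1) hPC (fun p => hpert p.1.1)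
      (fun j => (hg j).comp hm) (fun j => (hz j).comp hm) (fun j => (hμ j).comp hm)
      (u := fun p : X => p.1.2) continuous_subtype_val.snd (fun p => p.2.2.1) (fun p => p.2.2.2)
      (fun j y hy hmem => (hev j).comp_continuous (hy.prodMk hm) fun p =>
        ⟨Set.mem_iUnion.2 ⟨p.1.1, by rw [hdom]; exact hmem p⟩, trivial⟩)
      (fun p => hdecay p.1.1) (x := fun p => x p.1.1 ⟨p.1.2, p.2.2⟩)
      (fun p => hxconv p.1.1 ⟨p.1.2, p.2.2⟩) j
    convert this using 2 with p
    simp only [Set.domRestrict_apply, p.2.2, dif_pos]
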